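/- **Setting.** Let $B$ be a negative braid word with $N$ Morse layers (layers are counted from bottom to top and each of them is one negative crossing of adjacent strands). A $1$-smoothing of a crossing consists of two vertical segments, a $0$-smoothing of a cap below a cup. Let $\Psi[\![B]\!]$ be the delooped Bar-Natan complex of $B$ over the dotted cobordism category $\operatorname{Mat}(\operatorname{Cob}^3_\bullet)$ over $\mathbb Z$ (sphere $=0$, dotted sphere $=1$, two dots $=0$, neck cutting). Its cells are the complete smoothings of $B$ in which every loop is coloured red or blue. The cell with $k$ $1$-smoothings, $r$ red and $s$ blue loops is the underlying loopless Temperley–Lieb diagram in homological degree $h=k-N$ and quantum degree $q=k-2N+r-s$. For a loop $l$ let $\max(l)$ be the highest layer that contains a piece of $l$. A cell is written as a word of length $N$ in the letters $0,\mathbf 0_{b},\mathbf 0_{r},1,\mathbf 1_{b},\mathbf 1_{r}$: the letters give the smoothings from bottom to top, and the colour of a loop $l$ is attached to the letter at position $\max(l)$. The matrix elements of the differential are the signed saddles, pre- and post-composed with delooping. For a matrix element $a\to b$ which is an isomorphism, let $i(a\to b)$ be the layer whose smoothing changes from $0$ to $1$, and let $u(a\to b)$ be the minimum of $\max(l)$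 over the red loops $l$ of $a$ that are merged and the blue loops $l$ of $b$ that are split off by $a\to b$. Let $A_{j,k}$ be the set of isomorphism matrix elements with $i=j$ and $u=k$, and recursively let $M_{j,k}$ be the set of those $(a\to b)\in A_{j,k}$ for which neither $a$ nor $b$ is an end of an edge in some $M_{l,m}$ with $m<k$, or with $m=k$ and $l>j$. The greedy matching is $M_{\mathrm{gr}}=\bigsqcup_{j,k}M_{j,k}$, and a cell is unmatched if it is not an end of any edge in $M_{\mathrm{gr}}$. Let $U_n$ be the set of unmatched cells for the braid word $(\sigma_1\sigma_2\sigma_3)^n$ on four strands. For a cell $w$ of $\Psi[\![(\sigma_1\sigma_2\sigma_3)^n]\!]$ put $$t_A(w)=-\tfrac12 n+\tfrac12 h(w)-\tfrac14 q(w)-1,\quad t_B(w)=3n-\tfrac32 h(w)+q(w)-\tfrac52,\quad t_C(w)=-\tfrac94 n+h(w)-\tfrac34 q(w)-\tfrac14,$$ and consider the words of length $12$ $$A=1^{12},\qquad B=1\,0\,1\,0\,1\,1\,\mathbf 0_b\,0\,0\,1\,1\,\mathbf 0_b,\qquad C=(0\,1\,\mathbf 0_b\,\mathbf 0_b\,0\,1)^2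 .$$ **Proposition.** For every $n\ge 0$ there are bijections $$\mathfrak a_n\colon\{w\in U_n: t_A(w)\ge1\}\to\{w\in U_{n+4}: t_A(w)\ge2\},$$ $$\mathfrak b_n\colon\{w\in U_n: t_B(w)\ge1\}\to\{w\in U_{n+4}: t_B(w)\ge2\},$$ $$\mathfrak c_n\colon\{w\in U_n: t_C(w)\ge1\}\to\{w\in U_{n+4}: t_C(w)\ge2\}$$ such that every word $w$ in the domain of $\mathfrak a_n$ (respectively $\mathfrak b_n$, $\mathfrak c_n$) contains $A$ (respectively $B$, $C$) as a subword of consecutive letters, and its image is obtained by replacing the first occurrence of this block by two consecutive copies of it. The bijections preserve the connectivity of the underlying Temperley–Lieb diagrams, and $$w_1=\mathfrak a_n(w_1)\{12\},\qquad w_2=\mathfrak b_n(w_2)[6]\{20\},\qquad w_3=\mathfrak c_n(w_3)[8]\{24\}$$ as graded objects for all $w_1,w_2,w_3$ in the respective domains, where $[x]\{y\}$ raises the homological degree by $x$ and the quantum degree by $y$. That is, $(h,q)(w_1)=(h,q)(\mathfrak a_n(w_1))+(0,12)$, $(h,q)(w_2)=(h,q)(\mathfrak b_n(w_2))+(6,20)$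 and $(h,q)(w_3)=(h,q)(\mathfrak c_n(w_3))+(8,24)$. -/

import Mathlib

namespace GreedyKhovanov

/-! ## Negative braid words, smoothings and symbolic words

A negative braid word on `m + 1` strands is a list of generators `Fin m`, read from bottom to top;
the entry `i` is one Morse layer in which the strands in positions `i` and `i + 1` cross negatively.
Morse layers are counted from `0`: layer `j` lies between level `j` and level `j + 1`. -/

inductive Smoothing where
  | zero
  | one
  deriving DecidableEq

inductive Color where
  | blue
  | red
  deriving DecidableEq

/-- The characters that can occur at a crossing: a smoothing, possibly engraved with the colour of
the loop whose highest Morse layer is the layer of the character. -/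
inductive Letter where
  | zero
  | blueZero
  | redZero
  | one
  | blueOne
  | redOne
  deriving DecidableEq

def Letter.smoothing : Letter → Smoothing
  | .zero | .blueZero | .redZero => .zero
  | .one | .blueOne | .redOne => .one

def Letter.color : Letter → Option Color
  | .zero | .one => none
  | .blueZero | .blueOne => some .blue
  | .redZero | .redOne => some .red

abbrev Word := List Letter

/-- The number of letters of a word that are `1`-smoothings. -/
def onesCount (w : Word) : ℕ := w.countP (fun x => x.smoothing = .one)

/-- The number of letters of a word that carry the given colour. -/
def colorCount (c : Color) (w : Word) : ℕ := w.countP (fun x => x.color = some c)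

variable {m : ℕ}

/-- The points in which the strands meet the levels `0, …, N` of a diagram with `N` Morse layers. -/
abbrev Point (B : List (Fin m)) := Fin (B.length + 1) × Fin (m + 1)

/-- The segments of the smoothed diagram. A `1`-smoothed crossing is replaced by two vertical
segments, a `0`-smoothed one by a cap (attached to the level below) and a cup (attached to the level
above); all other strands of the layer are vertical. -/
inductive Segment (B : List (Fin m)) (w : Word) : Point B → Point B → Prop
  | vertical (j : Fin B.length) (x : Letter) (p : Fin (m + 1)) (hx : w[(j : ℕ)]? = some x)
      (hp : x.smoothing = .one ∨ (p ≠ (B.get j).castSucc ∧ p ≠ (B.get j).succ)) :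
      Segment B w (j.castSucc, p) (j.succ, p)
  | cap (j : Fin B.length) (x : Letter) (hx : w[(j : ℕ)]? = some x) (h0 : x.smoothing = .zero) :
      Segment B w (j.castSucc, (B.get j).castSucc) (j.castSucc, (B.get j).succ)
  | cup (j : Fin B.length) (x : Letter) (hx : w[(j : ℕ)]? = some x) (h0 : x.smoothing = .zero) :
      Segment B w (j.succ, (B.get j).castSucc) (j.succ, (B.get j).succ)

/-- Two points are related when they lie on the same component of the smoothed diagram. -/
def components (B : List (Fin m)) (w : Word) : Setoid (Point B) :=
  Relation.EqvGen.setoid (Segment B w)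

abbrev Component (B : List (Fin m)) (w : Word) := Quotient (components B w)

/-- The component through a given point. -/
def componentOf (B : List (Fin m)) (w : Word) (x : Point B) : Component B w :=
  Quotient.mk (components B w) x

/-- The endpoints of a tangle on `m + 1` strands: `(false, p)` at the bottom, `(true, p)` at the
top. -/
abbrev Endpoint (m : ℕ) := Bool × Fin (m + 1)

def endpoint (B : List (Fin m)) (e : Endpoint m) : Point B :=
  (if e.1 then Fin.last B.length else 0, e.2)

/-- A component is a loop when it does not reach the boundary; the other components are arcs. -/
def IsLoop (B : List (Fin m)) (w : Word) (c : Component B w) : Prop :=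
  ∀ e : Endpoint m, componentOf B w (endpoint B e) ≠ c

/-- The highest Morse layer that contains a piece of the loop `c`: if the highest points of `c` in
which it meets a level are on level `j`, then `c` is closed off by a cap in layer `j`. -/
noncomputable def maxLayer (B : List (Fin m)) (w : Word) (c : Component B w) : ℕ :=
  sSup {j : ℕ | ∃ x : Point B, componentOf B w x = c ∧ (x.1 : ℕ) = j}

/-- `w` is the symbolic encoding of a cell of the delooped hypercube complex of `B`: a choice of
smoothings together with a choice of a colour for every loop, the colour of a loop `c` being
engraved in the letter at position `maxLayer B w c`. -/
def IsCell (B : List (Fin m)) (w : Word) : Prop :=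
  w.length = B.length ∧
    ∀ (j : ℕ) (x : Letter), w[j]? = some x →
      (x.color ≠ none ↔ ∃ c : Component B w, IsLoop B w c ∧ maxLayer B w c = j)

noncomputable def loopColor (B : List (Fin m)) (w : Word) (c : Component B w) : Option Color :=
  (w[maxLayer B w c]?).bind Letter.color

/-! ## Loopless diagrams and the dotted cobordism category

A loopless diagram is recorded by its connectivity, the relation on the endpoints of being joined by
an arc. -/

abbrev Diagram (m : ℕ) := Setoid (Endpoint m)

/-- The loopless diagram that underlies a cell: its arcs, the loops being removed. -/
def underlying (B : List (Fin m)) (w : Word) : Diagram m :=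
  (components B w).comap (endpoint B)

/-- The summand `α[h]{q}`: a loopless diagram with a homological degree and a quantum degree. -/
structure GradedDiagram (m : ℕ) where
  diagram : Diagram m
  hdeg : ℤ
  qdeg : ℤ

/-- The grading shift `X[a]{b}`. -/
def GradedDiagram.shift (X : GradedDiagram m) (a b : ℤ) : GradedDiagram m :=
  ⟨X.diagram, X.hdeg + a, X.qdeg + b⟩

/-- The boundary circles of a cobordism from `α` to `β`: the components of the closed curve
obtained by gluing `α` and `β` along their endpoints. -/
abbrev Circle (α β : Diagram m) := Quotient (α ⊔ β)

/-- Morphisms `α → β` between loopless diagrams in the category of dotted cobordisms over `ℤ` modulo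
the relations sphere `= 0`, dotted sphere `= 1`, two dots `= 0` and neck cutting. By these relations
the cobordisms that consist of one disc for each boundary circle, each disc with at most one dot,
form a basis of the morphism group; the basis element given by `S` has its dots on the discs that
bound the circles in `S`, and a morphism is the function of its coefficients. -/
abbrev CobHom (α β : Diagram m) := Set (Circle α β) → ℤ

/-- The classes of `r` that meet the class `k` of `s`. -/
def pieces {X : Type*} (r s : Setoid X) (k : Quotient s) : Set (Quotient r) :=
  {c | ∃ x : X, Quotient.mk r x = c ∧ Quotient.mk s x = k}

/-- The contribution of one connected component of a cobordism, with Euler characteristic `χ`,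
`b` boundary circles and `d` dots, to the coefficient of a basis element in which `v` of these `b`
circles bound an undotted disc. The genus is `g = (2 - b - χ) / 2`, a handle equals twice a dot, and
cutting necks turns a surface of genus `0` without dots into the sum of the ways to leave exactly
one disc undotted, a surface of genus `0` with one dot into the discs that are all dotted, and
a surface with more dots into `0`; for `b = 0` this reads sphere `= 0`, dotted sphere `= 1`. -/
def surfaceCoeff (χ : ℤ) (b d v : ℕ) : ℤ :=
  if (2 - b - χ) / 2 + d + v = 1 then 2 ^ ((2 - b - χ) / 2).toNat else 0

open Classical in
/-- The identity cobordism of `α`: the undotted discs `arc × [0, 1]`. -/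
noncomputable def cobId (α : Diagram m) : CobHom α α :=
  fun U => if U = ∅ then 1 else 0

/-- Composition: the discs of `S` and `T` are glued along the arcs of `β`. The components `k` of the
resulting surface are the classes of `α ⊔ β ⊔ γ`, and the Euler characteristic of such a component
is its number of discs minus its number of arcs of `β`. -/
noncomputable def cobComp {α β γ : Diagram m} (f : CobHom α β) (g : CobHom β γ) : CobHom α γ :=
  fun U => ∑ᶠ (S : Set (Circle α β)) (T : Set (Circle β γ)), f S * g T *
    ∏ᶠ k : Quotient (α ⊔ β ⊔ γ),
      surfaceCoeff
        ((pieces (α ⊔ β) (α ⊔ β ⊔ γ) k).ncard + (pieces (β ⊔ γ) (α ⊔ β ⊔ γ) k).ncard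
          - (pieces β (α ⊔ β ⊔ γ) k).ncard)
        (pieces (α ⊔ γ) (α ⊔ β ⊔ γ) k).ncard
        ((pieces (α ⊔ β) (α ⊔ β ⊔ γ) k ∩ S).ncard + (pieces (β ⊔ γ) (α ⊔ β ⊔ γ) k ∩ T).ncard)
        (pieces (α ⊔ γ) (α ⊔ β ⊔ γ) k \ U).ncard

def IsCobIso {α β : Diagram m} (f : CobHom α β) : Prop :=
  ∃ g : CobHom β α, cobComp f g = cobId α ∧ cobComp g f = cobId β

/-! ## The delooped hypercube complex -/

/-- The homological degree `k - n₋`, where `k` is the number of `1`-smoothings and all `n₋` crossings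
are negative. -/
def hdeg (B : List (Fin m)) (w : Word) : ℤ := (onesCount w : ℤ) - B.length

/-- The quantum degree `k + n₊ - 2 n₋`, increased by `1` for every red loop and decreased by `1` for
every blue loop. -/
def qdeg (B : List (Fin m)) (w : Word) : ℤ :=
  (onesCount w : ℤ) - 2 * B.length + colorCount .red w - colorCount .blue w

/-- A cell as an object: its loopless diagram with its degrees. -/
def cellObject (B : List (Fin m)) (w : Word) : GradedDiagram m :=
  ⟨underlying B w, hdeg B w, qdeg B w⟩

/-- `b` arises from `a` by changing the smoothing of the crossing in layer `j` from `0` to `1` and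
keeping all other smoothings. -/
def ChangesAt (B : List (Fin m)) (a b : Word) (j : Fin B.length) : Prop :=
  (a[(j : ℕ)]?).map Letter.smoothing = some .zero ∧
  (b[(j : ℕ)]?).map Letter.smoothing = some .one ∧
  ∀ l : ℕ, l ≠ j → (a[l]?).map Letter.smoothing = (b[l]?).map Letter.smoothing

/-- The components of the saddle cobordism from the smoothed diagram of `a` to that of `b`. -/
abbrev SaddleComponent (B : List (Fin m)) (a b : Word) :=
  Quotient (components B a ⊔ components B b)

/-- The boundary circles of the component `k` of the cobordism that is obtained from the saddle by
capping off all loops. -/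
def saddleCircles (B : List (Fin m)) (a b : Word) (k : SaddleComponent B a b) :
    Set (Circle (underlying B a) (underlying B b)) :=
  {c | ∃ e : Endpoint m, Quotient.mk _ e = c ∧ Quotient.mk _ (endpoint B e) = k}

open Classical in
/-- The Euler characteristic of the component `k` of the cobordism that is obtained from the saddle
in layer `j` by capping off all loops of `a` and `b` with discs: each arc of `a` gives a disc
`arc × [0, 1]`, each loop of `a` an annulus, the saddle subtracts `1`, each capping disc adds `1`. -/
noncomputable def saddleEuler (B : List (Fin m)) (a b : Word) (j : Fin B.length)
    (k : SaddleComponent B a b) : ℤ :=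
  ({c ∈ pieces (components B a) (components B a ⊔ components B b) k | ¬ IsLoop B a c}.ncard : ℤ)
    - (if Quotient.mk _ (j.castSucc, (B.get j).castSucc) = k then 1 else 0)
    + {c ∈ pieces (components B a) (components B a ⊔ components B b) k | IsLoop B a c}.ncard
    + {c ∈ pieces (components B b) (components B a ⊔ components B b) k | IsLoop B b c}.ncard

/-- The number of dots on the component `k`. The delooping isomorphism caps a red loop of `b` with a
dotted disc and a blue one with an undotted disc; its inverse caps a blue loop of `a` with a dotted
disc and a red one with an undotted disc. -/
noncomputable def saddleDots (B : List (Fin m)) (a b : Word) (k : SaddleComponent B a b) : ℕ :=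
  {c ∈ pieces (components B a) (components B a ⊔ components B b) k |
    IsLoop B a c ∧ loopColor B a c = some .blue}.ncard
  + {c ∈ pieces (components B b) (components B a ⊔ components B b) k |
    IsLoop B b c ∧ loopColor B b c = some .red}.ncard

/-- The matrix element `a → b` of the delooped hypercube complex for cells with
`ChangesAt B a b j`: the signed saddle, preceded by the inverse delooping of `a` and followed by the
delooping of `b`, written in the basis of dotted discs. -/
noncomputable def matrixElement (B : List (Fin m)) (a b : Word) (j : Fin B.length) :
    CobHom (underlying B a) (underlying B b) :=
  fun U => (-1) ^ onesCount (a.take j) *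
    ∏ᶠ k : SaddleComponent B a b,
      surfaceCoeff (saddleEuler B a b j k) (saddleCircles B a b k).ncard (saddleDots B a b k)
        (saddleCircles B a b k \ U).ncard

/-! ## The greedy matching -/

/-- The component of `a` through the lower arc (the cap) of the `0`-smoothed crossing in layer
`j`. -/
def lowerArc (B : List (Fin m)) (a : Word) (j : Fin B.length) : Component B a :=
  componentOf B a (j.castSucc, (B.get j).castSucc)

/-- The component of `a` through the upper arc (the cup) of the `0`-smoothed crossing in layer
`j`. -/
def upperArc (B : List (Fin m)) (a : Word) (j : Fin B.length) : Component B a :=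
  componentOf B a (j.succ, (B.get j).castSucc)

/-- The component of `b` through the left arc of the `1`-smoothed crossing in layer `j`. -/
def leftArc (B : List (Fin m)) (b : Word) (j : Fin B.length) : Component B b :=
  componentOf B b (j.castSucc, (B.get j).castSucc)

/-- The component of `b` through the right arc of the `1`-smoothed crossing in layer `j`. -/
def rightArc (B : List (Fin m)) (b : Word) (j : Fin B.length) : Component B b :=
  componentOf B b (j.castSucc, (B.get j).succ)

/-- The red loops of `a` that are merged with another component by the saddle in layer `j`. -/
def mergedRedLoops (B : List (Fin m)) (a : Word) (j : Fin B.length) : Set (Component B a) :=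
  {c | IsLoop B a c ∧ loopColor B a c = some .red ∧ lowerArc B a j ≠ upperArc B a j ∧
    (c = lowerArc B a j ∨ c = upperArc B a j)}

/-- The blue loops of `b` that are split off another component by the saddle in layer `j`. -/
def splitBlueLoops (B : List (Fin m)) (b : Word) (j : Fin B.length) : Set (Component B b) :=
  {c | IsLoop B b c ∧ loopColor B b c = some .blue ∧ leftArc B b j ≠ rightArc B b j ∧
    (c = leftArc B b j ∨ c = rightArc B b j)}

/-- The set `A_{j,k}` of the isomorphisms `a → b` among the matrix elements with `i(a → b) = j`, the
changed layer, and `u(a → b) = k`, the least `maxLayer` of a merged red or split off blue loop. -/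
def isoEdges (B : List (Fin m)) (j : Fin B.length) (k : ℕ) : Set (Word × Word) :=
  {e | IsCell B e.1 ∧ IsCell B e.2 ∧ ChangesAt B e.1 e.2 j ∧
    IsCobIso (matrixElement B e.1 e.2 j) ∧
    IsLeast (maxLayer B e.1 '' mergedRedLoops B e.1 j ∪ maxLayer B e.2 '' splitBlueLoops B e.2 j) k}

/-- The set `M_{j,k}` of the edges in `A_{j,k}` whose ends are not matched in an earlier `M_{l,r}`;
earlier means `r < k`, or `r = k` and `l > j`. -/
def greedyPart (B : List (Fin m)) (j : Fin B.length) (k : ℕ) : Set (Word × Word) :=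
  {e | e ∈ isoEdges B j k ∧
    ∀ (l : Fin B.length) (r : ℕ) (_ : r < k ∨ (r = k ∧ j < l)), ∀ e' ∈ greedyPart B l r,
      e.1 ≠ e'.1 ∧ e.1 ≠ e'.2 ∧ e.2 ≠ e'.1 ∧ e.2 ≠ e'.2}
termination_by (k, B.length - (j : ℕ))
decreasing_by
  rename_i h
  rcases h with h | ⟨rfl, h⟩
  · exact Prod.Lex.left _ _ h
  · refine Prod.Lex.right _ ?_
    have := l.isLt
    have : (j : ℕ) < l := h
    omega

def greedyMatching (B : List (Fin m)) : Set (Word × Word) :=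
  {e | ∃ (j : Fin B.length) (k : ℕ), e ∈ greedyPart B j k}

/-- The cells that are neither the domain nor the codomain of an edge in the greedy matching. -/
def unmatchedCells (B : List (Fin m)) : Set Word :=
  {w | IsCell B w ∧ ∀ e ∈ greedyMatching B, w ≠ e.1 ∧ w ≠ e.2}

/-! ## The braids `(σ₁σ₂σ₃)ⁿ` -/

/-- The braid word `(σ₁σ₂σ₃)ⁿ` on four strands. -/
def torusBraid (n : ℕ) : List (Fin 3) := (List.replicate n [0, 1, 2]).flatten

/-- The set `U_n`. -/
def U (n : ℕ) : Set Word := unmatchedCells (torusBraid n)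

noncomputable def tA (n : ℕ) (w : Word) : ℝ :=
  -(1 / 2) * n + 1 / 2 * hdeg (torusBraid n) w - 1 / 4 * qdeg (torusBraid n) w - 1

noncomputable def tB (n : ℕ) (w : Word) : ℝ :=
  3 * n - 3 / 2 * hdeg (torusBraid n) w + qdeg (torusBraid n) w - 5 / 2

noncomputable def tC (n : ℕ) (w : Word) : ℝ :=
  -(9 / 4) * n + hdeg (torusBraid n) w - 3 / 4 * qdeg (torusBraid n) w - 1 / 4

def blockA : Word := List.replicate 12 .one

def blockB : Word :=
  [.one, .zero, .one, .zero, .one, .one, .blueZero, .zero, .zero, .one, .one, .blueZero]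

def blockC : Word :=
  [.zero, .one, .blueZero, .blueZero, .zero, .one, .zero, .one, .blueZero, .blueZero, .zero, .one]

/-- `w'` arises from `w` by replacing the first occurrence of the subword `s` by `s ++ s`. -/
def DuplicatesFirst (s w w' : Word) : Prop :=
  ∃ x y : Word, w = x ++ s ++ y ∧ w' = x ++ s ++ s ++ y ∧
    ∀ x' y' : Word, w = x' ++ s ++ y' → x.length ≤ x'.length

end GreedyKhovanov

/-! The greedy matching is local, and a finite automaton recognises its unmatched cells. Read a cell
from bottom to top and record how the part read so far joins its eight endpoints. Stage `k` of the
matching is governed by a loop whose highest layer is `k`. If a cap in layer `k` would close off a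
loop, the letters red `0` and `1` there are paired with each other, so only blue `0` can survive.
The other pairs that are needed split off a blue loop: `00` against `1` and blue `0`, or `0x0`
against `1x` and blue `0`. After a common prefix the survival of the next letter depends on one of
73 states only. `matchedBelow` shows by induction on `k` that the cells matched before stage `k` are
those with a rejected prefix of length `k`; hence `mem_U_iff`: the unmatched cells are the accepted
words of length `3 * n`.

The induction step has two halves. For completeness (`touched_of_not_alive`), a finite check finds a
partner for each rejected continuation; the partner is again a cell because both prefixes induce the
same matching of endpoints, and the saddle is an isomorphism because it merges a red loop or splits
off a blue one (`Absorbs`). For soundness (`not_alive_of_touched_self`), the ends of an edge differ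
in one smoothing, so the pairs of states along them stay in a finite table, and inspection of the
table shows that both ends are rejected. The geometric input is that a loop closed off after an
accepted prefix has height two, except in two states, whose loops are confined to a short window.

With the automaton at hand, `tA`, `tB` and `tC` become affine functions of weights that are additive
along paths. For each block a table bounds the weight of all paths that have not yet traversed the
block twice in succession (`IsDuplicable`). Thus a large weight forces an occurrence of the block,
and a larger one forces a second copy directly after the first occurrence. The block fixes every
state in which it can end, so inserting or deleting a copy preserves acceptance and the final
matching. This yields the bijections and the connectivity; the degrees change by the letter counts
of the block. -/

namespace GreedyKhovanov

/-! ## Connectivity of smoothed diagrams in natural-number coordinates -/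

/-- The segments in layer `j` of the smoothing `σ` of the periodic braid `σ₁σ₂σ₃σ₁σ₂σ₃…`. -/
inductive Seg (σ : ℕ → Option Smoothing) (j : ℕ) : ℕ × ℕ → ℕ × ℕ → Prop
  | vertical (p : ℕ) (hp : p < 4)
      (h : σ j = some .one ∨ σ j = some .zero ∧ p ≠ j % 3 ∧ p ≠ j % 3 + 1) :
      Seg σ j (j, p) (j + 1, p)
  | cap (h : σ j = some .zero) : Seg σ j (j, j % 3) (j, j % 3 + 1)
  | cup (h : σ j = some .zero) : Seg σ j (j + 1, j % 3) (j + 1, j % 3 + 1)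

/-- Connectivity by the segments in the layers below level `k`. -/
def Conn (σ : ℕ → Option Smoothing) (k : ℕ) : ℕ × ℕ → ℕ × ℕ → Prop :=
  Relation.EqvGen fun x y => ∃ j < k, Seg σ j x y

section Conn

variable {σ τ : ℕ → Option Smoothing} {k l : ℕ} {x y z : ℕ × ℕ}

theorem Conn.refl (σ : ℕ → Option Smoothing) (k : ℕ) (x : ℕ × ℕ) : Conn σ k x x :=
  Relation.EqvGen.refl x

theorem Conn.symm (h : Conn σ k x y) : Conn σ k y x := Relation.EqvGen.symm _ _ h

theorem Conn.trans (h : Conn σ k x y) (h' : Conn σ k y z) : Conn σ k x z :=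
  Relation.EqvGen.trans _ _ _ h h'

theorem Seg.conn {j : ℕ} (h : Seg σ j x y) (hj : j < k) : Conn σ k x y :=
  Relation.EqvGen.rel _ _ ⟨j, hj, h⟩

/-- The device behind every proof of non-connectivity: an invariant of segments is an invariant of
components. The labels used later are sets of points, optional classes or truth values. -/
theorem Conn.label {β : Type*} (f : ℕ × ℕ → β)
    (hf : ∀ j < k, ∀ x y, Seg σ j x y → f x = f y) (h : Conn σ k x y) : f x = f y := by
  induction h with
  | rel x y h => obtain ⟨j, hj, h⟩ := h; exact hf j hj x y h
  | refl x => rfl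
  | symm x y _ ih => exact ih.symm
  | trans x y z _ _ ih ih' => exact ih.trans ih'

theorem Conn.mono (hkl : k ≤ l) (h : Conn σ k x y) : Conn σ l x y :=
  Relation.EqvGen.mono (fun _ _ ⟨j, hj, h⟩ => ⟨j, hj.trans_le hkl, h⟩) _ _ h

theorem Seg.congr {j : ℕ} (e : σ j = τ j) (h : Seg σ j x y) : Seg τ j x y := by
  cases h with
  | vertical p hp h => exact .vertical p hp (e ▸ h)
  | cap h => exact .cap (e ▸ h)
  | cup h => exact .cup (e ▸ h)

theorem Conn.congr (e : ∀ j < k, σ j = τ j) (h : Conn σ k x y) : Conn τ k x y :=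
  Relation.EqvGen.mono (fun _ _ ⟨j, hj, h⟩ => ⟨j, hj, h.congr (e j hj)⟩) _ _ h

theorem Seg.level {j : ℕ} (h : Seg σ j x y) :
    (j ≤ x.1 ∧ x.1 ≤ j + 1) ∧ (j ≤ y.1 ∧ y.1 ≤ j + 1) := by
  cases h <;> simp

/-- The endpoint number `e < 8` of the prefix of height `k`: `0, …, 3` at the bottom and
`4, …, 7` at the top. -/
def ep (k e : ℕ) : ℕ × ℕ := if e < 4 then (0, e) else (k, e - 4)

theorem ep_top {k e : ℕ} (h : 4 ≤ e) : ep k e = (k, e - 4) := by simp [ep, not_lt.2 h]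

theorem ep_bottom {k e : ℕ} (h : e < 4) : ep k e = (0, e) := by simp [ep, h]

/-- The involution `f` describes how the prefix of height `k` joins its eight endpoints. -/
structure IsMatching (σ : ℕ → Option Smoothing) (k : ℕ) (f : ℕ → ℕ) : Prop where
  lt : ∀ e < 8, f e < 8
  invol : ∀ e < 8, f (f e) = e
  ne : ∀ e < 8, f e ≠ e
  conn : ∀ e < 8, ∀ e' < 8, Conn σ k (ep k e) (ep k e') ↔ e' = e ∨ e' = f e

/-- The effect of a cap and a cup at position `i` on a matching. -/
def capCup (i : ℕ) (f : ℕ → ℕ) : ℕ → ℕ := fun e =>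
  if f (4 + i) = 5 + i then f e
  else if e = 4 + i then 5 + i
  else if e = 5 + i then 4 + i
  else if e = f (4 + i) then f (5 + i)
  else if e = f (5 + i) then f (4 + i)
  else f e

def initialMatching : ℕ → ℕ := fun e => (e + 4) % 8

theorem conn_zero : Conn σ 0 x y ↔ x = y :=
  ⟨fun h => h.label id (fun j hj => absurd hj (Nat.not_lt_zero j)), fun h => h ▸ Conn.refl σ 0 x⟩

theorem isMatching_zero (σ : ℕ → Option Smoothing) : IsMatching σ 0 initialMatching where
  lt := by decide
  invol := by decide
  ne := by decide
  conn := by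
    simp only [conn_zero]
    decide

theorem IsMatching.congr {f g : ℕ → ℕ} (h : IsMatching σ k f) (e : ∀ i < 8, f i = g i) :
    IsMatching σ k g where
  lt i hi := e i hi ▸ h.lt i hi
  invol i hi := by rw [← e i hi, ← e _ (h.lt i hi), h.invol i hi]
  ne i hi := e i hi ▸ h.ne i hi
  conn i hi j hj := e i hi ▸ h.conn i hi j hj

theorem Conn.level_lt (h : Conn σ k x y) (hx : k < x.1) : x = y := by
  classical
  have := h.label (fun z => if k < z.1 then some z else none) (by
    intro j hj x y hxy
    have := hxy.level
    rw [if_neg (by omega), if_neg (by omega)])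
  simp only [hx, if_true] at this
  split_ifs at this
  exact Option.some_injective _ this

/-- Four vertical segments only lengthen the strands, so pushing level `k + 1` down to level `k`
respects connectivity. -/
theorem IsMatching.one {f : ℕ → ℕ} (h : IsMatching σ k f) (hσ : σ k = some .one) :
    IsMatching σ (k + 1) f where
  lt := h.lt
  invol := h.invol
  ne := h.ne
  conn e he e' he' := by
    rw [← h.conn e he e' he']
    have up : ∀ e < 8, Conn σ (k + 1) (ep k e) (ep (k + 1) e) := by
      intro e he
      by_cases h4 : e < 4
      · rw [ep_bottom h4, ep_bottom h4]; exact Conn.refl _ _ _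
      · rw [ep_top (not_lt.1 h4), ep_top (not_lt.1 h4)]
        exact (Seg.vertical _ (by omega) (.inl hσ)).conn (Nat.lt_succ_self k)
    constructor
    · intro hc
      have := hc.label (fun z => {t | Conn σ k (min k z.1, z.2) t}) (by
        intro j hj x y hxy
        rcases (Nat.lt_succ_iff_lt_or_eq.1 hj) with hj | rfl
        · have := hxy.level
          rw [min_eq_right (by omega), min_eq_right (by omega)]
          have hxy := hxy.conn hj
          ext t
          exact ⟨hxy.symm.trans, hxy.trans⟩
        · cases hxy with
          | vertical p hp h => simp
          | cap h => simp [h] at hσ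
          | cup h => simp [h] at hσ)
      have low : ∀ e, (min k (ep (k + 1) e).1, (ep (k + 1) e).2) = ep k e := by
        intro e; unfold ep; split_ifs <;> simp
      simp only [low] at this
      have h' : ep k e' ∈ {t | Conn σ k (ep k e') t} := Conn.refl _ _ _
      rw [← this] at h'
      exact h'
    · intro hc
      exact ((up e he).symm.trans (hc.mono (Nat.le_succ k))).trans (up e' he')

theorem capCup_lt {f : ℕ → ℕ} {i : ℕ} (hi : i < 3) (hlt : ∀ e < 8, f e < 8) {e : ℕ} (he : e < 8) :
    capCup i f e < 8 := by
  have := hlt e he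
  have := hlt (4 + i) (by omega)
  have := hlt (5 + i) (by omega)
  unfold capCup
  split_ifs <;> omega

theorem capCup_invol {f : ℕ → ℕ} {i : ℕ} (hi : i < 3) (hinv : ∀ e < 8, f (f e) = e)
    (hne : ∀ e < 8, f e ≠ e) {e : ℕ} (he : e < 8) : capCup i f (capCup i f e) = e := by
  have h4 := hinv e he
  have h5 := hinv (4 + i) (by omega)
  have h6 := hinv (5 + i) (by omega)
  have h7 := hne e he
  have h8 := hne (4 + i) (by omega)
  have h9 := hne (5 + i) (by omega)
  clear hinv hne
  unfold capCup
  grind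

theorem capCup_ne {f : ℕ → ℕ} {i : ℕ} (hi : i < 3) (hinv : ∀ e < 8, f (f e) = e)
    (hne : ∀ e < 8, f e ≠ e) {e : ℕ} (he : e < 8) : capCup i f e ≠ e := by
  have h4 := hinv e he
  have h5 := hinv (4 + i) (by omega)
  have h6 := hinv (5 + i) (by omega)
  have h7 := hne e he
  have h8 := hne (4 + i) (by omega)
  have h9 := hne (5 + i) (by omega)
  clear hinv hne
  unfold capCup
  grind

theorem capCup_special {f : ℕ → ℕ} {i : ℕ} (hi : i < 3) (hinv : ∀ e < 8, f (f e) = e)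
    {e e' : ℕ} (h : e = 4 + i ∨ e = 5 + i) (h' : e' = 4 + i ∨ e' = 5 + i) :
    e' = e ∨ e' = capCup i f e := by
  have h5 := hinv (4 + i) (by omega)
  have h6 := hinv (5 + i) (by omega)
  clear hinv
  unfold capCup
  grind

/-- The hypothesis `key` lists the ways in which `e` and `e'` can become equivalent once the class
of the right foot `5 + i` of the cap is merged into that of the left foot `4 + i`. -/
theorem capCup_join {f : ℕ → ℕ} {i : ℕ} (hi : i < 3) (hinv : ∀ e < 8, f (f e) = e)
    (hne : ∀ e < 8, f e ≠ e) {e e' : ℕ} (he : e < 8) (he' : e' < 8)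
    (h : ¬(e = 4 + i ∨ e = 5 + i)) (h' : ¬(e' = 4 + i ∨ e' = 5 + i))
    (key : (5 + i = f e ∧ 5 + i = f e') ∨ (5 + i = f e ∧ e' = f (4 + i)) ∨
      (5 + i = f e' ∧ 4 + i = f e) ∨ (5 + i ≠ f e ∧ 5 + i ≠ f e' ∧ (e' = e ∨ e' = f e))) :
    e' = e ∨ e' = capCup i f e := by
  have h4 := hinv e he
  have h10 := hinv e' he'
  have h5 := hinv (4 + i) (by omega)
  have h6 := hinv (5 + i) (by omega)
  have h7 := hne e he
  clear hinv hne
  unfold capCup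
  grind

/-- The cup is a new component and the cap merges two old classes. Labelling the cup by `none` and
every other point by its old class after the merger leaves only the connections that `capCup`
allows. -/
theorem IsMatching.eq_of_conn_zero {f : ℕ → ℕ} (h : IsMatching σ k f) (hσ : σ k = some .zero)
    {e e' : ℕ} (he : e < 8) (he' : e' < 8) (hc : Conn σ (k + 1) (ep (k + 1) e) (ep (k + 1) e')) :
    e' = e ∨ e' = capCup (k % 3) f e := by
  classical
  have hi : k % 3 < 3 := Nat.mod_lt _ (by norm_num)
  set i := k % 3 with hidef
  have hx8 : 4 + i < 8 := by omega
  have hy8 : 5 + i < 8 := by omega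
  let cls : ℕ × ℕ → Set (ℕ × ℕ) := fun z => {t | Conn σ k z t}
  have cls_eq : ∀ z z', cls z = cls z' ↔ Conn σ k z z' := by
    intro z z'
    constructor
    · intro he
      have : z' ∈ cls z' := Conn.refl _ _ _
      rw [← he] at this
      exact this
    · intro he
      ext t
      exact ⟨he.symm.trans, he.trans⟩
  -- The old class of a point, with the class of the right foot of the cap replaced by that of the
  -- left foot.
  let mcls : ℕ × ℕ → Set (ℕ × ℕ) := fun z =>
    if Conn σ k z (k, i + 1) then cls (k, i) else cls z
  have mcls_eq : ∀ z z', Conn σ k z z' → mcls z = mcls z' := by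
    intro z z' he
    simp only [mcls]
    by_cases h1 : Conn σ k z (k, i + 1)
    · rw [if_pos h1, if_pos (he.symm.trans h1)]
    · rw [if_neg h1, if_neg (fun h2 => h1 (he.trans h2)), cls_eq]
      exact he
  have := hc.label (fun z => if z = (k + 1, i) ∨ z = (k + 1, i + 1) then none
      else some (mcls (min k z.1, z.2))) (by
    intro j hj x y hxy
    rcases (Nat.lt_succ_iff_lt_or_eq.1 hj) with hj | rfl
    · have hl := hxy.level
      rw [if_neg (by rintro (rfl | rfl) <;> simp at hl <;> omega),
        if_neg (by rintro (rfl | rfl) <;> simp at hl <;> omega),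
        min_eq_right (by omega), min_eq_right (by omega)]
      exact congrArg some (mcls_eq _ _ (hxy.conn hj))
    · cases hxy with
      | vertical p hp h =>
        have : p ≠ i ∧ p ≠ i + 1 := by
          rcases h with h | h
          · simp [h] at hσ
          · exact h.2
        simp [this.1, this.2]
      | cap _ =>
        simp only [← hidef, Prod.mk.injEq, Nat.left_eq_add, one_ne_zero, false_and, or_self,
          if_false, min_self, Option.some.injEq]
        simp only [mcls]
        by_cases h1 : Conn σ j (j, i) (j, i + 1)
        · rw [if_pos h1, if_pos (Conn.refl _ _ _)]
        · rw [if_neg h1, if_pos (Conn.refl _ _ _)]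
      | cup _ => simp [← hidef])
  have low : ∀ e, (min k (ep (k + 1) e).1, (ep (k + 1) e).2) = ep k e := by
    intro e; unfold ep; split_ifs <;> simp
  have special : ∀ e < 8, (ep (k + 1) e = (k + 1, i) ∨ ep (k + 1) e = (k + 1, i + 1)) ↔
      e = 4 + i ∨ e = 5 + i := by
    intro e he
    unfold ep
    split_ifs with h4
    · simp; omega
    · simp only [Prod.mk.injEq, true_and]; omega
  simp only [low, special e he, special e' he'] at this
  have y_eq : (k, i + 1) = ep k (5 + i) := by
    rw [ep_top (by omega)]; congr 1; omega
  have x_eq : (k, i) = ep k (4 + i) := by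
    rw [ep_top (by omega)]; congr 1; omega
  by_cases c1 : e = 4 + i ∨ e = 5 + i
  · by_cases c2 : e' = 4 + i ∨ e' = 5 + i
    · exact capCup_special hi h.invol c1 c2
    · simp [c1, c2] at this
  · by_cases c2 : e' = 4 + i ∨ e' = 5 + i
    · simp [c1, c2] at this
    · simp only [c1, c2, if_false, Option.some.injEq, mcls, y_eq, x_eq] at this
      have a1 := h.conn e he _ hy8
      have a2 := h.conn e' he' _ hy8
      have a3 := (cls_eq (ep k e) (ep k e')).trans (h.conn e he _ he')
      have a4 := (cls_eq (ep k (4 + i)) (ep k e')).trans (h.conn _ hx8 _ he')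
      have a5 := (cls_eq (ep k e) (ep k (4 + i))).trans (h.conn e he _ hx8)
      rw [a1, a2] at this
      refine capCup_join hi h.invol h.ne he he' c1 c2 ?_
      split_ifs at this with b1 b2 b2
      · exact .inl ⟨b1.resolve_left (by omega), b2.resolve_left (by omega)⟩
      · rw [a4] at this
        exact .inr (.inl ⟨b1.resolve_left (by omega), this.resolve_left (by omega)⟩)
      · rw [a5] at this
        exact .inr (.inr (.inl ⟨b2.resolve_left (by omega), this.resolve_left (by omega)⟩))
      · rw [a3] at this
        exact .inr (.inr (.inr ⟨fun q => b1 (.inr q), fun q => b2 (.inr q), this⟩))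

/-- The paths are explicit: follow the old matching, and if it ends at a foot of the cap, cross the
cap and continue from the other foot. -/
theorem IsMatching.conn_capCup {f : ℕ → ℕ} (h : IsMatching σ k f) (hσ : σ k = some .zero)
    {e : ℕ} (he : e < 8) : Conn σ (k + 1) (ep (k + 1) e) (ep (k + 1) (capCup (k % 3) f e)) := by
  have hi : k % 3 < 3 := Nat.mod_lt _ (by norm_num)
  set i := k % 3 with hidef
  have hlt := h.lt
  have hinv := h.invol
  have hne := h.ne
  have hx8 : 4 + i < 8 := by omega
  have hy8 : 5 + i < 8 := by omega
  have up : ∀ e < 8, e ≠ 4 + i → e ≠ 5 + i → Conn σ (k + 1) (ep k e) (ep (k + 1) e) := by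
    intro e he hx hy
    by_cases h4 : e < 4
    · rw [ep_bottom h4, ep_bottom h4]; exact Conn.refl _ _ _
    · rw [ep_top (not_lt.1 h4), ep_top (not_lt.1 h4)]
      exact (Seg.vertical _ (by omega) (.inr ⟨hσ, by omega, by omega⟩)).conn (Nat.lt_succ_self k)
  have cap : Conn σ (k + 1) (ep k (4 + i)) (ep k (5 + i)) := by
    rw [ep_top (by omega), ep_top (by omega)]
    have := (Seg.cap (j := k) hσ).conn (Nat.lt_succ_self k)
    rwa [← hidef, show i = 4 + i - 4 by omega, show 4 + i - 4 + 1 = 5 + i - 4 by omega] at this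
  have cup : Conn σ (k + 1) (ep (k + 1) (4 + i)) (ep (k + 1) (5 + i)) := by
    rw [ep_top (by omega), ep_top (by omega)]
    have := (Seg.cup (j := k) hσ).conn (Nat.lt_succ_self k)
    rwa [← hidef, show i = 4 + i - 4 by omega, show 4 + i - 4 + 1 = 5 + i - 4 by omega] at this
  have old : ∀ e < 8, Conn σ (k + 1) (ep k e) (ep k (f e)) := fun e he =>
    ((h.conn e he _ (hlt e he)).2 (.inr rfl)).mono (Nat.le_succ k)
  have c := hlt _ hx8
  have c' := hlt _ hy8
  have d := hlt e he
  have n1 := hne _ hx8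
  have n2 := hne _ hy8
  have i1 := hinv _ hx8
  have i2 := hinv _ hy8
  have i3 := hinv e he
  unfold capCup
  split_ifs with b1 b2 b3 b4 b5
  · by_cases b2 : e = 4 + i
    · subst b2; rw [b1]; exact cup
    by_cases b3 : e = 5 + i
    · subst b3; rw [← b1, i1, b1]; exact cup.symm
    exact ((up e he b2 b3).symm.trans (old e he)).trans
      (up _ d (fun q => b3 (by rw [← i3, q, b1])) (fun q => b2 (by rw [← i3, q, ← b1, i1])))
  · subst b2; exact cup
  · subst b3; exact cup.symm
  · subst b4
    refine (up _ he b2 b3).symm.trans (((old _ hx8).symm.trans cap).trans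
      ((old _ hy8).trans (up _ c' ?_ n2)))
    intro q
    exact b1 (by rw [← q, i2])
  · subst b5
    refine (up _ he b2 b3).symm.trans (((old _ hy8).symm.trans cap.symm).trans
      ((old _ hx8).trans (up _ c n1 b1)))
  · exact ((up e he b2 b3).symm.trans (old e he)).trans
      (up _ d (fun q => b4 (by rw [← q, i3])) (fun q => b5 (by rw [← q, i3])))

theorem IsMatching.zero {f : ℕ → ℕ} (h : IsMatching σ k f) (hσ : σ k = some .zero) :
    IsMatching σ (k + 1) (capCup (k % 3) f) where
  lt _ he := capCup_lt (Nat.mod_lt _ (by norm_num)) h.lt he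
  invol _ he := capCup_invol (Nat.mod_lt _ (by norm_num)) h.invol h.ne he
  ne _ he := capCup_ne (Nat.mod_lt _ (by norm_num)) h.invol h.ne he
  conn e he e' he' := by
    constructor
    · exact h.eq_of_conn_zero hσ he he'
    · rintro (rfl | rfl)
      · exact Conn.refl _ _ _
      · exact h.conn_capCup hσ he

end Conn

/-! ## Loops and their highest layers -/

/-- Provides a matching for prefixes of arbitrary cells, whether or not the automaton accepts them.
-/
theorem exists_isMatching (σ : ℕ → Option Smoothing) (k : ℕ) (h : ∀ j < k, σ j ≠ none) :
    ∃ f, IsMatching σ k f := by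
  induction k with
  | zero => exact ⟨_, isMatching_zero σ⟩
  | succ k ih =>
    obtain ⟨f, hf⟩ := ih fun j hj => h j (hj.trans (Nat.lt_succ_self k))
    match hs : σ k with
    | none => exact absurd hs (h k (Nat.lt_succ_self k))
    | some .one => exact ⟨f, hf.one hs⟩
    | some .zero => exact ⟨_, hf.zero hs⟩

/-- The smoothing of layer `k` is a cap that closes off a loop. -/
def Closing (σ : ℕ → Option Smoothing) (k : ℕ) : Prop :=
  σ k = some .zero ∧ Conn σ k (k, k % 3) (k, k % 3 + 1)

section Closing

variable {σ τ : ℕ → Option Smoothing} {k N : ℕ} {x y : ℕ × ℕ}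

theorem Closing.congr (h : Closing σ k) (e : ∀ j ≤ k, σ j = τ j) : Closing τ k :=
  ⟨e k le_rfl ▸ h.1, h.2.congr fun j hj => e j hj.le⟩

theorem IsMatching.conn_top {f : ℕ → ℕ} (h : IsMatching σ k f) :
    Conn σ k (k, k % 3) (k, k % 3 + 1) ↔ f (4 + k % 3) = 5 + k % 3 := by
  have hi : k % 3 < 3 := Nat.mod_lt _ (by norm_num)
  have := h.conn (4 + k % 3) (by omega) (5 + k % 3) (by omega)
  rw [ep_top (by omega), ep_top (by omega), show 4 + k % 3 - 4 = k % 3 by omega,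
    show 5 + k % 3 - 4 = k % 3 + 1 by omega] at this
  rw [this]
  constructor
  · rintro (h | h)
    · omega
    · exact h.symm
  · exact fun h => .inr h.symm

theorem Conn.range (h : Conn σ k x y) (hx : x.2 < 4) : y.2 < 4 := by
  have := h.label (fun z => z.2 < 4) (by
    intro j _ x y hxy
    have hi : j % 3 < 3 := Nat.mod_lt _ (by norm_num)
    cases hxy with
    | vertical p hp h => rfl
    | cap h => simp only [eq_iff_iff]; omega
    | cup h => simp only [eq_iff_iff]; omega)
  exact this ▸ hx

theorem Conn.level_le (h : Conn σ k x y) (hx : x.1 ≤ k) : y.1 ≤ k := by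
  by_contra hy
  have := h.symm.level_lt (not_le.1 hy)
  exact hy (this ▸ hx)

/-- The points on the top of the prefix that lie on the loop which is about to be closed. -/
theorem Closing.top (hc : Closing σ k) (hσ : ∀ j < k, σ j ≠ none) {p : ℕ} (hp : p < 4)
    (h : Conn σ k (k, k % 3) (k, p)) : p = k % 3 ∨ p = k % 3 + 1 := by
  obtain ⟨f, hf⟩ := exists_isMatching σ k hσ
  have hi : k % 3 < 3 := Nat.mod_lt _ (by norm_num)
  have h1 := hf.conn_top.1 hc.2
  have := hf.conn (4 + k % 3) (by omega) (4 + p) (by omega)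
  rw [ep_top (by omega), ep_top (by omega), show 4 + k % 3 - 4 = k % 3 by omega,
    show 4 + p - 4 = p by omega] at this
  rcases this.1 h with h | h <;> omega

theorem Closing.not_bottom (hc : Closing σ k) (hσ : ∀ j < k, σ j ≠ none) {p : ℕ} (hp : p < 4) :
    ¬ Conn σ k (k, k % 3) (0, p) := by
  intro h
  obtain ⟨f, hf⟩ := exists_isMatching σ k hσ
  have hi : k % 3 < 3 := Nat.mod_lt _ (by norm_num)
  have h1 := hf.conn_top.1 hc.2
  have := hf.conn (4 + k % 3) (by omega) p (by omega)
  rw [ep_top (by omega), ep_bottom hp, show 4 + k % 3 - 4 = k % 3 by omega] at this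
  rcases this.1 h with h | h <;> omega

/-- A loop is already visible in the prefix below its highest layer. -/
theorem Closing.conn_iff (hc : Closing σ k) (hσ : ∀ j < k, σ j ≠ none) (hk : k ≤ N) :
    Conn σ N (k, k % 3) y ↔ Conn σ k (k, k % 3) y := by
  refine ⟨fun h => ?_, Conn.mono hk⟩
  -- The label is membership in the loop as seen in the prefix. The cap in layer `k` stays inside
  -- the loop, and no segment in layer `k` or above leaves it.
  have := h.label (fun z => Conn σ k (k, k % 3) z) (by
    intro j hj x y hxy
    have hl := hxy.level
    rcases lt_trichotomy j k with hjk | rfl | hjk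
    · exact propext ⟨fun h => h.trans (hxy.conn hjk), fun h => h.trans (hxy.conn hjk).symm⟩
    · have high : ∀ z : ℕ × ℕ, z.1 = j + 1 → ¬ Conn σ j (j, j % 3) z := fun z hz h => by
        have := h.level_le le_rfl
        omega
      have hz : σ j = some .zero := hc.1
      cases hxy with
      | vertical p hp h =>
        have : p ≠ j % 3 ∧ p ≠ j % 3 + 1 := by
          rcases h with h | h
          · simp [hz] at h
          · exact h.2
        refine propext ⟨fun h => ?_, fun h => absurd h (high _ rfl)⟩
        rcases hc.top hσ hp h with h | h
        · exact absurd h this.1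
        · exact absurd h this.2
      | cap h => exact propext ⟨fun _ => hc.2, fun _ => Conn.refl _ _ _⟩
      | cup h => exact propext ⟨fun h => absurd h (high _ rfl), fun h => absurd h (high _ rfl)⟩
    · have high : ∀ z : ℕ × ℕ, j ≤ z.1 → ¬ Conn σ k (k, k % 3) z := fun z hz h => by
        have := h.level_le le_rfl
        omega
      exact propext ⟨fun h => absurd h (high _ hl.1.1), fun h => absurd h (high _ hl.2.1)⟩)
  rw [← this]
  exact Conn.refl _ _ _

/-- The highest layer of a component without endpoints closes it off. -/
theorem closing_of_highest (hσ : ∀ j < N, σ j ≠ none) {p : ℕ} (hp : p < 4)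
    (hle : k ≤ N) (hmax : ∀ y, Conn σ N (k, p) y → y.1 ≤ k)
    (hends : ∀ e < 8, ¬ Conn σ N (k, p) (ep N e)) :
    k < N ∧ Closing σ k ∧ Conn σ N (k, p) (k, k % 3) := by
  have hi : k % 3 < 3 := Nat.mod_lt _ (by norm_num)
  have hkN : k < N := by
    refine lt_of_le_of_ne hle ?_
    rintro rfl
    apply hends (4 + p) (by omega)
    rw [ep_top (by omega), show 4 + p - 4 = p by omega]
    exact Conn.refl _ _ _
  -- A highest point must be a foot of the cap; otherwise a vertical segment leads one level higher.
  have key : ∀ q < 4, Conn σ N (k, p) (k, q) → σ k = some .zero ∧ (q = k % 3 ∨ q = k % 3 + 1) := by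
    intro q hq h
    by_contra hcon
    have hv : σ k = some .one ∨ σ k = some .zero ∧ q ≠ k % 3 ∧ q ≠ k % 3 + 1 := by
      match hs : σ k with
      | none => exact absurd hs (hσ k hkN)
      | some .one => exact .inl rfl
      | some .zero => simp only [hs, true_and] at hcon; exact .inr ⟨rfl, by omega, by omega⟩
    have := hmax _ (h.trans ((Seg.vertical q hq hv).conn hkN))
    simp at this
  obtain ⟨hz, hp'⟩ := key p hp (Conn.refl _ _ _)
  have cap : Conn σ N (k, k % 3) (k, k % 3 + 1) := (Seg.cap hz).conn hkN
  have hpi : Conn σ N (k, p) (k, k % 3) := by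
    rcases hp' with rfl | rfl
    · exact Conn.refl _ _ _
    · exact cap.symm
  refine ⟨hkN, ⟨hz, ?_⟩, hpi⟩
  -- The partner of the left foot in the prefix is not at the bottom, since the component has no
  -- endpoints; so it is on level `k`, where `key` leaves only the right foot.
  obtain ⟨f, hf⟩ := exists_isMatching σ k fun j hj => hσ j (hj.trans hkN)
  rw [hf.conn_top]
  have h8 := hf.lt (4 + k % 3) (by omega)
  have hc := (hf.conn (4 + k % 3) (by omega) _ h8).2 (.inr rfl)
  have hne := hf.ne (4 + k % 3) (by omega)
  rw [ep_top (by omega), show 4 + k % 3 - 4 = k % 3 by omega] at hc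
  have hc' := hpi.trans (hc.mono hle)
  by_cases h4 : f (4 + k % 3) < 4
  · rw [ep_bottom h4] at hc'
    refine absurd ?_ (hends _ h8)
    rwa [ep_bottom h4]
  · rw [ep_top (not_lt.1 h4)] at hc'
    have := (key _ (by omega) hc').2
    omega

end Closing

/-! ## The components of the smoothings of `(σ₁σ₂σ₃)ⁿ` -/

/-- The smoothings recorded by a word. -/
def sm (w : Word) : ℕ → Option Smoothing := fun j => (w[j]?).map Letter.smoothing

theorem torusBraid_length (n : ℕ) : (torusBraid n).length = 3 * n := by
  simp [torusBraid, mul_comm]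

theorem torusBraid_getElem (n j : ℕ) (hj : j < (torusBraid n).length) :
    ((torusBraid n)[j] : ℕ) = j % 3 := by
  induction n generalizing j with
  | zero => simp [torusBraid] at hj
  | succ n ih =>
    have e : torusBraid (n + 1) = [0, 1, 2] ++ torusBraid n := by
      simp [torusBraid, List.replicate_succ]
    simp only [e] at hj ⊢
    rw [List.getElem_append]
    split_ifs with h
    · simp only [List.length_cons, List.length_nil] at h
      interval_cases j <;> rfl
    · simp only [List.length_cons, List.length_nil] at h
      rw [ih]
      simp only [List.length_cons, List.length_nil]
      omega

/-- The natural-number coordinates of a point. -/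
def coords {B : List (Fin 3)} (x : Point B) : ℕ × ℕ := (x.1, x.2)

section Torus

variable {n : ℕ} {w a b : Word}

theorem sm_ne_none (hw : w.length = 3 * n) : ∀ j < 3 * n, sm w j ≠ none := by
  intro j hj
  simp [sm, hw, hj]

/-- The point in natural-number coordinates. -/
def point (n k p : ℕ) (hk : k ≤ 3 * n) (hp : p < 4) : Point (torusBraid n) :=
  (⟨k, by rw [torusBraid_length]; omega⟩, ⟨p, hp⟩)

theorem coords_point (k p : ℕ) (hk : k ≤ 3 * n) (hp : p < 4) :
    coords (point n k p hk hp) = (k, p) := rfl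

theorem coords_level_le (x : Point (torusBraid n)) : (coords x).1 ≤ 3 * n := by
  have := x.1.2
  have h := torusBraid_length n
  simp only [coords]
  omega

theorem coords_position_lt (x : Point (torusBraid n)) : (coords x).2 < 4 := x.2.2

theorem coords_injective : Function.Injective (coords (B := torusBraid n)) := by
  rintro ⟨x, p⟩ ⟨y, q⟩ h
  simp only [coords, Prod.mk.injEq] at h
  exact Prod.ext (Fin.ext h.1) (Fin.ext h.2)

theorem exists_coords {z : ℕ × ℕ} (h1 : z.1 ≤ 3 * n) (h2 : z.2 < 4) :
    ∃ x : Point (torusBraid n), coords x = z := ⟨point n z.1 z.2 h1 h2, rfl⟩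

theorem get_castSucc_val (j : Fin (torusBraid n).length) :
    (((torusBraid n).get j).castSucc : ℕ) = j % 3 := torusBraid_getElem n j j.2

theorem get_succ_val (j : Fin (torusBraid n).length) :
    (((torusBraid n).get j).succ : ℕ) = j % 3 + 1 := by
  rw [Fin.val_succ]
  exact congrArg (· + 1) (torusBraid_getElem n j j.2)

/-- Transfers connectivity from the dependent coordinates of `Point` to pairs of natural numbers,
where prefixes of different heights can be compared. -/
theorem components_iff {x y : Point (torusBraid n)} :
    components (torusBraid n) w x y ↔ Conn (sm w) (3 * n) (coords x) (coords y) := by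
  constructor
  · intro h
    change Relation.EqvGen _ x y at h
    induction h with
    | rel x y h =>
      have hlen := torusBraid_length n
      cases h with
      | vertical j c p hx hp =>
        refine (Seg.vertical (σ := sm w) (j := j) p p.2 ?_).conn (by have := j.2; omega)
        rw [← get_castSucc_val j] at *
        have h2 := get_succ_val j
        rw [← get_castSucc_val j] at h2
        match hc : c.smoothing with
        | .one => exact .inl (by simp [sm, hx, hc])
        | .zero =>
          simp only [hc, reduceCtorEq, false_or] at hp
          refine .inr ⟨by simp [sm, hx, hc], fun h => hp.1 (Fin.ext h), fun h => hp.2 (Fin.ext ?_)⟩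
          rw [h2, h]
      | cap j c hx h0 =>
        have := (Seg.cap (σ := sm w) (j := j) (by simp [sm, hx, h0])).conn
          (k := 3 * n) (by have := j.2; omega)
        rwa [← get_succ_val j, ← get_castSucc_val j] at this
      | cup j c hx h0 =>
        have := (Seg.cup (σ := sm w) (j := j) (by simp [sm, hx, h0])).conn
          (k := 3 * n) (by have := j.2; omega)
        rwa [← get_succ_val j, ← get_castSucc_val j] at this
    | refl x => exact Conn.refl _ _ _
    | symm x y _ ih => exact ih.symm
    | trans x y z _ _ ih ih' => exact ih.trans ih'
  · intro h
    have := h.label (fun z => {t : Point (torusBraid n) |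
        ∃ s, coords s = z ∧ components (torusBraid n) w t s}) (by
      intro j hj u v huv
      have hj' : j < (torusBraid n).length := by rw [torusBraid_length]; exact hj
      have hu : ∃ x : Point (torusBraid n), coords x = u := by
        have hl := huv.level
        refine exists_coords (by omega) ?_
        have hi : j % 3 < 3 := Nat.mod_lt _ (by norm_num)
        cases huv with
        | vertical p hp h => exact hp
        | cap h => simp only; omega
        | cup h => simp only; omega
      obtain ⟨x, rfl⟩ := hu
      have hv : ∃ x : Point (torusBraid n), coords x = v :=
        exists_coords (by have := huv.level; omega)
          ((huv.conn (Nat.lt_succ_self j)).range (coords_position_lt x))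
      obtain ⟨y, rfl⟩ := hv
      have hxy : components (torusBraid n) w x y := by
        obtain ⟨x1, x2⟩ := x
        obtain ⟨y1, y2⟩ := y
        have e1 := get_castSucc_val (⟨j, hj'⟩ : Fin (torusBraid n).length)
        have e2 := get_succ_val (⟨j, hj'⟩ : Fin (torusBraid n).length)
        simp only [coords] at huv
        refine Relation.EqvGen.rel _ _ ?_
        have letter : ∀ s, sm w j = some s → ∃ c : Letter, w[j]? = some c ∧ c.smoothing = s := by
          intro s hs
          simpa [sm] using hs
        generalize hA : ((x1 : ℕ), (x2 : ℕ)) = A at huv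
        generalize hC : ((y1 : ℕ), (y2 : ℕ)) = C at huv
        cases huv with
        | vertical p hp h =>
          simp only [Prod.mk.injEq] at hA hC
          have hx1 : x1 = (⟨j, hj'⟩ : Fin (torusBraid n).length).castSucc := Fin.ext hA.1
          have hy1 : y1 = (⟨j, hj'⟩ : Fin (torusBraid n).length).succ := Fin.ext hC.1
          have hxy2 : y2 = x2 := Fin.ext (hC.2.trans hA.2.symm)
          subst hx1 hy1 hxy2
          rcases h with h | ⟨h, h1, h2⟩
          · obtain ⟨c, hc, hs⟩ := letter _ h
            exact .vertical ⟨j, hj'⟩ c _ hc (.inl hs)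
          · obtain ⟨c, hc, hs⟩ := letter _ h
            refine .vertical ⟨j, hj'⟩ c _ hc (.inr ⟨fun h => h1 ?_, fun h => h2 ?_⟩)
            · rw [← hC.2, h]; exact e1
            · rw [← hC.2, h]; exact e2
        | cap h =>
          simp only [Prod.mk.injEq] at hA hC
          obtain ⟨c, hc, hs⟩ := letter _ h
          have hx1 : x1 = (⟨j, hj'⟩ : Fin (torusBraid n).length).castSucc := Fin.ext hA.1
          have hy1 : y1 = (⟨j, hj'⟩ : Fin (torusBraid n).length).castSucc := Fin.ext hC.1
          have hx2 : x2 = ((torusBraid n).get ⟨j, hj'⟩).castSucc := Fin.ext (hA.2.trans e1.symm)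
          have hy2 : y2 = ((torusBraid n).get ⟨j, hj'⟩).succ := Fin.ext (hC.2.trans e2.symm)
          rw [hx1, hy1, hx2, hy2]
          exact .cap ⟨j, hj'⟩ c hc hs
        | cup h =>
          simp only [Prod.mk.injEq] at hA hC
          obtain ⟨c, hc, hs⟩ := letter _ h
          have hx1 : x1 = (⟨j, hj'⟩ : Fin (torusBraid n).length).succ := Fin.ext hA.1
          have hy1 : y1 = (⟨j, hj'⟩ : Fin (torusBraid n).length).succ := Fin.ext hC.1
          have hx2 : x2 = ((torusBraid n).get ⟨j, hj'⟩).castSucc := Fin.ext (hA.2.trans e1.symm)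
          have hy2 : y2 = ((torusBraid n).get ⟨j, hj'⟩).succ := Fin.ext (hC.2.trans e2.symm)
          rw [hx1, hy1, hx2, hy2]
          exact .cup ⟨j, hj'⟩ c hc hs
      ext t
      simp only [Set.mem_ofPred_eq]
      constructor
      · rintro ⟨s, hs, ht⟩
        rw [coords_injective hs] at ht
        exact ⟨y, rfl, (components (torusBraid n) w).trans' ht hxy⟩
      · rintro ⟨s, hs, ht⟩
        rw [coords_injective hs] at ht
        exact ⟨x, rfl, (components (torusBraid n) w).trans' ht
          ((components (torusBraid n) w).symm' hxy)⟩)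
    have hx : x ∈ {t : Point (torusBraid n) |
        ∃ s, coords s = coords x ∧ components (torusBraid n) w t s} :=
      ⟨x, rfl, (components (torusBraid n) w).refl' x⟩
    rw [this] at hx
    obtain ⟨s, hs, h⟩ := hx
    rwa [coords_injective hs] at h

theorem componentOf_eq_iff {x y : Point (torusBraid n)} :
    componentOf (torusBraid n) w x = componentOf (torusBraid n) w y ↔
      Conn (sm w) (3 * n) (coords x) (coords y) :=
  Quotient.eq.trans components_iff

theorem coords_endpoint (e : Endpoint 3) :
    coords (endpoint (torusBraid n) e) = ep (3 * n) (cond e.1 4 0 + e.2) := by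
  obtain ⟨b, p⟩ := e
  have := p.2
  cases b
  · simp only [coords, endpoint, cond_false, zero_add, ep_bottom p.2]; rfl
  · simp only [coords, endpoint, cond_true]
    rw [ep_top (by omega)]
    simp [torusBraid_length]

theorem exists_endpoint {e : ℕ} (he : e < 8) :
    ∃ e' : Endpoint 3, coords (endpoint (torusBraid n) e') = ep (3 * n) e := by
  by_cases h : e < 4
  · exact ⟨(false, ⟨e, h⟩), by rw [coords_endpoint]; simp⟩
  · exact ⟨(true, ⟨e - 4, by omega⟩), by
      rw [coords_endpoint]
      simp only [cond_true]
      congr 1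
      omega⟩

theorem isLoop_iff {x : Point (torusBraid n)} :
    IsLoop (torusBraid n) w (componentOf (torusBraid n) w x) ↔
      ∀ e < 8, ¬ Conn (sm w) (3 * n) (coords x) (ep (3 * n) e) := by
  constructor
  · intro h e he hc
    obtain ⟨e', he'⟩ := exists_endpoint (n := n) he
    exact h e' (componentOf_eq_iff.2 (he' ▸ hc.symm))
  · intro h e hc
    have := componentOf_eq_iff.1 hc
    rw [coords_endpoint] at this
    refine h _ ?_ this.symm
    have := e.2.2
    cases e.1 <;> simp <;> omega

theorem bddAbove_levels (c : Component (torusBraid n) w) :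
    BddAbove {j : ℕ | ∃ x : Point (torusBraid n),
      componentOf (torusBraid n) w x = c ∧ (x.1 : ℕ) = j} := by
  refine ⟨3 * n, ?_⟩
  rintro j ⟨x, -, rfl⟩
  exact coords_level_le x

theorem level_le_maxLayer (x : Point (torusBraid n)) :
    (x.1 : ℕ) ≤ maxLayer (torusBraid n) w (componentOf (torusBraid n) w x) :=
  le_csSup (bddAbove_levels _) ⟨x, rfl, rfl⟩

theorem exists_level_eq_maxLayer (c : Component (torusBraid n) w) :
    ∃ x : Point (torusBraid n), componentOf (torusBraid n) w x = c ∧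
      (x.1 : ℕ) = maxLayer (torusBraid n) w c := by
  refine Nat.sSup_mem ?_ (bddAbove_levels c)
  induction c using Quotient.inductionOn with
  | h x => exact ⟨x.1, x, rfl, rfl⟩

/-- By `Closing.conn_iff` the whole component lies in the prefix below the cap, so it has no
endpoint and rises no higher than level `k`. -/
theorem Closing.isLoop {k : ℕ} (hw : w.length = 3 * n) (hk : k < 3 * n) (hc : Closing (sm w) k)
    {x : Point (torusBraid n)} (hx : coords x = (k, k % 3)) :
    IsLoop (torusBraid n) w (componentOf (torusBraid n) w x) ∧
      maxLayer (torusBraid n) w (componentOf (torusBraid n) w x) = k := by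
  have hσ : ∀ j < k, sm w j ≠ none := fun j hj => sm_ne_none hw j (hj.trans hk)
  constructor
  · rw [isLoop_iff, hx]
    intro e he h
    rw [hc.conn_iff hσ hk.le] at h
    by_cases h4 : e < 4
    · rw [ep_bottom h4] at h
      exact hc.not_bottom hσ h4 h
    · rw [ep_top (not_lt.1 h4)] at h
      have := h.level_le le_rfl
      simp only at this
      omega
  · apply le_antisymm
    · obtain ⟨y, hy, hy'⟩ := exists_level_eq_maxLayer (componentOf (torusBraid n) w x)
      rw [← hy']
      have := componentOf_eq_iff.1 hy.symm
      rw [hx, hc.conn_iff hσ hk.le] at this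
      exact this.level_le le_rfl
    · have := level_le_maxLayer (w := w) x
      rwa [show (x.1 : ℕ) = k from congrArg Prod.fst hx] at this

theorem IsLoop.closing {c : Component (torusBraid n) w} (hw : w.length = 3 * n)
    (h : IsLoop (torusBraid n) w c) :
    ∃ hk : maxLayer (torusBraid n) w c < 3 * n,
      Closing (sm w) (maxLayer (torusBraid n) w c) ∧
      c = componentOf (torusBraid n) w (point n (maxLayer (torusBraid n) w c)
        (maxLayer (torusBraid n) w c % 3) hk.le
        ((Nat.mod_lt _ (by norm_num)).trans (by norm_num))) := by
  obtain ⟨x, rfl, hx⟩ := exists_level_eq_maxLayer c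
  set k := maxLayer (torusBraid n) w (componentOf (torusBraid n) w x) with hk
  have hxc : coords x = (k, (x.2 : ℕ)) := by rw [← hx]; rfl
  rw [isLoop_iff, hxc] at h
  obtain ⟨h1, h2, h3⟩ := closing_of_highest (k := k) (p := (x.2 : ℕ)) (sm_ne_none hw) x.2.2
    (by rw [← hx]; exact coords_level_le x) (by
      intro y hy
      rw [← hxc] at hy
      by_cases hyN : y.1 ≤ 3 * n
      · obtain ⟨y, rfl⟩ := exists_coords (n := n) hyN (hy.range (coords_position_lt x))
        rw [hk, componentOf_eq_iff.2 hy]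
        exact level_le_maxLayer y
      · have := hy.symm.level_lt (not_le.1 hyN)
        rw [this] at hyN
        exact absurd (coords_level_le x) hyN) h
  refine ⟨h1, h2, ?_⟩
  rw [componentOf_eq_iff, hxc]
  exact h3

theorem IsLoop.eq_of_maxLayer {k : ℕ} {c : Component (torusBraid n) w} (hw : w.length = 3 * n)
    (h : IsLoop (torusBraid n) w c) (hk : maxLayer (torusBraid n) w c = k) :
    k < 3 * n ∧ Closing (sm w) k ∧ ∀ x : Point (torusBraid n), coords x = (k, k % 3) →
      c = componentOf (torusBraid n) w x := by
  subst hk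
  obtain ⟨h1, h2, h3⟩ := h.closing hw
  refine ⟨h1, h2, fun x hx => ?_⟩
  rw [h3]
  exact congrArg _ (coords_injective (hx ▸ rfl))

theorem exists_isLoop_iff {k : ℕ} (hw : w.length = 3 * n) :
    (∃ c : Component (torusBraid n) w, IsLoop (torusBraid n) w c ∧
      maxLayer (torusBraid n) w c = k) ↔ k < 3 * n ∧ Closing (sm w) k := by
  constructor
  · rintro ⟨c, h, hk⟩
    have := h.eq_of_maxLayer hw hk
    exact ⟨this.1, this.2.1⟩
  · rintro ⟨hk, h⟩
    exact ⟨_, h.isLoop hw hk (coords_point k (k % 3) hk.le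
      ((Nat.mod_lt _ (by norm_num)).trans (by norm_num)))⟩

/-- Loops correspond to closing caps, so the global condition on the colours becomes a condition on
prefixes. This makes a letter-by-letter automaton possible. -/
theorem isCell_iff : IsCell (torusBraid n) w ↔ w.length = 3 * n ∧
    ∀ (j : ℕ) (x : Letter), w[j]? = some x → (x.color ≠ none ↔ Closing (sm w) j) := by
  unfold IsCell
  rw [torusBraid_length]
  refine and_congr_right fun hw => forall_congr' fun j => forall_congr' fun x =>
    forall_congr' fun hx => ?_
  rw [exists_isLoop_iff hw]
  have : j < 3 * n := hw ▸ (List.getElem?_eq_some_iff.1 hx).1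
  simp [this]

end Torus

/-! ## Isomorphisms among the matrix elements -/

section Iso

variable {m : ℕ}

theorem pieces_eq_singleton {X : Type*} {r s : Setoid X} (h : ∀ x y, s x y → r x y)
    (h' : r ≤ s) (x : X) : pieces r s (Quotient.mk s x) = {Quotient.mk r x} := by
  ext c
  induction c using Quotient.inductionOn with
  | h y =>
    simp only [pieces, Set.mem_ofPred_eq, Set.mem_singleton_iff]
    constructor
    · rintro ⟨z, hz, hz'⟩
      rw [← hz]
      exact Quotient.sound (h _ _ (Quotient.exact hz'))
    · intro hy
      exact ⟨y, rfl, Quotient.sound (h' (Quotient.exact hy))⟩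

theorem surfaceCoeff_disc (v : ℕ) : surfaceCoeff 1 1 0 v = if v = 1 then 1 else 0 := by
  have e : ((2 : ℤ) - ((1 : ℕ) : ℤ) - 1) / 2 = 0 := by norm_num
  unfold surfaceCoeff
  rw [e]
  simp

theorem surfaceCoeff_sphere : surfaceCoeff 2 0 1 0 = 1 := by
  unfold surfaceCoeff
  norm_num

/-- The form in which a product over surface components equals a coefficient of the identity: some
factor vanishes as soon as a disc is to carry a dot. -/
theorem finprod_ite_empty {K C : Type*} [Finite K] (g : K → ℤ) (U : Set C)
    (h1 : ∀ k, (∀ u ∈ U, False) → g k = 1) (h0 : ∀ u ∈ U, ∃ k, g k = 0) [Decidable (U = ∅)] :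
    ∏ᶠ k, g k = if U = ∅ then 1 else 0 := by
  split_ifs with hU
  · exact finprod_eq_one_of_forall_eq_one fun k => h1 k (by simp [hU])
  · obtain ⟨u, hu⟩ := Set.nonempty_iff_ne_empty.2 hU
    obtain ⟨k, hk⟩ := h0 u hu
    exact finprod_eq_zero g k hk (Set.toFinite _)

-- Since `α ⊔ α = α`, each component of the glued surface consists of two discs glued along one arc;
-- its Euler characteristic is `1 + 1 - 1`, so it is a disc again, and the signs cancel.
open Classical in
theorem cobComp_scalar (α : Diagram m) (ε : ℤ) (hε : ε * ε = 1) (f : CobHom α α)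
    (hf : ∀ U, f U = ε * if U = ∅ then 1 else 0) : cobComp f f = cobId α := by
  funext U
  unfold cobComp cobId
  have e : α ⊔ α = α := sup_idem α
  have e' : α ⊔ α ⊔ α = α := by rw [e, e]
  have key : ∏ᶠ k : Quotient (α ⊔ α ⊔ α),
      surfaceCoeff
        ((pieces (α ⊔ α) (α ⊔ α ⊔ α) k).ncard + (pieces (α ⊔ α) (α ⊔ α ⊔ α) k).ncard
          - (pieces α (α ⊔ α ⊔ α) k).ncard)
        (pieces (α ⊔ α) (α ⊔ α ⊔ α) k).ncard
        ((pieces (α ⊔ α) (α ⊔ α ⊔ α) k ∩ (∅ : Set (Circle α α))).ncard +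
          (pieces (α ⊔ α) (α ⊔ α ⊔ α) k ∩ (∅ : Set (Circle α α))).ncard)
        (pieces (α ⊔ α) (α ⊔ α ⊔ α) k \ U).ncard = if U = ∅ then 1 else 0 := by
    have val : ∀ x, surfaceCoeff
        ((pieces (α ⊔ α) (α ⊔ α ⊔ α) (Quotient.mk _ x)).ncard +
          (pieces (α ⊔ α) (α ⊔ α ⊔ α) (Quotient.mk _ x)).ncard
          - (pieces α (α ⊔ α ⊔ α) (Quotient.mk _ x)).ncard)
        (pieces (α ⊔ α) (α ⊔ α ⊔ α) (Quotient.mk _ x)).ncard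
        ((pieces (α ⊔ α) (α ⊔ α ⊔ α) (Quotient.mk _ x) ∩ (∅ : Set (Circle α α))).ncard +
          (pieces (α ⊔ α) (α ⊔ α ⊔ α) (Quotient.mk _ x) ∩ (∅ : Set (Circle α α))).ncard)
        (pieces (α ⊔ α) (α ⊔ α ⊔ α) (Quotient.mk _ x) \ U).ncard =
          if Quotient.mk (α ⊔ α) x ∈ U then 0 else 1 := by
      intro x
      rw [pieces_eq_singleton (r := α ⊔ α) (fun x y h => by rw [e'] at h; rwa [e]) (by rw [e', e]),
        pieces_eq_singleton (r := α) (fun x y h => by rwa [e'] at h) (by rw [e'])]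
      simp only [Set.ncard_singleton, Set.inter_empty, Set.ncard_empty, Nat.cast_one, add_zero]
      rw [show (1 : ℤ) + 1 - 1 = 1 by norm_num, surfaceCoeff_disc]
      by_cases hx : Quotient.mk (α ⊔ α) x ∈ U
      · rw [Set.sdiff_eq_empty.2 (Set.singleton_subset_iff.2 hx)]
        simp [hx]
      · rw [(Set.disjoint_singleton_left.2 hx).sdiff_eq_left]
        simp [hx]
    apply finprod_ite_empty
    · intro k hU
      induction k using Quotient.inductionOn with
      | h x => rw [val, if_neg (fun h => hU _ h)]
    · intro u hu
      induction u using Quotient.inductionOn with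
      | h x => exact ⟨Quotient.mk _ x, by rw [val, if_pos hu]⟩
  -- Only the undotted basis elements have a nonzero coefficient, so the double sum reduces to one
  -- term.
  rw [finsum_eq_single _ (∅ : Set (Circle α α)), finsum_eq_single _ (∅ : Set (Circle α α)), key, hf]
  · simp [hε]
  · intro T hT
    rw [hf T, if_neg hT]
    simp
  · intro S hS
    rw [hf S, if_neg hS]
    simp

open Classical in
theorem isCobIso_scalar {α β : Diagram m} (hαβ : α = β) (ε : ℤ) (hε : ε * ε = 1) (f : CobHom α β)
    (hf : ∀ U, f U = ε * if U = ∅ then 1 else 0) : IsCobIso f := by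
  subst hαβ
  exact ⟨f, cobComp_scalar α ε hε f hf, cobComp_scalar α ε hε f hf⟩

variable {B : List (Fin m)}

/-- The components of `C` arise from those of `F` by uniting the loop `c` with the component `X`,
and the colours of all other loops agree. -/
structure Absorbs (B : List (Fin m)) (F C : Word) (c X : Component B F) : Prop where
  loop : IsLoop B F c
  ne : c ≠ X
  rel : ∀ x y, components B C x y ↔ components B F x y ∨
    (componentOf B F x = c ∧ componentOf B F y = X) ∨
    (componentOf B F x = X ∧ componentOf B F y = c)
  color : ∀ x, IsLoop B F (componentOf B F x) → componentOf B F x ≠ c →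
    loopColor B F (componentOf B F x) = loopColor B C (componentOf B C x)
  colored : ∀ x, IsLoop B F (componentOf B F x) → loopColor B F (componentOf B F x) ≠ none

namespace Absorbs

variable {F C : Word} {c X : Component B F}

theorem le (h : Absorbs B F C c X) : components B F ≤ components B C :=
  fun x y hxy => (h.rel x y).2 (.inl hxy)

theorem underlying_eq (h : Absorbs B F C c X) : underlying B F = underlying B C := by
  ext e e'
  change components B F _ _ ↔ components B C _ _
  rw [h.rel]
  constructor
  · exact .inl
  · rintro (h' | ⟨h', -⟩ | ⟨-, h'⟩)
    · exact h'
    · exact absurd h' (h.loop e)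
    · exact absurd h' (h.loop e')

theorem isLoop_iff_of_ne (h : Absorbs B F C c X) {x : Point B} (hc : componentOf B F x ≠ c)
    (hX : componentOf B F x ≠ X) :
    IsLoop B C (componentOf B C x) ↔ IsLoop B F (componentOf B F x) := by
  refine forall_congr' fun e => not_congr ?_
  refine Quotient.eq.trans (Iff.trans ?_ Quotient.eq.symm)
  rw [h.rel]
  exact ⟨fun h' => h'.resolve_right (by rintro (h' | h'); exacts [hX h'.2, hc h'.2]), .inl⟩

/-- The loop `c` has no endpoints, so the union of `c` and `X` has exactly those of `X`. -/
theorem isLoop_iff_of_eq (h : Absorbs B F C c X) {x : Point B}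
    (hx : componentOf B F x = c ∨ componentOf B F x = X) :
    IsLoop B C (componentOf B C x) ↔ IsLoop B F X := by
  refine forall_congr' fun e => not_congr ?_
  refine Quotient.eq.trans ((h.rel _ _).trans ?_)
  have hl := h.loop e
  have hne := h.ne
  constructor
  · rintro (h' | h' | h')
    · have : componentOf B F (endpoint B e) = componentOf B F x := Quotient.sound h'
      rcases hx with hx | hx
      · exact absurd (this.trans hx) hl
      · exact this.trans hx
    · exact absurd h'.1 hl
    · exact h'.1
  · intro h'
    rcases hx with hx | hx
    · exact .inr (.inr ⟨h', hx⟩)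
    · exact .inl (Quotient.exact (h'.trans hx.symm))

theorem pieces_coarse (_ : Absorbs B F C c X) {T : Setoid (Point B)} (hT : T = components B C)
    (x : Point B) : pieces (components B C) T (Quotient.mk T x) = {componentOf B C x} := by
  subst hT
  exact pieces_eq_singleton (fun _ _ h => h) le_rfl x

theorem pieces_fine_of_ne (h : Absorbs B F C c X) {T : Setoid (Point B)}
    (hT : T = components B C) {x : Point B} (hc : componentOf B F x ≠ c)
    (hX : componentOf B F x ≠ X) :
    pieces (components B F) T (Quotient.mk T x) = {componentOf B F x} := by
  subst hT
  ext d
  simp only [pieces, Set.mem_ofPred_eq, Set.mem_singleton_iff]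
  constructor
  · rintro ⟨z, rfl, hz⟩
    rcases (h.rel _ _).1 (Quotient.exact hz) with h' | h' | h'
    · exact Quotient.sound h'
    · exact absurd h'.2 hX
    · exact absurd h'.2 hc
  · rintro rfl
    exact ⟨x, rfl, rfl⟩

theorem pieces_fine_of_eq (h : Absorbs B F C c X) {T : Setoid (Point B)}
    (hT : T = components B C) {x : Point B}
    (hx : componentOf B F x = c ∨ componentOf B F x = X) :
    pieces (components B F) T (Quotient.mk T x) = {c, X} := by
  subst hT
  ext d
  induction d using Quotient.inductionOn with
  | h y =>
    simp only [pieces, Set.mem_ofPred_eq, Set.mem_insert_iff, Set.mem_singleton_iff]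
    constructor
    · rintro ⟨z, hz, hz'⟩
      rw [← hz]
      rcases (h.rel _ _).1 (Quotient.exact hz') with h' | h' | h'
      · have : componentOf B F z = componentOf B F x := Quotient.sound h'
        rw [← this] at hx
        exact hx
      · exact .inl h'.1
      · exact .inr h'.1
    · intro hy
      refine ⟨y, rfl, Quotient.sound ((h.rel _ _).2 ?_)⟩
      rcases hx with hx | hx <;> rcases hy with hy | hy
      · exact .inl (Quotient.exact (hy.trans hx.symm))
      · exact .inr (.inr ⟨hy, hx⟩)
      · exact .inr (.inl ⟨hy, hx⟩)
      · exact .inl (Quotient.exact (hy.trans hx.symm))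

end Absorbs

open Classical in
theorem ncard_sep_singleton {Y : Type*} (y : Y) (P : Y → Prop) :
    {d ∈ ({y} : Set Y) | P d}.ncard = if P y then 1 else 0 := by
  split_ifs with h
  · rw [Set.ncard_eq_one]
    exact ⟨y, by ext d; simp only [Set.mem_singleton_iff, Set.mem_ofPred_eq]; grind⟩
  · rw [Set.ncard_eq_zero (Set.toFinite _)]
    ext d; simp only [Set.mem_singleton_iff, Set.mem_ofPred_eq, Set.mem_empty_iff_false]; grind

open Classical in
theorem ncard_sep_pair {Y : Type*} {y z : Y} (h : y ≠ z) (P : Y → Prop) :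
    {d ∈ ({y, z} : Set Y) | P d}.ncard = (if P y then 1 else 0) + (if P z then 1 else 0) := by
  rw [← ncard_sep_singleton y, ← ncard_sep_singleton z, ← Set.ncard_union_eq]
  · congr 1
    ext d
    simp only [Set.mem_insert_iff, Set.mem_singleton_iff, Set.mem_ofPred_eq, Set.mem_union]
    tauto
  · rw [Set.disjoint_left]
    rintro d ⟨hd, -⟩ ⟨hd', -⟩
    exact h (hd.symm.trans hd')

variable {a b : Word} {j : Fin B.length}

theorem saddleCircles_of_isLoop {C : Word} (hT : components B a ⊔ components B b = components B C)
    {x : Point B} (hx : IsLoop B C (componentOf B C x)) :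
    saddleCircles B a b (Quotient.mk _ x) = ∅ := by
  ext d
  simp only [saddleCircles, Set.mem_ofPred_eq, Set.mem_empty_iff_false, iff_false]
  rintro ⟨e, -, he⟩
  have := Quotient.exact he
  change (components B a ⊔ components B b) _ _ at this
  rw [hT] at this
  exact hx e (Quotient.sound this)

theorem saddleCircles_of_not_isLoop {C : Word}
    (hT : components B a ⊔ components B b = components B C)
    (hC : underlying B a ⊔ underlying B b = underlying B C)
    {x : Point B} {e : Endpoint m} (he : componentOf B C (endpoint B e) = componentOf B C x) :
    saddleCircles B a b (Quotient.mk _ x) = {Quotient.mk _ e} := by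
  ext d
  induction d using Quotient.inductionOn with
  | h e' =>
    simp only [saddleCircles, Set.mem_ofPred_eq, Set.mem_singleton_iff]
    constructor
    · rintro ⟨e'', h1, h2⟩
      rw [← h1]
      apply Quotient.sound
      have := Quotient.exact h2
      change (components B a ⊔ components B b) _ _ at this
      rw [hT] at this
      change (underlying B a ⊔ underlying B b) _ _
      rw [hC]
      exact (components B C).trans' this ((components B C).symm' (Quotient.exact he))
    · intro h
      refine ⟨e', rfl, Quotient.sound ?_⟩
      have := Quotient.exact h
      change (underlying B a ⊔ underlying B b) _ _ at this
      rw [hC] at this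
      change (components B a ⊔ components B b) _ _
      rw [hT]
      exact (components B C).trans' this (Quotient.exact he)

/-- The data which show that the matrix element is a signed identity, once its components are known
to be discs and spheres. -/
theorem isCobIso_of_factor {C : Word} (hT : components B a ⊔ components B b = components B C)
    (ha : underlying B a = underlying B C) (hb : underlying B b = underlying B C)
    (hloop : ∀ x, IsLoop B C (componentOf B C x) →
      saddleEuler B a b j (Quotient.mk _ x) = 2 ∧ saddleDots B a b (Quotient.mk _ x) = 1)
    (harc : ∀ x, ¬ IsLoop B C (componentOf B C x) →
      saddleEuler B a b j (Quotient.mk _ x) = 1 ∧ saddleDots B a b (Quotient.mk _ x) = 0) :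
    IsCobIso (matrixElement B a b j) := by
  classical
  have hC : underlying B a ⊔ underlying B b = underlying B C := by rw [ha, hb, sup_idem]
  refine isCobIso_scalar (ha.trans hb.symm) ((-1) ^ onesCount (a.take j))
    (by rw [← mul_pow]; simp) _ fun U => ?_
  unfold matrixElement
  congr 1
  -- An undotted disc contributes `1` unless `U` demands a dot on it; a once dotted sphere always
  -- contributes `1`.
  have arc : ∀ (x : Point B) (e : Endpoint m),
      componentOf B C (endpoint B e) = componentOf B C x →
      surfaceCoeff (saddleEuler B a b j (Quotient.mk _ x))
        (saddleCircles B a b (Quotient.mk _ x)).ncard (saddleDots B a b (Quotient.mk _ x))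
        (saddleCircles B a b (Quotient.mk _ x) \ U).ncard =
        if Quotient.mk _ e ∈ U then 0 else 1 := by
    intro x e he
    obtain ⟨h1, h2⟩ := harc x (fun h => h e he)
    rw [h1, h2, saddleCircles_of_not_isLoop hT hC he, Set.ncard_singleton, surfaceCoeff_disc]
    by_cases hx : Quotient.mk _ e ∈ U
    · rw [Set.sdiff_eq_empty.2 (Set.singleton_subset_iff.2 hx)]
      simp [hx]
    · rw [(Set.disjoint_singleton_left.2 hx).sdiff_eq_left]
      simp [hx]
  apply finprod_ite_empty
  · intro k hU
    induction k using Quotient.inductionOn with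
    | h x =>
      by_cases hx : IsLoop B C (componentOf B C x)
      · obtain ⟨h1, h2⟩ := hloop x hx
        rw [h1, h2, saddleCircles_of_isLoop hT hx, Set.ncard_empty, Set.empty_sdiff,
          Set.ncard_empty, surfaceCoeff_sphere]
      · obtain ⟨e, he⟩ := not_forall_not.1 hx
        rw [arc x e he, if_neg (fun h => hU _ h)]
  · intro u hu
    induction u using Quotient.inductionOn with
    | h e => exact ⟨Quotient.mk _ (endpoint B e), by rw [arc _ e rfl, if_pos hu]⟩

theorem Absorbs.color_cases {F C : Word} {c X : Component B F} (h : Absorbs B F C c X)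
    (x : Point B) (hx : IsLoop B F (componentOf B F x)) :
    loopColor B F (componentOf B F x) = some .red ∨
      loopColor B F (componentOf B F x) = some .blue := by
  have := h.colored x hx
  match hh : loopColor B F (componentOf B F x) with
  | none => exact absurd hh this
  | some .red => exact .inl rfl
  | some .blue => exact .inr rfl

/-- Merging a red loop is an isomorphism. -/
theorem Absorbs.isCobIso_merge {c X : Component B a} (h : Absorbs B a b c X)
    (hred : loopColor B a c = some .red)
    (hj : lowerArc B a j = c ∨ lowerArc B a j = X) : IsCobIso (matrixElement B a b j) := by
  classical
  have hT : components B a ⊔ components B b = components B b := sup_eq_right.2 h.le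
  have hj' : ∀ x, (Quotient.mk (components B a ⊔ components B b)
      (j.castSucc, (B.get j).castSucc) = Quotient.mk _ x) ↔
      (componentOf B a x = c ∨ componentOf B a x = X) := by
    intro x
    rw [Quotient.eq, hT, h.rel]
    unfold lowerArc at hj
    constructor
    · rintro (h' | h' | h')
      · have e : componentOf B a (j.castSucc, (B.get j).castSucc) = componentOf B a x :=
          Quotient.sound h'
        rwa [e] at hj
      · exact .inr h'.2
      · exact .inl h'.2
    · intro hx
      rcases hj with hj | hj <;> rcases hx with hx | hx
      · exact .inl (Quotient.exact (hj.trans hx.symm))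
      · exact .inr (.inl ⟨hj, hx⟩)
      · exact .inr (.inr ⟨hj, hx⟩)
      · exact .inl (Quotient.exact (hj.trans hx.symm))
  have hcl := h.loop
  apply isCobIso_of_factor hT h.underlying_eq rfl
  -- Spheres and discs need the same count. The component with the saddle has Euler characteristic
  -- `1 - 1 + 1` if `X` is an arc and `-1 + 2 + 1` if `X` is a loop; away from the saddle an arc
  -- gives `1` and a loop `1 + 1`. The red loop `c` contributes no dot.
  all_goals
    intro x hx
    unfold saddleEuler saddleDots
    rw [h.pieces_coarse hT]
    simp only [hj' x]
    by_cases hm : componentOf B a x = c ∨ componentOf B a x = X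
    · rw [h.isLoop_iff_of_eq hm] at hx
      rw [h.pieces_fine_of_eq hT hm]
      simp only [ncard_sep_singleton, ncard_sep_pair h.ne, h.isLoop_iff_of_eq hm, hm, hx, hcl, hred]
      try
        -- The loop `X` keeps its colour after the merger. Hence exactly one dot arises: on the cap
        -- in `a` if it is blue, on the cap in `b` if it is red.
        obtain ⟨x', rfl⟩ : ∃ x', componentOf B a x' = X := Quotient.exists_rep X
        have h1 := h.color x' hx h.ne.symm
        have h2 : componentOf B b x' = componentOf B b x := by
          refine Quotient.sound ((h.rel _ _).2 ?_)
          rcases hm with hm | hm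
          · exact .inr (.inr ⟨rfl, hm⟩)
          · exact .inl (Quotient.exact hm.symm)
        rw [h2] at h1
        rcases h.color_cases x' hx with h3 | h3 <;> rw [← h1, h3] <;> simp
      try simp
    · have hm' := not_or.1 hm
      rw [h.isLoop_iff_of_ne hm'.1 hm'.2] at hx
      rw [h.pieces_fine_of_ne hT hm'.1 hm'.2]
      simp only [ncard_sep_singleton, h.isLoop_iff_of_ne hm'.1 hm'.2, hm, hx]
      try
        rw [← h.color x hx hm'.1]
        rcases h.color_cases x hx with h3 | h3 <;> rw [h3] <;> simp
      try simp

/-- Splitting off a blue loop is an isomorphism. -/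
theorem Absorbs.isCobIso_split {c X : Component B b} (h : Absorbs B b a c X)
    (hblue : loopColor B b c = some .blue)
    (hj : leftArc B b j = c ∨ leftArc B b j = X) : IsCobIso (matrixElement B a b j) := by
  classical
  have hT : components B a ⊔ components B b = components B a := sup_eq_left.2 h.le
  have hj' : ∀ x, (Quotient.mk (components B a ⊔ components B b)
      (j.castSucc, (B.get j).castSucc) = Quotient.mk _ x) ↔
      (componentOf B b x = c ∨ componentOf B b x = X) := by
    intro x
    rw [Quotient.eq, hT, h.rel]
    unfold leftArc at hj
    constructor
    · rintro (h' | h' | h')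
      · have e : componentOf B b (j.castSucc, (B.get j).castSucc) = componentOf B b x :=
          Quotient.sound h'
        rwa [e] at hj
      · exact .inr h'.2
      · exact .inl h'.2
    · intro hx
      rcases hj with hj | hj <;> rcases hx with hx | hx
      · exact .inl (Quotient.exact (hj.trans hx.symm))
      · exact .inr (.inl ⟨hj, hx⟩)
      · exact .inr (.inr ⟨hj, hx⟩)
      · exact .inl (Quotient.exact (hj.trans hx.symm))
  have hcl := h.loop
  apply isCobIso_of_factor hT rfl h.underlying_eq
  -- The mirror image of the count for merging: now `c` is capped off in `b`, where a blue loop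
  -- carries no dot.
  all_goals
    intro x hx
    unfold saddleEuler saddleDots
    rw [h.pieces_coarse hT]
    simp only [hj' x]
    by_cases hm : componentOf B b x = c ∨ componentOf B b x = X
    · rw [h.isLoop_iff_of_eq hm] at hx
      rw [h.pieces_fine_of_eq hT hm]
      simp only [ncard_sep_singleton, ncard_sep_pair h.ne, h.isLoop_iff_of_eq hm, hm, hx, hcl,
        hblue]
      try
        obtain ⟨x', rfl⟩ : ∃ x', componentOf B b x' = X := Quotient.exists_rep X
        have h1 := h.color x' hx h.ne.symm
        have h2 : componentOf B a x' = componentOf B a x := by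
          refine Quotient.sound ((h.rel _ _).2 ?_)
          rcases hm with hm | hm
          · exact .inr (.inr ⟨rfl, hm⟩)
          · exact .inl (Quotient.exact hm.symm)
        rw [h2] at h1
        rcases h.color_cases x' hx with h3 | h3 <;> rw [← h1, h3] <;> simp
      try simp
    · have hm' := not_or.1 hm
      rw [h.isLoop_iff_of_ne hm'.1 hm'.2] at hx
      rw [h.pieces_fine_of_ne hT hm'.1 hm'.2]
      simp only [ncard_sep_singleton, h.isLoop_iff_of_ne hm'.1 hm'.2, hm, hx]
      try
        rw [← h.color x hx hm'.1]
        rcases h.color_cases x hx with h3 | h3 <;> rw [h3] <;> simp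
      try simp

end Iso

/-! ## The edges of the matching -/

section Merge

variable {σ τ : ℕ → Option Smoothing} {N : ℕ} {p q x y : ℕ × ℕ}

/-- Connectivity in a diagram that arises from another one by joining two points. -/
theorem conn_iff_of_join (hfine : ∀ j < N, ∀ x y, Seg τ j x y → Conn σ N x y)
    (hjoin : Conn σ N p q)
    (hcoarse : ∀ j < N, ∀ x y, Seg σ j x y → Conn τ N x y ∨
      (Conn τ N x p ∧ Conn τ N y q) ∨ (Conn τ N x q ∧ Conn τ N y p)) :
    Conn σ N x y ↔ Conn τ N x y ∨
      (Conn τ N x p ∧ Conn τ N y q) ∨ (Conn τ N x q ∧ Conn τ N y p) := by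
  have fine : ∀ {x y}, Conn τ N x y → Conn σ N x y := by
    intro x y h
    induction h with
    | rel x y h => obtain ⟨j, hj, h⟩ := h; exact hfine j hj x y h
    | refl x => exact Conn.refl _ _ _
    | symm x y _ ih => exact ih.symm
    | trans x y z _ _ ih ih' => exact ih.trans ih'
  constructor
  · intro h
    induction h with
    | rel x y h => obtain ⟨j, hj, h⟩ := h; exact hcoarse j hj x y h
    | refl x => exact .inl (Conn.refl _ _ _)
    | symm x y _ ih =>
      rcases ih with h | h | h
      · exact .inl h.symm
      · exact .inr (.inr ⟨h.2, h.1⟩)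
      · exact .inr (.inl ⟨h.2, h.1⟩)
    | trans x y z _ _ ih ih' =>
      rcases ih with h | h | h <;> rcases ih' with h' | h' | h'
      · exact .inl (h.trans h')
      · exact .inr (.inl ⟨h.trans h'.1, h'.2⟩)
      · exact .inr (.inr ⟨h.trans h'.1, h'.2⟩)
      · exact .inr (.inl ⟨h.1, h'.symm.trans h.2⟩)
      · exact .inr (.inl ⟨h.1, h'.2⟩)
      · exact .inl (h.1.trans h'.2.symm)
      · exact .inr (.inr ⟨h.1, h'.symm.trans h.2⟩)
      · exact .inl (h.1.trans h'.2.symm)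
      · exact .inr (.inr ⟨h.1, h'.2⟩)
  · rintro (h | h | h)
    · exact fine h
    · exact ((fine h.1).trans hjoin).trans (fine h.2).symm
    · exact ((fine h.1).trans hjoin.symm).trans (fine h.2).symm

end Merge

section Torus

variable {n : ℕ} {w a b : Word}

theorem IsCell.length_eq (h : IsCell (torusBraid n) w) : w.length = 3 * n := (isCell_iff.1 h).1

theorem IsCell.color_iff (h : IsCell (torusBraid n) w) {j : ℕ} {x : Letter} (hx : w[j]? = some x) :
    x.color ≠ none ↔ Closing (sm w) j := (isCell_iff.1 h).2 j x hx

theorem exists_letter (hw : w.length = 3 * n) {j : ℕ} (hj : j < 3 * n) :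
    ∃ x, w[j]? = some x := by
  simp [hw, hj]

theorem sm_of_getElem? {j : ℕ} {x : Letter} (h : w[j]? = some x) : sm w j = some x.smoothing := by
  simp [sm, h]

/-- The first point of the cap in layer `k`. -/
abbrev capPoint (n k : ℕ) (hk : k < 3 * n) : Point (torusBraid n) :=
  point n k (k % 3) hk.le ((Nat.mod_lt _ (by norm_num)).trans (by norm_num))

theorem maxLayer_eq_of_le {F C : Word} {x : Point (torusBraid n)} {l : ℕ}
    (hF : maxLayer (torusBraid n) F (componentOf (torusBraid n) F x) = l)
    (hFC : components (torusBraid n) F ≤ components (torusBraid n) C)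
    (hle : ∀ y, components (torusBraid n) C y x → (y.1 : ℕ) ≤ l) :
    maxLayer (torusBraid n) C (componentOf (torusBraid n) C x) = l := by
  apply le_antisymm
  · obtain ⟨y, hy, hy'⟩ := exists_level_eq_maxLayer (componentOf (torusBraid n) C x)
    rw [← hy']
    exact hle y (Quotient.exact hy)
  · obtain ⟨y, hy, hy'⟩ := exists_level_eq_maxLayer (componentOf (torusBraid n) F x)
    rw [← hF, ← hy']
    have : componentOf (torusBraid n) C y = componentOf (torusBraid n) C x :=
      Quotient.sound (hFC (Quotient.exact hy))
    rw [← this]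
    exact level_le_maxLayer y

/-- By `hq` the union of the two components inherits its highest layer from `X`, not from the
absorbed loop. The colour of `X` is therefore engraved at the same position in both words, where
`hletters` says that they agree. -/
theorem absorbs_of_rel {F C : Word} (hF : IsCell (torusBraid n) F) {k : ℕ}
    (hk : k < 3 * n) (hc : Closing (sm F) k) (q : Point (torusBraid n))
    (hne : componentOf (torusBraid n) F (capPoint n k hk) ≠ componentOf (torusBraid n) F q)
    (hrel : ∀ x y, components (torusBraid n) C x y ↔ components (torusBraid n) F x y ∨
      (componentOf (torusBraid n) F x = componentOf (torusBraid n) F (capPoint n k hk) ∧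
        componentOf (torusBraid n) F y = componentOf (torusBraid n) F q) ∨
      (componentOf (torusBraid n) F x = componentOf (torusBraid n) F q ∧
        componentOf (torusBraid n) F y = componentOf (torusBraid n) F (capPoint n k hk)))
    (hq : IsLoop (torusBraid n) F (componentOf (torusBraid n) F q) →
      k ≤ maxLayer (torusBraid n) F (componentOf (torusBraid n) F q))
    (hletters : ∀ l, l ≠ k → sm F l = some .zero → F[l]? = C[l]?) :
    Absorbs (torusBraid n) F C (componentOf (torusBraid n) F (capPoint n k hk))
      (componentOf (torusBraid n) F q) where
  loop := (hc.isLoop hF.length_eq hk (coords_point _ _ _ _)).1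
  ne := hne
  rel := hrel
  color x hx hxc := by
    set l := maxLayer (torusBraid n) F (componentOf (torusBraid n) F x) with hl
    obtain ⟨hlN, hcl, hpt⟩ := hx.eq_of_maxLayer hF.length_eq hl.symm
    have hlk : l ≠ k := by
      rintro h
      refine hxc (hpt _ ?_)
      rw [coords_point, h]
    have hmax : maxLayer (torusBraid n) C (componentOf (torusBraid n) C x) = l := by
      refine maxLayer_eq_of_le hl.symm (fun x y h => (hrel x y).2 (.inl h)) fun y hy => ?_
      rcases (hrel _ _).1 hy with h | h | h
      · have : componentOf (torusBraid n) F y = componentOf (torusBraid n) F x := Quotient.sound h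
        rw [hl, ← this]
        exact level_le_maxLayer y
      · rw [h.2] at hx hl
        have hy := level_le_maxLayer (w := F) y
        rw [h.1, (hc.isLoop hF.length_eq hk (coords_point _ _ _ _)).2] at hy
        rw [hl]
        exact hy.trans (hq hx)
      · exact absurd h.2 hxc
    unfold loopColor
    rw [hmax, ← hl, hletters l hlk hcl.1]
  colored x hx := by
    obtain ⟨hlN, hcl, -⟩ := hx.eq_of_maxLayer hF.length_eq rfl
    obtain ⟨c, hcF⟩ := exists_letter hF.length_eq hlN
    unfold loopColor
    rw [hcF]
    exact (hF.color_iff hcF).2 hcl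

theorem layer_lt (j : Fin (torusBraid n).length) : (j : ℕ) < 3 * n := by
  have := j.2
  have := torusBraid_length n
  omega

theorem coords_lowerPoint (j : Fin (torusBraid n).length) :
    coords ((j.castSucc, ((torusBraid n).get j).castSucc) : Point (torusBraid n)) =
      ((j : ℕ), (j : ℕ) % 3) := by
  simp only [coords, get_castSucc_val]; rfl

theorem coords_lowerPoint' (j : Fin (torusBraid n).length) :
    coords ((j.castSucc, ((torusBraid n).get j).succ) : Point (torusBraid n)) =
      ((j : ℕ), (j : ℕ) % 3 + 1) := by
  simp only [coords, get_succ_val]; rfl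

theorem coords_upperPoint (j : Fin (torusBraid n).length) :
    coords ((j.succ, ((torusBraid n).get j).castSucc) : Point (torusBraid n)) =
      ((j : ℕ) + 1, (j : ℕ) % 3) := by
  simp only [coords, get_castSucc_val]; rfl

theorem isLeast_of_isLeast {B : List (Fin 3)} {j : Fin B.length} {k : ℕ} {a b : Word}
    (h : IsLeast (maxLayer B a '' mergedRedLoops B a j ∪ maxLayer B b '' splitBlueLoops B b j) k) :
    (∃ c ∈ mergedRedLoops B a j, maxLayer B a c = k) ∨
      (∃ c ∈ splitBlueLoops B b j, maxLayer B b c = k) := h.1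

theorem Letter.eq_redZero {x : Letter} (h : x.smoothing = .zero) (h' : x.color = some .red) :
    x = .redZero := by cases x <;> simp_all [Letter.smoothing, Letter.color]

theorem Letter.eq_blueZero {x : Letter} (h : x.smoothing = .zero) (h' : x.color = some .blue) :
    x = .blueZero := by cases x <;> simp_all [Letter.smoothing, Letter.color]

theorem Letter.eq_one {x : Letter} (h : x.smoothing = .one) (h' : x.color = none) :
    x = .one := by cases x <;> simp_all [Letter.smoothing, Letter.color]

theorem Letter.eq_zero {x : Letter} (h : x.smoothing = .zero) (h' : x.color = none) :
    x = .zero := by cases x <;> simp_all [Letter.smoothing, Letter.color]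

theorem letter_of_loopColor (hw : IsCell (torusBraid n) w) {c : Component (torusBraid n) w}
    (hc : IsLoop (torusBraid n) w c) {k : ℕ} (hk : maxLayer (torusBraid n) w c = k)
    {r : Color} (hr : loopColor (torusBraid n) w c = some r) :
    Closing (sm w) k ∧ ∃ x, w[k]? = some x ∧ x.smoothing = .zero ∧ x.color = some r := by
  obtain ⟨hkN, hcl, -⟩ := hc.eq_of_maxLayer hw.length_eq hk
  obtain ⟨x, hx⟩ := exists_letter hw.length_eq hkN
  refine ⟨hcl, x, hx, ?_, ?_⟩
  · have := hcl.1
    rw [sm_of_getElem? hx] at this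
    exact Option.some_injective _ this
  · rw [loopColor, hk, hx] at hr
    exact hr

theorem ChangesAt.sm {j : Fin (torusBraid n).length} (h : ChangesAt (torusBraid n) a b j) :
    sm a j = some .zero ∧ sm b j = some .one ∧ ∀ l : ℕ, l ≠ j → sm a l = sm b l := h

/-- A loop with highest layer `j` needs a cap there, and `e.2` has none. So the minimum is attained
by a merged red loop of `e.1`. -/
theorem isoEdges_self {j : Fin (torusBraid n).length} {e : Word × Word}
    (h : e ∈ isoEdges (torusBraid n) j j) :
    e.1[(j : ℕ)]? = some .redZero ∧ e.2[(j : ℕ)]? = some .one ∧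
      Conn (sm e.2) j (j, j % 3) (j, j % 3 + 1) := by
  obtain ⟨ha, hb, hch, -, hl⟩ := h
  obtain ⟨h1, h2, h3⟩ := hch.sm
  rcases isLeast_of_isLeast hl with ⟨c, hc, hk⟩ | ⟨c, hc, hk⟩
  · obtain ⟨hcl, x, hx, hs, hr⟩ := letter_of_loopColor ha hc.1 hk hc.2.1
    refine ⟨by rw [hx, Letter.eq_redZero hs hr], ?_, hcl.2.congr fun l hlj => h3 l hlj.ne⟩
    obtain ⟨y, hy⟩ := exists_letter hb.length_eq (layer_lt j)
    have hys : y.smoothing = .one := by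
      rw [sm_of_getElem? hy] at h2
      exact Option.some_injective _ h2
    rw [hy, Letter.eq_one hys]
    by_contra hcol
    have := ((hb.color_iff hy).1 hcol).1
    rw [h2] at this
    exact absurd this (by simp)
  · obtain ⟨hcl, -⟩ := letter_of_loopColor hb hc.1 hk hc.2.1
    rw [Closing, h2] at hcl
    exact absurd hcl.1 (by simp)

/-- The loop that attains the minimum passes through the changed layer, which therefore lies below
the cap that closes the loop off. -/
theorem isoEdges_of_ne {j : Fin (torusBraid n).length} {k : ℕ} {e : Word × Word}
    (h : e ∈ isoEdges (torusBraid n) j k) (hjk : (j : ℕ) ≠ k) :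
    (j : ℕ) < k ∧ k < 3 * n ∧ (e.1[k]? = some .redZero ∨
      (e.2[k]? = some .blueZero ∧ Closing (sm e.2) k ∧
        (Conn (sm e.2) k (k, k % 3) (j, j % 3) ∨
          Conn (sm e.2) k (k, k % 3) (j, j % 3 + 1)))) := by
  obtain ⟨ha, hb, hch, -, hl⟩ := h
  rcases isLeast_of_isLeast hl with ⟨c, hc, hk⟩ | ⟨c, hc, hk⟩
  · obtain ⟨hcl, x, hx, hs, hr⟩ := letter_of_loopColor ha hc.1 hk hc.2.1
    refine ⟨lt_of_le_of_ne ?_ hjk, (hc.1.eq_of_maxLayer ha.length_eq hk).1,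
      .inl (by rw [hx, Letter.eq_redZero hs hr])⟩
    rw [← hk]
    rcases hc.2.2.2 with rfl | rfl
    · exact level_le_maxLayer (w := e.1) (j.castSucc, _)
    · exact (Nat.le_succ _).trans (level_le_maxLayer (w := e.1) (j.succ, _))
  · obtain ⟨hcl, x, hx, hs, hr⟩ := letter_of_loopColor hb hc.1 hk hc.2.1
    obtain ⟨hkN, -, hpt⟩ := hc.1.eq_of_maxLayer hb.length_eq hk
    have hpt := hpt (capPoint n k hkN) (coords_point _ _ _ _)
    have hiff : ∀ {y}, _ ↔ _ := fun {y} => hcl.conn_iff (y := y)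
      (fun j hj => sm_ne_none hb.length_eq j (hj.trans hkN)) hkN.le
    refine ⟨lt_of_le_of_ne ?_ hjk, hkN, .inr ⟨by rw [hx, Letter.eq_blueZero hs hr], hcl, ?_⟩⟩
    · rw [← hk]
      rcases hc.2.2.2 with rfl | rfl
      · exact level_le_maxLayer (w := e.2) (j.castSucc, _)
      · exact level_le_maxLayer (w := e.2) (j.castSucc, _)
    · rcases hc.2.2.2 with h | h
      · left
        rw [← hiff]
        rw [hpt, leftArc, componentOf_eq_iff, coords_point, coords_lowerPoint] at h
        exact h
      · right
        rw [← hiff]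
        rw [hpt, rightArc, componentOf_eq_iff, coords_point, coords_lowerPoint'] at h
        exact h

/-- Merging a red loop at the layer that closes it off. -/
theorem mem_isoEdges_self (ha : IsCell (torusBraid n) a) (hb : IsCell (torusBraid n) b)
    (j : Fin (torusBraid n).length) (haj : a[(j : ℕ)]? = some .redZero)
    (hbj : b[(j : ℕ)]? = some .one) (hab : ∀ l : ℕ, l ≠ j → a[l]? = b[l]?) :
    (a, b) ∈ isoEdges (torusBraid n) j j := by
  obtain ⟨k, hk'⟩ := j
  have hk : k < 3 * n := torusBraid_length n ▸ hk'
  simp only at haj hbj hab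
  have hi : k % 3 < 3 := Nat.mod_lt _ (by norm_num)
  have hcl : Closing (sm a) k := (ha.color_iff haj).1 (by simp [Letter.color])
  have hσ : ∀ j < k, sm a j ≠ none := fun j hj => sm_ne_none ha.length_eq j (hj.trans hk)
  have hsm : ∀ l, l ≠ k → sm a l = sm b l := fun l hl => by simp only [sm, hab l hl]
  have hak : sm a k = some .zero := hcl.1
  have hbk : sm b k = some .one := sm_of_getElem? hbj
  have hcapb : Conn (sm b) (3 * n) (k, k % 3) (k, k % 3 + 1) :=
    (hcl.2.congr fun l hl => hsm l hl.ne).mono hk.le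
  have hvert : ∀ p < 4, Conn (sm b) (3 * n) (k, p) (k + 1, p) := fun p hp =>
    (Seg.vertical p hp (.inl hbk)).conn hk
  have hcapa : Conn (sm a) (3 * n) (k, k % 3) (k, k % 3 + 1) := hcl.2.mono hk.le
  have hcupa : Conn (sm a) (3 * n) (k + 1, k % 3) (k + 1, k % 3 + 1) := (Seg.cup hak).conn hk
  -- Replacing the closing cap and the cup above it by vertical segments joins the loop to the
  -- component of the cup and changes nothing else.
  have hrel : ∀ x y, Conn (sm b) (3 * n) x y ↔ _ := fun x y =>
    conn_iff_of_join (σ := sm b) (τ := sm a) (N := 3 * n) (p := (k, k % 3)) (q := (k + 1, k % 3))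
      (x := x) (y := y) (by
        intro j hj x y hxy
        by_cases hjk : j = k
        · subst hjk
          cases hxy with
          | vertical p hp h => exact hvert p hp
          | cap h => exact hcapb
          | cup h =>
            exact ((hvert _ (by omega)).symm.trans hcapb).trans (hvert _ (by omega))
        · exact (hxy.congr (hsm j hjk)).conn hj)
      (hvert _ (by omega)) (by
        intro j hj x y hxy
        by_cases hjk : j = k
        · subst hjk
          cases hxy with
          | vertical p hp h =>
            by_cases h1 : p = j % 3
            · subst h1
              exact .inr (.inl ⟨Conn.refl _ _ _, Conn.refl _ _ _⟩)
            by_cases h2 : p = j % 3 + 1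
            · subst h2
              exact .inr (.inl ⟨hcapa.symm, hcupa.symm⟩)
            exact .inl ((Seg.vertical p hp (.inr ⟨hak, h1, h2⟩)).conn hj)
          | cap h => simp [hbk] at h
          | cup h => simp [hbk] at h
        · exact .inl ((hxy.congr (hsm j hjk).symm).conn hj))
  let q : Point (torusBraid n) := point n (k + 1) (k % 3) (by omega) (by omega)
  have hne : componentOf (torusBraid n) a (capPoint n k hk) ≠ componentOf (torusBraid n) a q := by
    rw [Ne, componentOf_eq_iff, coords_point, coords_point, hcl.conn_iff hσ hk.le]
    intro h
    have := h.level_le le_rfl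
    simp at this
  have habs := absorbs_of_rel (C := b) ha hk hcl q hne (by
    intro x y
    simp only [components_iff, componentOf_eq_iff]
    exact hrel _ _) (fun _ => (Nat.le_succ k).trans (level_le_maxLayer q))
    (fun l hl _ => hab l hl)
  have hlower : lowerArc (torusBraid n) a ⟨k, hk'⟩ =
      componentOf (torusBraid n) a (capPoint n k hk) :=
    congrArg _ (coords_injective (coords_lowerPoint _))
  have hupper : upperArc (torusBraid n) a ⟨k, hk'⟩ = componentOf (torusBraid n) a q :=
    congrArg _ (coords_injective (coords_upperPoint _))
  have hloop := hcl.isLoop ha.length_eq hk (coords_point k (k % 3) hk.le (by omega))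
  have hred : loopColor (torusBraid n) a (componentOf (torusBraid n) a (capPoint n k hk)) =
      some .red := by
    rw [loopColor, hloop.2, haj]; rfl
  refine ⟨ha, hb, ⟨hak, hbk, hsm⟩, habs.isCobIso_merge hred (.inl hlower), .inl ⟨_, ⟨hloop.1, hred,
    by rwa [hlower, hupper], .inl hlower.symm⟩, hloop.2⟩, ?_⟩
  -- The other merged component reaches level `k + 1`, and in `b` the two strands are joined below,
  -- so nothing is split off.
  rintro l (⟨c, hc, rfl⟩ | ⟨c, hc, rfl⟩)
  · rcases hc.2.2.2 with rfl | rfl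
    · rw [hlower, hloop.2]
    · rw [hupper]
      exact (Nat.le_succ k).trans (level_le_maxLayer q)
  · refine absurd ?_ hc.2.2.1
    rw [leftArc, rightArc, componentOf_eq_iff, coords_lowerPoint, coords_lowerPoint']
    exact hcapb

end Torus

/-! ## Loops of height two -/

section SimpleLoop

variable {σ τ : ℕ → Option Smoothing} {k N : ℕ} {x y : ℕ × ℕ}

/-- The loop closed off in layer `k` consists of two vertical strands of height two. -/
structure SimpleLoop (σ : ℕ → Option Smoothing) (k : ℕ) : Prop where
  le : 3 ≤ k
  cup : σ (k - 3) = some .zero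
  strand₁ : k % 3 ≠ 0 → σ (k - 1) = some .one
  strand₂ : k % 3 ≠ 2 → σ (k - 2) = some .one

/-- The points of a loop of height two. -/
def loopPoint (k : ℕ) (x : ℕ × ℕ) : Prop :=
  k ≤ x.1 + 2 ∧ x.1 ≤ k ∧ (x.2 = k % 3 ∨ x.2 = k % 3 + 1)

/-- The label is the rectangle of six points itself. The cup closes it at the bottom, and each layer
in between whose crossing touches it is `1`-smoothed. -/
theorem SimpleLoop.loopPoint_of_conn (h : SimpleLoop σ k) (hx : Conn σ k (k, k % 3) x) :
    loopPoint k x := by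
  have := hx.label (loopPoint k) (by
    intro j hj x y hxy
    have h3 := h.le
    have h2 := h.cup
    have s1 := h.strand₁
    have s2 := h.strand₂
    refine propext ?_
    rcases (by omega : j < k - 3 ∨ j = k - 3 ∨ j = k - 2 ∨ j = k - 1) with h | h | h | h
    · have := hxy.level
      unfold loopPoint
      omega
    · rw [← h] at h2
      cases hxy <;> simp only [loopPoint] <;> simp_all <;> omega
    · rw [← h] at s2
      cases hxy <;> simp only [loopPoint] <;> simp_all <;> omega
    · rw [← h] at s1
      cases hxy <;> simp only [loopPoint] <;> simp_all <;> omega)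
  rw [← this]
  exact ⟨by simp, le_rfl, .inl rfl⟩

/-- The strands of a loop of height two, with one vertical segment left out, are connected. -/
theorem conn_of_loopPoint {j s : ℕ} (hk : 3 ≤ k) (hs : s = k % 3 ∨ s = k % 3 + 1)
    (hj : j = k - 1 ∨ j = k - 2)
    (hcap : Conn σ N (k, k % 3) (k, k % 3 + 1)) (hcup : Conn σ N (k - 2, k % 3) (k - 2, k % 3 + 1))
    (hv : ∀ l p, l = k - 1 ∨ l = k - 2 → p = k % 3 ∨ p = k % 3 + 1 → ¬(l = j ∧ p = s) →
      Conn σ N (l, p) (l + 1, p)) (hx : loopPoint k x) : Conn σ N (k, k % 3) x := by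
  obtain ⟨l, p⟩ := x
  obtain ⟨h1, h2, h3⟩ := hx
  simp only at h1 h2 h3
  generalize hi : k % 3 = i at *
  obtain ⟨k, rfl⟩ : ∃ k', k = k' + 2 := ⟨k - 2, by omega⟩
  have e1 : k + 2 - 1 = k + 1 := rfl
  have e2 : k + 2 - 2 = k := rfl
  rw [e1, e2] at hj
  rw [e2] at hcup
  have v1 : ∀ p, p = i ∨ p = i + 1 → ¬(k = j ∧ p = s) → Conn σ N (k, p) (k + 1, p) :=
    fun p hp h => hv k p (.inr rfl) hp h
  have v2 : ∀ p, p = i ∨ p = i + 1 → ¬(k + 1 = j ∧ p = s) → Conn σ N (k + 1, p) (k + 2, p) :=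
    fun p hp h => hv (k + 1) p (.inl rfl) hp h
  -- The strand opposite to the one with the missing segment; it serves as the detour.
  obtain ⟨s', hs', hss', h4, h5⟩ : ∃ s', (s' = i ∨ s' = i + 1) ∧ s' ≠ s ∧
      Conn σ N (k, s') (k, s) ∧ Conn σ N (k + 2, s') (k + 2, s) := by
    rcases hs with rfl | rfl
    · exact ⟨_, .inr rfl, by omega, hcup.symm, hcap.symm⟩
    · exact ⟨_, .inl rfl, by omega, hcup, hcap⟩
  have u1 := v1 s' hs' (fun h => hss' h.2)
  have u2 := v2 s' hs' (fun h => hss' h.2)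
  have base : Conn σ N (k + 2, i) (k + 2, s') := by
    rcases hs' with rfl | rfl
    · exact Conn.refl _ _ _
    · exact hcap
  refine base.trans ?_
  have hp : p = s' ∨ p = s := by omega
  rcases (by omega : l = k ∨ l = k + 1 ∨ l = k + 2) with rfl | rfl | rfl <;> rcases hp with rfl | rfl
  · exact (u1.trans u2).symm
  · exact (u1.trans u2).symm.trans h4
  · exact u2.symm
  · rcases hj with rfl | rfl
    · exact (u1.trans u2).symm.trans (h4.trans (v1 p hs (by omega)))
    · exact h5.trans (v2 p hs (by omega)).symm
  · exact Conn.refl _ _ _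
  · exact h5

theorem SimpleLoop.vertical (h : SimpleLoop σ k) (hσ : ∀ j < k, σ j ≠ none) (hN : k ≤ N) {l p : ℕ}
    (hl : l = k - 1 ∨ l = k - 2) (hp : p = k % 3 ∨ p = k % 3 + 1) :
    Conn σ N (l, p) (l + 1, p) := by
  have h3 := h.le
  refine (Seg.vertical p (by omega) ?_).conn (j := l) (by omega)
  match hs : σ l with
  | none => exact absurd hs (hσ l (by omega))
  | some .one => exact .inl rfl
  | some .zero =>
    refine .inr ⟨rfl, ?_⟩
    rcases hl with rfl | rfl
    · have := h.strand₁
      rw [hs] at this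
      simp only [Option.some.injEq, reduceCtorEq, imp_false, not_not] at this
      omega
    · have := h.strand₂
      rw [hs] at this
      simp only [Option.some.injEq, reduceCtorEq, imp_false, not_not] at this
      omega

theorem SimpleLoop.conn_cup (h : SimpleLoop σ k) (hN : k ≤ N) :
    Conn σ N (k - 2, k % 3) (k - 2, k % 3 + 1) := by
  have h3 := h.le
  have := (Seg.cup h.cup).conn (k := N) (by omega)
  rwa [show k - 3 + 1 = k - 2 by omega, show (k - 3) % 3 = k % 3 by omega] at this

/-- The saddle in layer `j` joins a strand of the loop of height two closed off in layer `k` to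
another strand, in position `t`. -/
theorem conn_iff_of_simpleLoop (h : SimpleLoop τ k) (hτ : ∀ j < N, τ j ≠ none) (hk : k < N)
    (hτk : τ k = some .zero) {j s t : ℕ} (hτj : τ j = some .one) (hσj : σ j = some .zero)
    (hστ : ∀ l, l ≠ j → σ l = τ l)
    (hst : (s = j % 3 ∧ t = j % 3 + 1) ∨ (s = j % 3 + 1 ∧ t = j % 3))
    (hs : s = k % 3 ∨ s = k % 3 + 1) (ht : t ≠ k % 3 ∧ t ≠ k % 3 + 1)
    (hj : j = k - 1 ∨ j = k - 2) :
    (Conn σ N x y ↔ Conn τ N x y ∨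
      (Conn τ N x (k, k % 3) ∧ Conn τ N y (j, t)) ∨
      (Conn τ N x (j, t) ∧ Conn τ N y (k, k % 3))) ∧
    Conn τ N (k, k % 3) (j, s) ∧ Conn σ N (j, j % 3) (j + 1, j % 3) := by
  have h3 := h.le
  have hσk : σ k = some .zero := (hστ k (by omega)).trans hτk
  have loopτ : ∀ {x}, loopPoint k x → Conn τ N (k, k % 3) x := fun hx =>
    conn_of_loopPoint h3 hs hj ((Seg.cap hτk).conn hk) (h.conn_cup hk.le)
      (fun l p hl hp _ => h.vertical (fun j hj => hτ j (hj.trans hk)) hk.le hl hp) hx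
  have loopσ : ∀ {x}, loopPoint k x → Conn σ N (k, k % 3) x := fun hx => by
    refine conn_of_loopPoint h3 hs hj ((Seg.cap hσk).conn hk) ?_ (fun l p hl hp hlp => ?_) hx
    · have := (Seg.cup (σ := σ) (j := k - 3) ?_).conn (k := N) (by omega)
      · rwa [show k - 3 + 1 = k - 2 by omega, show (k - 3) % 3 = k % 3 by omega] at this
      · rw [hστ _ (by omega), h.cup]
    · by_cases hlj : l = j
      · subst hlj
        exact (Seg.vertical p (by omega) (.inr ⟨hσj, by omega, by omega⟩)).conn (by omega)
      · refine (Seg.vertical p (by omega) ?_).conn (by omega)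
        rw [hστ l hlj]
        match hs : τ l with
        | none => exact absurd hs (hτ l (by omega))
        | some .one => exact .inl rfl
        | some .zero =>
          refine .inr ⟨rfl, ?_⟩
          have s1 := h.strand₁
          have s2 := h.strand₂
          rcases hl with rfl | rfl
          · rw [hs] at s1
            simp only [Option.some.injEq, reduceCtorEq, imp_false, not_not] at s1
            omega
          · rw [hs] at s2
            simp only [Option.some.injEq, reduceCtorEq, imp_false, not_not] at s2
            omega
  have p1 : loopPoint k (j, s) := ⟨by simp only; omega, by simp only; omega, hs⟩
  have p2 : loopPoint k (j + 1, s) := ⟨by simp only; omega, by simp only; omega, hs⟩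
  -- In `σ` the vertical segment at `s` is missing, but its ends remain connected around the other
  -- side of the loop.
  have vert : Conn σ N (j, s) (j + 1, s) := (loopσ p1).symm.trans (loopσ p2)
  have cap : Conn σ N (j, s) (j, t) := by
    have := (Seg.cap hσj).conn (k := N) (by omega)
    rcases hst with ⟨rfl, rfl⟩ | ⟨rfl, rfl⟩
    · exact this
    · exact this.symm
  have cup : Conn σ N (j + 1, s) (j + 1, t) := by
    have := (Seg.cup hσj).conn (k := N) (by omega)
    rcases hst with ⟨rfl, rfl⟩ | ⟨rfl, rfl⟩
    · exact this
    · exact this.symm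
  have vert' : Conn σ N (j, t) (j + 1, t) := (cap.symm.trans vert).trans cup
  have vertτ : Conn τ N (j, t) (j + 1, t) :=
    (Seg.vertical t (by omega) (.inl hτj)).conn (by omega)
  refine ⟨conn_iff_of_join ?_ ((loopσ p1).trans cap) ?_, loopτ p1, ?_⟩
  · intro l hl x y hxy
    by_cases hlj : l = j
    · subst hlj
      cases hxy with
      | vertical p hp _ =>
        by_cases h1 : p = s
        · subst h1; exact vert
        by_cases h2 : p = t
        · subst h2; exact vert'
        exact (Seg.vertical p hp (.inr ⟨hσj, by omega, by omega⟩)).conn hl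
      | cap h => simp [hτj] at h
      | cup h => simp [hτj] at h
    · exact (hxy.congr (hστ l hlj).symm).conn hl
  · intro l hl x y hxy
    by_cases hlj : l = j
    · subst hlj
      cases hxy with
      | vertical p hp _ => exact .inl ((Seg.vertical p hp (.inl hτj)).conn hl)
      | cap _ =>
        rcases hst with ⟨rfl, rfl⟩ | ⟨rfl, rfl⟩
        · exact .inr (.inl ⟨(loopτ p1).symm, Conn.refl _ _ _⟩)
        · exact .inr (.inr ⟨Conn.refl _ _ _, (loopτ p1).symm⟩)
      | cup _ =>
        rcases hst with ⟨rfl, rfl⟩ | ⟨rfl, rfl⟩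
        · exact .inr (.inl ⟨(loopτ p2).symm, vertτ.symm⟩)
        · exact .inr (.inr ⟨vertτ.symm, (loopτ p2).symm⟩)
    · exact .inl ((hxy.congr (hστ l hlj)).conn hl)
  · rcases hst with ⟨rfl, rfl⟩ | ⟨rfl, rfl⟩
    · exact vert
    · exact vert'

end SimpleLoop

section Torus

variable {n : ℕ} {a b : Word}

/-- Splitting a blue loop of height two off another strand. -/
theorem mem_isoEdges_of_simpleLoop (ha : IsCell (torusBraid n) a) (hb : IsCell (torusBraid n) b)
    (j : Fin (torusBraid n).length) {k : ℕ} (hak : a[k]? = some .zero)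
    (hbk : b[k]? = some .blueZero) (hloop : SimpleLoop (sm b) k)
    (hch : ChangesAt (torusBraid n) a b j) (hab : ∀ l : ℕ, l ≠ j → l ≠ k → a[l]? = b[l]?)
    (hj : (k % 3 ≠ 0 ∧ (j : ℕ) = k - 1) ∨ (k % 3 ≠ 2 ∧ (j : ℕ) = k - 2)) :
    (a, b) ∈ isoEdges (torusBraid n) j k := by
  have h3 := hloop.le
  have hk : k < 3 * n := hb.length_eq ▸ (List.getElem?_eq_some_iff.1 hbk).1
  have hcl : Closing (sm b) k := (hb.color_iff hbk).1 (by simp [Letter.color])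
  have hσ : ∀ j < k, sm b j ≠ none := fun j hj => sm_ne_none hb.length_eq j (hj.trans hk)
  obtain ⟨haj, hbj, hsm⟩ := hch.sm
  obtain ⟨s, t, hst, hs, ht⟩ : ∃ s t, ((s = (j : ℕ) % 3 ∧ t = (j : ℕ) % 3 + 1) ∨
      (s = (j : ℕ) % 3 + 1 ∧ t = (j : ℕ) % 3)) ∧ (s = k % 3 ∨ s = k % 3 + 1) ∧
      (t ≠ k % 3 ∧ t ≠ k % 3 + 1) := by
    by_cases h : (j : ℕ) % 3 = k % 3 + 1
    · exact ⟨_, _, .inl ⟨rfl, rfl⟩, by omega, by omega⟩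
    · exact ⟨_, _, .inr ⟨rfl, rfl⟩, by omega, by omega⟩
  have hj' : (j : ℕ) = k - 1 ∨ (j : ℕ) = k - 2 := by omega
  have main := fun x y => conn_iff_of_simpleLoop (x := x) (y := y) hloop (sm_ne_none hb.length_eq)
    hk hcl.1 hbj haj hsm hst hs ht hj'
  -- The last two facts do not involve `x` and `y`, so any points will do.
  obtain ⟨-, hs_conn, hvert⟩ := main (0, 0) (0, 0)
  let q : Point (torusBraid n) := point n j t (by omega) (by omega)
  have hne : componentOf (torusBraid n) b (capPoint n k hk) ≠ componentOf (torusBraid n) b q := by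
    rw [Ne, componentOf_eq_iff, coords_point, coords_point, hcl.conn_iff hσ hk.le]
    intro h
    have := (hloop.loopPoint_of_conn h).2.2
    simp only at this
    omega
  have hrel : ∀ x y, components (torusBraid n) a x y ↔ components (torusBraid n) b x y ∨
      (componentOf (torusBraid n) b x = componentOf (torusBraid n) b (capPoint n k hk) ∧
        componentOf (torusBraid n) b y = componentOf (torusBraid n) b q) ∨
      (componentOf (torusBraid n) b x = componentOf (torusBraid n) b q ∧
        componentOf (torusBraid n) b y = componentOf (torusBraid n) b (capPoint n k hk)) := by
    intro x y
    simp only [components_iff, componentOf_eq_iff]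
    exact (main _ _).1
  have hl := hcl.isLoop hb.length_eq hk (coords_point k (k % 3) hk.le (by omega))
  -- If the other strand belonged to a loop closed off below layer `k`, the merged component of `a`
  -- would be a loop with highest layer `k`; but the letter of `a` there is uncoloured. Thus `k` is
  -- also the least value for this edge.
  have hq : IsLoop (torusBraid n) b (componentOf (torusBraid n) b q) →
      k < maxLayer (torusBraid n) b (componentOf (torusBraid n) b q) := by
    intro hX
    by_contra hle
    have hXk := lt_of_le_of_ne (not_lt.1 hle) (fun h => hne
      ((hX.eq_of_maxLayer hb.length_eq h).2.2 (capPoint n k hk) (coords_point _ _ _ _)).symm)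
    have hmax : maxLayer (torusBraid n) a (componentOf (torusBraid n) a (capPoint n k hk)) = k := by
      refine maxLayer_eq_of_le hl.2 (fun x y h => (hrel x y).2 (.inl h)) fun y hy => ?_
      have hy' := level_le_maxLayer (w := b) y
      rcases (hrel _ _).1 hy with h | h | h
      · have e : componentOf (torusBraid n) b y = componentOf (torusBraid n) b (capPoint n k hk) :=
          Quotient.sound h
        rw [e, hl.2] at hy'
        exact hy'
      · rw [h.1, hl.2] at hy'
        exact hy'
      · rw [h.1] at hy'
        exact hy'.trans hXk.le
    have hal : IsLoop (torusBraid n) a (componentOf (torusBraid n) a (capPoint n k hk)) := by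
      intro e he
      rcases (hrel _ _).1 (Quotient.exact he) with h | h | h
      · exact hl.1 e (Quotient.sound h)
      · exact hl.1 e h.1
      · exact hX e h.1
    have := (hal.eq_of_maxLayer ha.length_eq hmax).2.1
    exact (ha.color_iff hak).2 this rfl
  have habs := absorbs_of_rel (C := a) hb hk hcl q hne hrel (fun h => (hq h).le) (by
    intro l hlk hlz
    refine (hab l ?_ hlk).symm
    rintro rfl
    rw [hbj] at hlz
    exact absurd hlz (by simp))
  have hblue : loopColor (torusBraid n) b (componentOf (torusBraid n) b (capPoint n k hk)) =
      some .blue := by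
    rw [loopColor, hl.2, hbk]; rfl
  have hs_eq : ∀ x : Point (torusBraid n), coords x = ((j : ℕ), s) →
      componentOf (torusBraid n) b x = componentOf (torusBraid n) b (capPoint n k hk) := by
    intro x hx
    rw [componentOf_eq_iff, hx, coords_point]
    exact hs_conn.symm
  have ht_eq : ∀ x : Point (torusBraid n), coords x = ((j : ℕ), t) →
      componentOf (torusBraid n) b x = componentOf (torusBraid n) b q :=
    fun x hx => congrArg _ (coords_injective hx)
  have arcs : (leftArc (torusBraid n) b j = componentOf (torusBraid n) b (capPoint n k hk) ∧
      rightArc (torusBraid n) b j = componentOf (torusBraid n) b q) ∨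
      (leftArc (torusBraid n) b j = componentOf (torusBraid n) b q ∧
      rightArc (torusBraid n) b j = componentOf (torusBraid n) b (capPoint n k hk)) := by
    rcases hst with ⟨rfl, rfl⟩ | ⟨rfl, rfl⟩
    · exact .inl ⟨hs_eq _ (coords_lowerPoint j), ht_eq _ (coords_lowerPoint' j)⟩
    · exact .inr ⟨ht_eq _ (coords_lowerPoint j), hs_eq _ (coords_lowerPoint' j)⟩
  refine ⟨ha, hb, hch, habs.isCobIso_split hblue (by rcases arcs with h | h <;> simp [h.1]),
    .inr ⟨_, ⟨hl.1, hblue, ?_, ?_⟩, hl.2⟩, ?_⟩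
  · rcases arcs with h | h
    · rw [h.1, h.2]; exact hne
    · rw [h.1, h.2]; exact hne.symm
  · rcases arcs with h | h
    · exact .inl h.1.symm
    · exact .inr h.2.symm
  · rintro l (⟨c, hc, rfl⟩ | ⟨c, hc, rfl⟩)
    · refine absurd ?_ hc.2.2.1
      rw [lowerArc, upperArc, componentOf_eq_iff, coords_lowerPoint, coords_upperPoint]
      exact hvert
    · have : c = componentOf (torusBraid n) b (capPoint n k hk) ∨
          c = componentOf (torusBraid n) b q := by
        rcases arcs with h | h <;> rcases hc.2.2.2 with h' | h' <;> simp [h', h.1, h.2]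
      rcases this with rfl | rfl
      · rw [hl.2]
      · exact (hq hc.1).le

end Torus

/-! ## The automaton that accepts the unmatched words -/

/-- The transitions of the automaton on the letters `0`, `1` and blue `0`; its states are the
numbers below `73`, and `99` stands for rejection. -/
def transitionTable : List (ℕ × ℕ × ℕ) := [
  (1, 2, 99), (3, 4, 99), (5, 6, 99), (7, 8, 99), (9, 10, 99), (11, 12, 99), (13, 0, 99),
  (99, 14, 99), (99, 15, 99), (99, 99, 99), (99, 99, 99), (16, 17, 99), (18, 19, 99),
  (20, 21, 99), (99, 22, 99), (99, 99, 99), (23, 24, 99), (25, 26, 99), (99, 27, 99),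
  (99, 99, 99), (28, 29, 99), (30, 31, 99), (99, 99, 32), (99, 33, 99), (99, 99, 99),
  (99, 12, 99), (99, 99, 99), (34, 35, 99), (99, 36, 99), (99, 99, 99), (99, 37, 99),
  (99, 99, 99), (20, 38, 99), (39, 40, 99), (99, 99, 16), (99, 99, 41), (42, 43, 99),
  (44, 45, 99), (46, 47, 99), (99, 48, 99), (99, 99, 99), (49, 50, 99), (99, 51, 99),
  (99, 99, 99), (99, 52, 99), (99, 99, 99), (99, 53, 99), (99, 99, 99), (99, 99, 34),
  (54, 55, 99), (56, 57, 99), (99, 99, 58), (58, 59, 99), (60, 15, 99), (99, 61, 99),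
  (99, 19, 99), (99, 99, 99), (99, 99, 99), (99, 99, 20), (99, 99, 62), (99, 63, 99),
  (99, 64, 99), (65, 66, 99), (58, 67, 99), (99, 99, 11), (68, 69, 99), (9, 70, 99), (99, 99, 1),
  (99, 71, 99), (99, 45, 99), (99, 99, 99), (99, 72, 99), (99, 99, 13)]

/-- The matchings of the endpoints that belong to the states. -/
def matchingTable : List (List ℕ) := [
  [4, 5, 6, 7, 0, 1, 2, 3], [1, 0, 6, 7, 5, 4, 2, 3], [4, 5, 6, 7, 0, 1, 2, 3],
  [1, 0, 4, 7, 2, 6, 5, 3], [1, 0, 6, 7, 5, 4, 2, 3], [4, 2, 1, 7, 0, 6, 5, 3],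
  [4, 5, 6, 7, 0, 1, 2, 3], [1, 0, 4, 5, 2, 3, 7, 6], [1, 0, 4, 7, 2, 6, 5, 3],
  [1, 0, 3, 2, 5, 4, 7, 6], [1, 0, 6, 7, 5, 4, 2, 3], [4, 2, 1, 5, 0, 3, 7, 6],
  [4, 2, 1, 7, 0, 6, 5, 3], [4, 5, 3, 2, 0, 1, 7, 6], [1, 0, 4, 5, 2, 3, 7, 6],
  [1, 0, 4, 7, 2, 6, 5, 3], [3, 2, 1, 0, 5, 4, 7, 6], [4, 2, 1, 5, 0, 3, 7, 6],
  [6, 2, 1, 7, 5, 4, 0, 3], [4, 2, 1, 7, 0, 6, 5, 3], [1, 0, 3, 2, 5, 4, 7, 6],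
  [4, 5, 3, 2, 0, 1, 7, 6], [1, 0, 4, 5, 2, 3, 7, 6], [3, 2, 1, 0, 7, 6, 5, 4],
  [3, 2, 1, 0, 5, 4, 7, 6], [4, 2, 1, 7, 0, 6, 5, 3], [4, 2, 1, 5, 0, 3, 7, 6],
  [6, 2, 1, 7, 5, 4, 0, 3], [1, 0, 3, 2, 7, 6, 5, 4], [1, 0, 3, 2, 5, 4, 7, 6],
  [4, 7, 3, 2, 0, 6, 5, 1], [4, 5, 3, 2, 0, 1, 7, 6], [1, 0, 4, 5, 2, 3, 7, 6],
  [3, 2, 1, 0, 7, 6, 5, 4], [3, 2, 1, 0, 5, 4, 7, 6], [6, 2, 1, 7, 5, 4, 0, 3],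
  [1, 0, 3, 2, 7, 6, 5, 4], [4, 7, 3, 2, 0, 6, 5, 1], [1, 0, 4, 5, 2, 3, 7, 6],
  [3, 2, 1, 0, 5, 4, 7, 6], [3, 2, 1, 0, 7, 6, 5, 4], [6, 2, 1, 7, 5, 4, 0, 3],
  [1, 0, 3, 2, 5, 4, 7, 6], [1, 0, 3, 2, 7, 6, 5, 4], [6, 7, 3, 2, 5, 4, 0, 1],
  [4, 7, 3, 2, 0, 6, 5, 1], [1, 0, 4, 7, 2, 6, 5, 3], [1, 0, 4, 5, 2, 3, 7, 6],
  [3, 2, 1, 0, 5, 4, 7, 6], [4, 2, 1, 7, 0, 6, 5, 3], [6, 2, 1, 7, 5, 4, 0, 3],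
  [1, 0, 3, 2, 5, 4, 7, 6], [6, 7, 3, 2, 5, 4, 0, 1], [1, 0, 4, 7, 2, 6, 5, 3],
  [4, 2, 1, 5, 0, 3, 7, 6], [4, 2, 1, 7, 0, 6, 5, 3], [3, 2, 1, 0, 5, 4, 7, 6],
  [6, 2, 1, 7, 5, 4, 0, 3], [1, 0, 3, 2, 5, 4, 7, 6], [6, 7, 3, 2, 5, 4, 0, 1],
  [1, 0, 6, 7, 5, 4, 2, 3], [4, 2, 1, 5, 0, 3, 7, 6], [6, 7, 3, 2, 5, 4, 0, 1],
  [1, 0, 6, 7, 5, 4, 2, 3], [4, 2, 1, 5, 0, 3, 7, 6], [4, 7, 3, 2, 0, 6, 5, 1],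
  [6, 7, 3, 2, 5, 4, 0, 1], [1, 0, 6, 7, 5, 4, 2, 3], [4, 5, 3, 2, 0, 1, 7, 6],
  [4, 7, 3, 2, 0, 6, 5, 1], [6, 7, 3, 2, 5, 4, 0, 1], [4, 5, 3, 2, 0, 1, 7, 6],
  [4, 5, 3, 2, 0, 1, 7, 6]]

/-- The lengths modulo three of the words that lead to the states. -/
def phaseTable : List ℕ := [
  0, 1, 1, 2, 2, 2, 2, 0, 0, 0, 0, 0, 0, 0, 1, 1, 1, 1, 1, 1, 1, 1, 2, 2, 2, 2, 2, 2, 2, 2, 2, 2,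
  0, 0, 0, 0, 0, 0, 1, 1, 1, 1, 1, 1, 1, 1, 2, 2, 2, 2, 2, 2, 2, 0, 0, 0, 0, 0, 0, 0, 1, 1, 1, 2,
  2, 2, 2, 0, 0, 0, 0, 1, 2]

/-- The pairs `100 * p + q` of states that can be reached by two words whose smoothings differ in
exactly one layer, the first word having the `1`-smoothing there. -/
def pairTable : List ℕ := [
  10, 12, 13, 118, 120, 201, 219, 221, 328, 403, 427, 429, 503, 530, 604, 605, 631, 807, 836,
  907, 934, 956, 968, 1008, 1009, 1035, 1107, 1113, 1208, 1211, 1233, 1237, 1309, 1311, 1514,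
  1543, 1560, 1616, 1620, 1714, 1716, 1721, 1816, 1839, 1844, 1915, 1917, 1918, 1940, 1945, 1961,
  2016, 2020, 2117, 2120, 2323, 2328, 2423, 2424, 2429, 2523, 2530, 2622, 2624, 2625, 2631, 2724,
  2748, 2752, 2823, 2828, 2924, 2928, 2929, 3025, 3028, 3126, 3129, 3130, 3333, 3336, 3434, 3458,
  3534, 3559, 3633, 3636, 3712, 3736, 3820, 3939, 3942, 4039, 4040, 4043, 4116, 4162, 4239, 4242,
  4340, 4342, 4343, 4418, 4442, 4519, 4543, 4544, 4571, 4628, 4729, 4746, 4848, 4851, 4923, 4965,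
  5024, 5049, 5066, 5148, 5151, 5227, 5251, 5336, 5468, 5533, 5554, 5569, 5609, 5654, 5755, 5756,
  5770, 5834, 5858, 5935, 5958, 6042, 6171, 6220, 6241, 6351, 6472, 6528, 6549, 6629, 6650, 6665,
  6758, 6854, 6936, 6955, 6968, 7009, 7057, 7069, 7161, 7264]

/-- Red loops are matched at the stage of their highest layer, and a `1`-smoothing closes off no
loop, so the remaining letters are rejected. The default `99` makes rejection permanent. -/
def next (s : ℕ) : Letter → ℕ
  | .zero => (transitionTable.getD s (99, 99, 99)).1
  | .one => (transitionTable.getD s (99, 99, 99)).2.1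
  | .blueZero => (transitionTable.getD s (99, 99, 99)).2.2
  | _ => 99

def stateMatching (s e : ℕ) : ℕ := (matchingTable.getD s []).getD e 0

def phase (s : ℕ) : ℕ := phaseTable.getD s 0

/-- The letters that occur in accepted words. -/
def plainLetters : List Letter := [.zero, .one, .blueZero]

/-- In state `s` the next cap closes off a loop. -/
def Closes (s : ℕ) : Prop := stateMatching s (4 + phase s) = 5 + phase s

instance (s : ℕ) : Decidable (Closes s) := inferInstanceAs (Decidable (_ = _))

/-- After `v`, the words `00` and `1` followed by a blue `0` are matched. -/
def Partner₁ (v : ℕ) : Prop :=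
  next v .zero < 73 ∧ next v .one < 73 ∧ Closes (next v .one) ∧ ¬ Closes (next v .zero)

instance (v : ℕ) : Decidable (Partner₁ v) :=
  inferInstanceAs (Decidable (_ ∧ _ ∧ _ ∧ ¬ _))

/-- After `v`, the words `0x0` and `1x` followed by a blue `0` are matched. -/
def Partner₂ (v : ℕ) (x : Letter) : Prop :=
  next (next v .zero) x < 73 ∧ next (next v .one) x < 73 ∧ Closes (next (next v .one) x) ∧
    ¬ Closes (next (next v .zero) x) ∧ ¬ (x = .one ∧ Partner₁ (next v .one)) ∧
    ¬ (x = .zero ∧ Partner₁ (next v .zero))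

instance (v : ℕ) (x : Letter) : Decidable (Partner₂ v x) :=
  inferInstanceAs (Decidable (_ ∧ _ ∧ _ ∧ ¬ _ ∧ ¬ (_ ∧ _) ∧ ¬ (_ ∧ _)))

/-! ### Finite checks on the automaton. -/

theorem next_of_le {s : ℕ} (h : 73 ≤ s) (c : Letter) : next s c = 99 := by
  have : transitionTable.getD s (99, 99, 99) = (99, 99, 99) := by
    rw [List.getD_eq_getElem?_getD, List.getElem?_eq_none h]; rfl
  cases c <;> simp only [next, this]

theorem next_alive {s : ℕ} {c : Letter} (h : next s c < 73) : s < 73 ∧ c ∈ plainLetters := by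
  constructor
  · by_contra hs
    rw [next_of_le (not_lt.1 hs)] at h
    omega
  · cases c <;> simp_all [next, plainLetters]

/-- The tables simulate the topology: states carry the correct position and matching, and accepted
letters are coloured exactly where a loop is closed off. -/
theorem next_spec : ∀ s < 73, ∀ c ∈ plainLetters, next s c < 73 →
    phase (next s c) = (phase s + 1) % 3 ∧
    (c.color ≠ none ↔ c.smoothing = .zero ∧ Closes s) ∧
    ∀ e < 8, stateMatching (next s c) e =
      if c.smoothing = .one then stateMatching s e else capCup (phase s) (stateMatching s) e := by
  decide +kernel

/-- Where a cap would close off a loop, the letter `1` is paired with red `0`; this is the only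
reason to reject a `1`. -/
theorem next_one_alive : ∀ s < 73, next s .one < 73 ↔ ¬ Closes s := by decide +kernel

theorem initial_spec : phase 0 = 0 ∧ ∀ e < 8, stateMatching 0 e = initialMatching e := by
  decide +kernel

theorem partner₁_spec : ∀ v < 73, Partner₁ v → phase v ≠ 2 ∧
    ¬ next (next v .one) .blueZero < 73 ∧ ¬ next (next v .zero) .zero < 73 ∧
    ∀ e < 8, capCup ((phase v + 1) % 3) (stateMatching (next v .one)) e =
      capCup ((phase v + 1) % 3) (stateMatching (next v .zero)) e := by
  decide +kernel

theorem partner₂_spec : ∀ v < 73, ∀ x ∈ plainLetters, Partner₂ v x → phase v ≠ 0 ∧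
    x ≠ .blueZero ∧ ¬ next (next (next v .one) x) .blueZero < 73 ∧
    ¬ next (next (next v .zero) x) .zero < 73 ∧
    ∀ e < 8, capCup ((phase v + 2) % 3) (stateMatching (next (next v .one) x)) e =
      capCup ((phase v + 2) % 3) (stateMatching (next (next v .zero) x)) e := by
  decide +kernel

/-- Completeness of the two patterns: a rejected blue `0` is always explained by a partner that
changes one of the two preceding layers. -/
theorem exists_partner_blueZero : ∀ u < 73, ∀ y ∈ plainLetters, next u y < 73 →
    ∀ x ∈ plainLetters, next (next u y) x < 73 → Closes (next (next u y) x) →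
    ¬ next (next (next u y) x) .blueZero < 73 →
    (x = .one ∧ Partner₁ (next u y)) ∨ (y = .one ∧ Partner₂ u x) := by
  decide +kernel

theorem exists_partner_zero : ∀ u < 73, ∀ y ∈ plainLetters, next u y < 73 →
    ∀ x ∈ plainLetters, next (next u y) x < 73 → ¬ Closes (next (next u y) x) →
    ¬ next (next (next u y) x) .zero < 73 →
    (x = .zero ∧ Partner₁ (next u y)) ∨ (y = .zero ∧ Partner₂ u x) := by
  decide +kernel

theorem early_states : ∀ s ∈ [0, 1, 2, 3, 4, 5, 6], next s .zero < 73 ∧ ¬ Closes s := by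
  decide +kernel

theorem next_early : ∀ x ∈ plainLetters, next 0 x < 73 → next 0 x ∈ [1, 2] := by decide +kernel

theorem next_early' : ∀ s ∈ [1, 2], ∀ x ∈ plainLetters, next s x < 73 →
    next s x ∈ [3, 4, 5, 6] := by decide +kernel

set_option synthInstance.maxHeartbeats 400000 in
set_option synthInstance.maxSize 2000 in
/-- Apart from two states, the loops that can be closed off have height two. -/
theorem closes_spec : ∀ u < 73, ∀ x ∈ plainLetters, next u x < 73 → ∀ y ∈ plainLetters,
    next (next u x) y < 73 → ∀ z ∈ plainLetters, next (next (next u x) y) z < 73 →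
    Closes (next (next (next u x) y) z) → next (next (next u x) y) z ∉ [48, 51] →
    x.smoothing = .zero ∧ (phase u ≠ 0 → z.smoothing = .one) ∧
      (phase u ≠ 2 → y.smoothing = .one) := by
  decide +kernel

-- The step at which two words diverge. The clauses about closing loops settle the edges whose
-- changed layer is directly below the closing cap.
set_option synthInstance.maxHeartbeats 400000 in
set_option synthInstance.maxSize 2000 in
theorem pairTable_start : ∀ v < 73, ∀ c ∈ [Letter.zero, .blueZero], next v .one < 73 →
    next v c < 73 → 100 * next v .one + next v c ∈ pairTable ∧
    (Closes (next v .one) → Closes (next v c) → phase v = 2) ∧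
    (Closes (next v .one) → ¬ Closes (next v c) → c = .zero) := by
  decide +kernel

/-- The table is closed under equal smoothings. If the next cap closes off a loop only in the first
word, then both continuations are rejected, unless an edge at the layer just below has priority. -/
theorem pairTable_step : ∀ r ∈ pairTable, ∀ x ∈ plainLetters, ∀ y ∈ plainLetters,
    x.smoothing = y.smoothing → next (r / 100) x < 73 → next (r % 100) y < 73 →
    100 * next (r / 100) x + next (r % 100) y ∈ pairTable ∧
    (Closes (next (r / 100) x) → ¬ Closes (next (r % 100) y) →
      (¬ next (next (r / 100) x) .blueZero < 73 ∧ ¬ next (next (r % 100) y) .zero < 73) ∨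
      (x = .one ∧ Partner₁ (r / 100))) := by
  decide +kernel

-- The case of one letter after the divergence. If both words close off a loop, phase `0` puts the
-- changed crossing on other strands than a loop of height two.
set_option synthInstance.maxHeartbeats 400000 in
set_option synthInstance.maxSize 2000 in
theorem pair_gap_two : ∀ v < 73, ∀ c ∈ [Letter.zero, .blueZero], next v .one < 73 →
    next v c < 73 → ∀ x ∈ plainLetters, ∀ y ∈ plainLetters, x.smoothing = y.smoothing →
    next (next v .one) x < 73 → next (next v c) y < 73 →
    Closes (next (next v .one) x) → Closes (next (next v c) y) → phase v = 0 := by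
  decide +kernel

-- Traces the paths into the states 48 and 51 backwards; these are the only states with loops that
-- need not have height two.
set_option synthInstance.maxHeartbeats 400000 in
set_option synthInstance.maxSize 2000 in
theorem tall_loop_back : ∀ s < 73, ∀ c ∈ plainLetters,
    (next s c ∈ [48, 51] → s ∈ [39, 42] ∧ c = .one) ∧
    (next s c ∈ [39, 42] → s ∈ [33, 36] ∧ c.smoothing = .zero) ∧
    (next s c ∈ [33, 36] → s ∈ [23, 28] ∧ c = .one) ∧
    (next s c ∈ [23, 28] → s ∈ [16, 20] ∧ c.smoothing = .zero) ∧
    (next s c ∈ [16, 20] → s ∈ [11, 13, 32, 34, 58] ∧ c.smoothing = .zero) ∧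
    (next s c ∈ [11, 13, 32, 34, 58] → c.smoothing = .zero) := by
  decide +kernel

/-- The `1`-smoothings which these paths force next to a tall loop cannot be changed to `0` within
an accepted word. -/
theorem tall_loop_rigid : ∀ s ∈ [39, 42, 23, 28], ∀ c ∈ [Letter.zero, .blueZero],
    ¬ next s c < 73 := by
  decide +kernel

theorem tall_loop_phase : ∀ s ∈ [48, 51], phase s = 2 := by decide +kernel

/-! ## Accepted words -/

/-- The state which the automaton reaches on a word. -/
def run (w : Word) : ℕ := w.foldl next 0

section Run

variable {w a b : Word} {k l : ℕ} {x : Letter}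

theorem run_append (u v : Word) : run (u ++ v) = v.foldl next (run u) := List.foldl_append ..

theorem run_take_succ (h : w[k]? = some x) : run (w.take (k + 1)) = next (run (w.take k)) x := by
  rw [List.take_add_one, h, run_append]
  rfl

theorem take_congr (h : ∀ l < k, a[l]? = b[l]?) : a.take k = b.take k := by
  refine List.ext_getElem? fun l => ?_
  by_cases hl : l < k
  · rw [List.getElem?_take_of_lt hl, List.getElem?_take_of_lt hl, h l hl]
  · rw [List.getElem?_take_eq_none (not_lt.1 hl), List.getElem?_take_eq_none (not_lt.1 hl)]

theorem run_alive_mono (hk : k ≤ w.length) (h : run (w.take k) < 73) (hl : l ≤ k) :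
    run (w.take l) < 73 := by
  induction k with
  | zero => obtain rfl : l = 0 := by omega
            exact h
  | succ k ih =>
    rcases Nat.lt_or_ge l (k + 1) with hl' | hl'
    · have hx : w[k]? = some w[k] := List.getElem?_eq_getElem (by omega)
      rw [run_take_succ hx] at h
      exact ih (by omega) (next_alive h).1 (by omega)
    · rwa [show l = k + 1 by omega]

theorem run_step (hk : k ≤ w.length) (h : run (w.take k) < 73) (hl : l < k) :
    ∃ x ∈ plainLetters, w[l]? = some x ∧ run (w.take (l + 1)) = next (run (w.take l)) x ∧
      run (w.take l) < 73 ∧ next (run (w.take l)) x < 73 := by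
  have hx : w[l]? = some w[l] := List.getElem?_eq_getElem (by omega)
  have h1 := run_alive_mono hk h (l := l + 1) hl
  rw [run_take_succ hx] at h1
  exact ⟨_, (next_alive h1).2, hx, run_take_succ hx, (next_alive h1).1, h1⟩

/-- The bridge between automaton and topology: the state knows the connectivity of the prefix. -/
theorem run_spec (hk : k ≤ w.length) (h : run (w.take k) < 73) :
    phase (run (w.take k)) = k % 3 ∧ IsMatching (sm w) k (stateMatching (run (w.take k))) := by
  induction k with
  | zero =>
    exact ⟨initial_spec.1, (isMatching_zero _).congr fun e he => (initial_spec.2 e he).symm⟩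
  | succ k ih =>
    obtain ⟨x, hx, hwx, hrun, h1, h2⟩ := run_step hk h (Nat.lt_succ_self k)
    obtain ⟨ih1, ih2⟩ := ih (by omega) h1
    obtain ⟨s1, -, s2⟩ := next_spec _ h1 x hx h2
    rw [hrun]
    refine ⟨by rw [s1, ih1]; omega, ?_⟩
    have hsm := sm_of_getElem? hwx
    match hs : x.smoothing with
    | .one =>
      rw [hs] at hsm
      exact (ih2.one hsm).congr fun e he => by rw [s2 e he, if_pos hs]
    | .zero =>
      rw [hs] at hsm
      exact (ih2.zero hsm).congr fun e he => by rw [s2 e he, if_neg (by simp [hs]), ih1]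

theorem conn_iff_closes (hk : k ≤ w.length) (h : run (w.take k) < 73) :
    Conn (sm w) k (k, k % 3) (k, k % 3 + 1) ↔ Closes (run (w.take k)) := by
  obtain ⟨h1, h2⟩ := run_spec hk h
  rw [h2.conn_top, Closes, h1]

theorem closing_iff_closes (hk : k < w.length) (h : run (w.take k) < 73) (hx : w[k]? = some x) :
    Closing (sm w) k ↔ x.smoothing = .zero ∧ Closes (run (w.take k)) := by
  rw [Closing, conn_iff_closes hk.le h, sm_of_getElem? hx, Option.some.injEq]

theorem color_iff_of_alive (hk : k ≤ w.length) (h : run (w.take k) < 73) (hl : l < k)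
    (hx : w[l]? = some x) : x ∈ plainLetters ∧ (x.color ≠ none ↔ Closing (sm w) l) := by
  obtain ⟨y, hy, hwy, -, h1, h2⟩ := run_step hk h hl
  obtain rfl : x = y := by rw [hx] at hwy; exact Option.some_injective _ hwy
  exact ⟨hy, by rw [closing_iff_closes (by omega) h1 hx]; exact (next_spec _ h1 x hy h2).2.1⟩

theorem eq_of_smoothing_of_color : ∀ x ∈ plainLetters, ∀ y ∈ plainLetters,
    x.smoothing = y.smoothing → (x.color ≠ none ↔ y.color ≠ none) → x = y := by
  decide

/-- Accepted words are determined by their smoothings. -/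
theorem getElem?_eq_of_alive (hka : k ≤ a.length) (hkb : k ≤ b.length)
    (ha : run (a.take k) < 73) (hb : run (b.take k) < 73) (hl : l < k)
    (hsm : ∀ i ≤ l, sm a i = sm b i) : a[l]? = b[l]? := by
  have hx : a[l]? = some a[l] := List.getElem?_eq_getElem (by omega)
  have hy : b[l]? = some b[l] := List.getElem?_eq_getElem (by omega)
  obtain ⟨hx1, hx2⟩ := color_iff_of_alive hka ha hl hx
  obtain ⟨hy1, hy2⟩ := color_iff_of_alive hkb hb hl hy
  have hs := hsm l le_rfl
  rw [sm_of_getElem? hx, sm_of_getElem? hy, Option.some.injEq] at hs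
  rw [hx, hy, eq_of_smoothing_of_color _ hx1 _ hy1 hs]
  rw [hx2, hy2]
  exact ⟨fun h => h.congr hsm, fun h => h.congr fun i hi => (hsm i hi).symm⟩

theorem IsCell.of_alive {n : ℕ} (hw : w.length = 3 * n) (h : run w < 73) :
    IsCell (torusBraid n) w := by
  rw [isCell_iff]
  refine ⟨hw, fun j x hx => ?_⟩
  have hj := (List.getElem?_eq_some_iff.1 hx).1
  rw [← List.take_length (l := w)] at h
  exact (color_iff_of_alive le_rfl h hj hx).2

/-- Equal matchings at level `k` and equal layers above produce equal matchings at all later levels.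
-/
theorem closing_congr_of_matching {σ τ : ℕ → Option Smoothing} {N : ℕ} {f : ℕ → ℕ}
    (hσ : IsMatching σ k f) (hτ : IsMatching τ k f) (h : ∀ l, k ≤ l → σ l = τ l)
    (hne : ∀ l < N, σ l ≠ none) (hkl : k ≤ l) (hlN : l ≤ N) :
    Closing σ l ↔ Closing τ l := by
  have : ∃ f, IsMatching σ l f ∧ IsMatching τ l f := by
    induction l, hkl using Nat.le_induction with
    | base => exact ⟨f, hσ, hτ⟩
    | succ l hkl ih =>
      obtain ⟨f, h1, h2⟩ := ih (by omega)
      match hs : σ l with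
      | none => exact absurd hs (hne l (by omega))
      | some .one => exact ⟨f, h1.one hs, h2.one (h l hkl ▸ hs)⟩
      | some .zero => exact ⟨_, h1.zero hs, h2.zero (h l hkl ▸ hs)⟩
  obtain ⟨g, h1, h2⟩ := this
  rw [Closing, Closing, h1.conn_top, h2.conn_top, h l hkl]

/-- A cell remains a cell when an accepted prefix is replaced by another one with the same
matching. -/
theorem IsCell.of_replace {n : ℕ} (ha : IsCell (torusBraid n) a) (hb : b.length = 3 * n)
    (hk : k < 3 * n) (hbk : run (b.take k) < 73) (hx : b[k]? = some x)
    (hxc : x.color ≠ none ↔ x.smoothing = .zero ∧ Closes (run (b.take k)))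
    (htail : ∀ l, k < l → a[l]? = b[l]?) {f : ℕ → ℕ} (hfa : IsMatching (sm a) (k + 1) f)
    (hfb : IsMatching (sm b) (k + 1) f) : IsCell (torusBraid n) b := by
  rw [isCell_iff]
  refine ⟨hb, fun j y hy => ?_⟩
  rcases lt_trichotomy j k with hj | rfl | hj
  · exact (color_iff_of_alive (by omega) hbk hj hy).2
  · obtain rfl : x = y := by rw [hx] at hy; exact Option.some_injective _ hy
    rw [closing_iff_closes (by omega) hbk hx, hxc]
  · have hjn : j < 3 * n := hb ▸ (List.getElem?_eq_some_iff.1 hy).1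
    rw [← closing_congr_of_matching hfa hfb (fun l hl => by simp only [sm, htail l hl])
      (sm_ne_none ha.length_eq) hj hjn.le]
    exact ha.color_iff (by rw [htail j hj, hy])

/-- An accepted prefix that closes off a loop closes off a loop of height two, or it ends in one of
two states. -/
theorem simpleLoop_of_closes (hk : k ≤ w.length) (h : run (w.take k) < 73)
    (hc : Closes (run (w.take k))) (hs : run (w.take k) ∉ [48, 51]) : SimpleLoop (sm w) k := by
  -- At most two letters lead to the states 0 to 6, and in these no loop can be closed off.
  have h3 : 3 ≤ k := by
    by_contra hlt
    have hmem : run (w.take k) ∈ [0, 1, 2, 3, 4, 5, 6] := by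
      have h0 : run (w.take 0) = 0 := rfl
      rcases (by omega : k = 0 ∨ k = 1 ∨ k = 2) with rfl | rfl | rfl
      · rw [h0]
        decide
      · obtain ⟨x, hx, -, hr, -, h2⟩ := run_step hk h (l := 0) (by omega)
        rw [h0] at hr h2
        have := next_early x hx h2
        rw [show run (w.take 1) = next 0 x from hr]
        grind
      · obtain ⟨x, hx, -, hr, -, h2⟩ := run_step hk h (l := 0) (by omega)
        obtain ⟨y, hy, -, hr', -, h2'⟩ := run_step hk h (l := 1) (by omega)
        rw [h0] at hr h2
        rw [show run (w.take 1) = next 0 x from hr] at hr' h2'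
        have := next_early' _ (next_early x hx h2) y hy h2'
        rw [show run (w.take 2) = next (next 0 x) y from hr']
        grind
    exact (early_states _ hmem).2 hc
  obtain ⟨k, rfl⟩ : ∃ k', k = k' + 3 := ⟨k - 3, by omega⟩
  obtain ⟨x, hx, hwx, hrx, hu, hx'⟩ := run_step hk h (l := k) (by omega)
  obtain ⟨y, hy, hwy, hry, -, hy'⟩ := run_step hk h (l := k + 1) (by omega)
  obtain ⟨z, hz, hwz, hrz, -, hz'⟩ := run_step hk h (l := k + 2) (by omega)
  have hph := (run_spec (w := w) (k := k) (by omega) hu).1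
  rw [hrz, hry, hrx] at hc hs
  rw [hry, hrx] at hz'
  rw [hrx] at hy'
  obtain ⟨c1, c2, c3⟩ := closes_spec _ hu x hx hx' y hy hy' z hz hz' hc hs
  rw [hph] at c2 c3
  refine ⟨by omega, ?_, fun h => ?_, fun h => ?_⟩
  · rw [show k + 3 - 3 = k from rfl, sm_of_getElem? hwx, c1]
  · rw [show k + 3 - 1 = k + 2 from rfl, sm_of_getElem? hwz, c2 (by omega)]
  · rw [show k + 3 - 2 = k + 1 from rfl, sm_of_getElem? hwy, c3 (by omega)]

end Run

/-- The points that can lie on a loop closed off in one of the two exceptional states. -/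
def tallLoopPoint (k : ℕ) (x : ℕ × ℕ) : Prop :=
  x.1 ≤ k ∧ k ≤ x.1 + 5 ∧ (k ≤ x.1 + 1 → 2 ≤ x.2) ∧ (k = x.1 + 5 → 2 ≤ x.2)

/-- The prescribed smoothings seal off the region: a cup below it on the right, and caps and cups
that keep the two left positions out near its bottom and top. Layer `k - 3` is arbitrary, as it lies
in the part of full width. -/
theorem tallLoopPoint_of_conn {σ : ℕ → Option Smoothing} {k : ℕ} (h6 : 6 ≤ k) (hk : k % 3 = 2)
    (s1 : σ (k - 1) = some .one) (s2 : σ (k - 2) = some .zero) (s4 : σ (k - 4) = some .zero)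
    (s5 : σ (k - 5) = some .zero) (s6 : σ (k - 6) = some .zero) {x : ℕ × ℕ}
    (hx : Conn σ k (k, k % 3) x) : tallLoopPoint k x := by
  have := hx.label (tallLoopPoint k) (by
    intro j hj x y hxy
    refine propext ?_
    rcases (by omega : j < k - 6 ∨ j = k - 6 ∨ j = k - 5 ∨ j = k - 4 ∨ j = k - 3 ∨ j = k - 2 ∨
      j = k - 1) with h | h | h | h | h | h | h
    · have := hxy.level
      unfold tallLoopPoint
      omega
    · rw [← h] at s6
      cases hxy <;> simp only [tallLoopPoint] <;>
        simp only [s6, reduceCtorEq, false_or, true_and, Option.some.injEq] at * <;> omega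
    · rw [← h] at s5
      cases hxy <;> simp only [tallLoopPoint] <;>
        simp only [s5, reduceCtorEq, false_or, true_and, Option.some.injEq] at * <;> omega
    · rw [← h] at s4
      cases hxy <;> simp only [tallLoopPoint] <;>
        simp only [s4, reduceCtorEq, false_or, true_and, Option.some.injEq] at * <;> omega
    · cases hxy <;> simp only [tallLoopPoint] <;> omega
    · rw [← h] at s2
      cases hxy <;> simp only [tallLoopPoint] <;>
        simp only [s2, reduceCtorEq, false_or, true_and, Option.some.injEq] at * <;> omega
    · rw [← h] at s1
      cases hxy <;> simp only [tallLoopPoint] <;>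
        simp only [s1, reduceCtorEq, Option.some.injEq] at * <;> omega)
  rw [← this]
  exact ⟨le_rfl, by simp, fun _ => by simp only; omega, fun h => by simp at h⟩

/-- The last letters of a word that leads to one of the two exceptional states. -/
theorem tall_loop_window {w : Word} {k : ℕ} (hk : k ≤ w.length) (h : run (w.take k) ∈ [48, 51]) :
    6 ≤ k ∧ k % 3 = 2 ∧ sm w (k - 1) = some .one ∧ sm w (k - 2) = some .zero ∧
      sm w (k - 4) = some .zero ∧ sm w (k - 5) = some .zero ∧ sm w (k - 6) = some .zero ∧
      run (w.take (k - 1)) ∈ [39, 42] ∧ run (w.take (k - 3)) ∈ [23, 28] := by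
  have alive : run (w.take k) < 73 := by
    simp only [List.mem_cons, List.not_mem_nil, or_false] at h
    omega
  have back : ∀ (l : ℕ) (S : List ℕ), l ≤ k → 0 ∉ S → run (w.take l) ∈ S →
      ∃ l' x, l = l' + 1 ∧ x ∈ plainLetters ∧ run (w.take l') < 73 ∧ w[l']? = some x ∧
        next (run (w.take l')) x ∈ S := by
    intro l S hl h0 hS
    cases l with
    | zero => exact absurd hS h0
    | succ l =>
      obtain ⟨x, hx, hwx, hr, h1, -⟩ := run_step hk alive (l := l) (by omega)
      exact ⟨l, x, rfl, hx, h1, hwx, hr ▸ hS⟩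
  have hph := (run_spec hk alive).1
  rw [tall_loop_phase _ h] at hph
  obtain ⟨k1, x1, rfl, hx1, a1, w1, n1⟩ := back k _ le_rfl (by decide) h
  obtain ⟨m1, rfl⟩ := (tall_loop_back _ a1 _ hx1).1 n1
  obtain ⟨k2, x2, rfl, hx2, a2, w2, n2⟩ := back k1 _ (by omega) (by decide) m1
  obtain ⟨m2, c2⟩ := (tall_loop_back _ a2 _ hx2).2.1 n2
  obtain ⟨k3, x3, rfl, hx3, a3, w3, n3⟩ := back k2 _ (by omega) (by decide) m2
  obtain ⟨m3, rfl⟩ := (tall_loop_back _ a3 _ hx3).2.2.1 n3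
  obtain ⟨k4, x4, rfl, hx4, a4, w4, n4⟩ := back k3 _ (by omega) (by decide) m3
  obtain ⟨m4, c4⟩ := (tall_loop_back _ a4 _ hx4).2.2.2.1 n4
  obtain ⟨k5, x5, rfl, hx5, a5, w5, n5⟩ := back k4 _ (by omega) (by decide) m4
  obtain ⟨m5, c5⟩ := (tall_loop_back _ a5 _ hx5).2.2.2.2.1 n5
  obtain ⟨k6, x6, rfl, hx6, a6, w6, n6⟩ := back k5 _ (by omega) (by decide) m5
  have c6 := (tall_loop_back _ a6 _ hx6).2.2.2.2.2 n6
  refine ⟨by omega, hph.symm, ?_, ?_, ?_, ?_, ?_, m1, m3⟩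
  · exact sm_of_getElem? w1
  · exact (sm_of_getElem? w2).trans (congrArg some c2)
  · exact (sm_of_getElem? w4).trans (congrArg some c4)
  · exact (sm_of_getElem? w5).trans (congrArg some c5)
  · exact (sm_of_getElem? w6).trans (congrArg some c6)

/-! ## The unmatched cells are the accepted words -/

section Greedy

variable {n k : ℕ} {a b w : Word} {x y : Letter} {e : Word × Word}

theorem mem_greedyPart {m : ℕ} {B : List (Fin m)} {j : Fin B.length} {e : Word × Word} :
    e ∈ greedyPart B j k ↔ e ∈ isoEdges B j k ∧
      ∀ (l : Fin B.length) (r : ℕ), (r < k ∨ r = k ∧ j < l) → ∀ e' ∈ greedyPart B l r,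
        e.1 ≠ e'.1 ∧ e.1 ≠ e'.2 ∧ e.2 ≠ e'.1 ∧ e.2 ≠ e'.2 := by
  rw [greedyPart]
  rfl

/-- The word `w` is an end of an edge in some `M_{j,k}`. -/
def Touched (n k : ℕ) (w : Word) : Prop :=
  ∃ j, ∃ e ∈ greedyPart (torusBraid n) j k, w = e.1 ∨ w = e.2

/-- The cells that are matched before stage `k` are those with a rejected prefix of length `k`. -/
def MatchedBelow (n k : ℕ) : Prop :=
  ∀ w, IsCell (torusBraid n) w → ((∃ r < k, Touched n r w) ↔ ¬ run (w.take k) < 73)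

/-- The layer with index `j`. -/
def layer (j : ℕ) (hj : j < 3 * n) : Fin (torusBraid n).length :=
  ⟨j, by rw [torusBraid_length]; exact hj⟩

theorem run_take_set (j : ℕ) (hk : k ≤ j) : run ((w.set j x).take k) = run (w.take k) := by
  rw [take_congr (a := w.set j x) (b := w)]
  intro l hl
  rw [List.getElem?_set_ne (by omega)]

theorem capCup_eq_self {i : ℕ} {f : ℕ → ℕ} (h : f (4 + i) = 5 + i) : capCup i f = f := by
  funext e
  rw [capCup, if_pos h]

/-- Closing off a loop leaves the endpoints as joined as before, so both smoothings of the layer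
give the same matching and may be exchanged. -/
theorem isMatching_succ_of_closes (hk : k < w.length) (h : run (w.take k) < 73)
    (hc : Closes (run (w.take k))) :
    IsMatching (sm w) (k + 1) (stateMatching (run (w.take k))) := by
  obtain ⟨h1, h2⟩ := run_spec hk.le h
  have hx : w[k]? = some w[k] := List.getElem?_eq_getElem hk
  have hs := sm_of_getElem? hx
  match hw : w[k].smoothing with
  | .one => exact h2.one (hs.trans (congrArg some hw))
  | .zero =>
    have := h2.zero (hs.trans (congrArg some hw))
    rwa [capCup_eq_self (by rw [Closes, h1] at hc; exact hc)] at this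

theorem IsCell.set_of_closes (hw : IsCell (torusBraid n) w) (hk : k < 3 * n)
    (h : run (w.take k) < 73) (hc : Closes (run (w.take k)))
    (hx : x.color ≠ none ↔ x.smoothing = .zero) : IsCell (torusBraid n) (w.set k x) := by
  have hl := hw.length_eq
  have hr : run ((w.set k x).take k) = run (w.take k) := run_take_set k le_rfl
  refine hw.of_replace (by simpa using hl) hk (hr ▸ h) (x := x) (List.getElem?_set_self (by omega))
    (by rw [hr, hx]; simp [hc]) (fun l hl => (List.getElem?_set_ne (by omega)).symm)
    (isMatching_succ_of_closes (by omega) h hc) ?_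
  have := isMatching_succ_of_closes (w := w.set k x) (k := k) (by simp; omega) (hr ▸ h) (hr ▸ hc)
  rwa [hr] at this

theorem not_alive_of_touched (ih : MatchedBelow n k) {r : ℕ} (hr : r < k)
    (hw : IsCell (torusBraid n) w) (h : Touched n r w) : ¬ run (w.take k) < 73 :=
  (ih w hw).1 ⟨r, hr, h⟩

theorem alive_of_mem_greedyPart (ih : MatchedBelow n k) {j : Fin (torusBraid n).length}
    (he : e ∈ greedyPart (torusBraid n) j k) :
    run (e.1.take k) < 73 ∧ run (e.2.take k) < 73 := by
  obtain ⟨h1, h2⟩ := mem_greedyPart.1 he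
  constructor <;> by_contra h
  · obtain ⟨r, hr, l, e', he', h | h⟩ := (ih e.1 h1.1).2 h
    · exact (h2 l r (.inl hr) e' he').1 h
    · exact (h2 l r (.inl hr) e' he').2.1 h
  · obtain ⟨r, hr, l, e', he', h | h⟩ := (ih e.2 h1.2.1).2 h
    · exact (h2 l r (.inl hr) e' he').2.2.1 h
    · exact (h2 l r (.inl hr) e' he').2.2.2 h

theorem le_of_mem_isoEdges {j : Fin (torusBraid n).length} (he : e ∈ isoEdges (torusBraid n) j k) :
    (j : ℕ) ≤ k := by
  by_contra h
  have := (isoEdges_of_ne he (by omega)).1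
  omega

/-- Earlier stages only touch cells with a rejected prefix, so competition can only come from edges
of the same stage at higher layers. -/
theorem mem_greedyPart_of_alive (ih : MatchedBelow n k) {j : Fin (torusBraid n).length}
    (he : e ∈ isoEdges (torusBraid n) j k) (h1 : run (e.1.take k) < 73)
    (h2 : run (e.2.take k) < 73)
    (h : ∀ l : Fin (torusBraid n).length, j < l → (l : ℕ) ≤ k →
      ∀ e' ∈ greedyPart (torusBraid n) l k, e.1 ≠ e'.1 ∧ e.1 ≠ e'.2 ∧ e.2 ≠ e'.1 ∧ e.2 ≠ e'.2) :
    e ∈ greedyPart (torusBraid n) j k := by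
  refine mem_greedyPart.2 ⟨he, ?_⟩
  rintro l r (hr | ⟨rfl, hl⟩) e' he'
  · have g1 := fun hh => not_alive_of_touched ih hr he.1 hh h1
    have g2 := fun hh => not_alive_of_touched ih hr he.2.1 hh h2
    exact ⟨fun hh => g1 ⟨l, e', he', .inl hh⟩, fun hh => g1 ⟨l, e', he', .inr hh⟩,
      fun hh => g2 ⟨l, e', he', .inl hh⟩, fun hh => g2 ⟨l, e', he', .inr hh⟩⟩
  · exact h l hl (le_of_mem_isoEdges (mem_greedyPart.1 he').1) e' he'

/-- Layer `k` is the highest layer that an edge of stage `k` can change, so these edges are served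
first. -/
theorem mem_greedyPart_self (ih : MatchedBelow n k) (hk : k < 3 * n)
    (ha : IsCell (torusBraid n) a) (hb : IsCell (torusBraid n) b) (hra : run (a.take k) < 73)
    (hak : a[k]? = some .redZero) (hbk : b[k]? = some .one)
    (hab : ∀ l : ℕ, l ≠ k → a[l]? = b[l]?) : (a, b) ∈ greedyPart (torusBraid n) (layer k hk) k := by
  refine mem_greedyPart_of_alive ih (mem_isoEdges_self ha hb (layer k hk) hak hbk hab) hra ?_ ?_
  · rwa [take_congr (a := b) (b := a) fun l hl => (hab l (by omega)).symm]
  · intro l hl hlk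
    exact absurd (show k < (l : ℕ) from hl) (by omega)

theorem exists_edge_of_redZero (ih : MatchedBelow n k) (hw : IsCell (torusBraid n) w)
    (h : run (w.take k) < 73) (hk : k < 3 * n) (hx : w[k]? = some .redZero) :
    ∃ b, (w, b) ∈ greedyPart (torusBraid n) (layer k hk) k := by
  have hl := hw.length_eq
  have hc : Closes (run (w.take k)) :=
    ((closing_iff_closes (by omega) h hx).1 ((hw.color_iff hx).1 (by simp [Letter.color]))).2
  have hb := hw.set_of_closes (x := .one) hk h hc (by simp [Letter.color, Letter.smoothing])
  exact ⟨_, mem_greedyPart_self ih hk hw hb h hx (List.getElem?_set_self (by omega))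
    fun l hl => (List.getElem?_set_ne (by omega)).symm⟩

theorem touched_of_one (ih : MatchedBelow n k) (hw : IsCell (torusBraid n) w)
    (h : run (w.take k) < 73) (hk : k < 3 * n) (hx : w[k]? = some .one)
    (hc : Closes (run (w.take k))) : Touched n k w := by
  have hl := hw.length_eq
  have ha := hw.set_of_closes (x := .redZero) hk h hc (by simp [Letter.color, Letter.smoothing])
  exact ⟨_, _, mem_greedyPart_self ih hk ha hw ((run_take_set k le_rfl).symm ▸ h)
    (List.getElem?_set_self (by omega)) hx
    fun l hl => List.getElem?_set_ne (by omega), .inr rfl⟩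

theorem ne_of_getElem? (ha : a[k]? = some x) (hb : b[k]? = some y) (hxy : x ≠ y) : a ≠ b := by
  rintro rfl
  exact hxy (Option.some_injective _ (ha.symm.trans hb))

/-- Two words that differ in a `0`-smoothing whose change splits off a loop of height two. -/
theorem isoEdges_of_partner (hla : a.length = 3 * n) (hlb : b.length = 3 * n) {j : ℕ}
    (hk : k < 3 * n) (hj : (k % 3 ≠ 0 ∧ j = k - 1) ∨ (k % 3 ≠ 2 ∧ j = k - 2)) (hjk : j < k)
    (haj : a[j]? = some .zero) (hbj : b[j]? = some .one) (hak : a[k]? = some .zero)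
    (hbk : b[k]? = some .blueZero) (hab : ∀ l, l ≠ j → l ≠ k → a[l]? = b[l]?)
    (hra : run (a.take k) < 73) (hrb : run (b.take k) < 73) (hca : ¬ Closes (run (a.take k)))
    (hcb : Closes (run (b.take k))) (hdb : ¬ next (run (b.take k)) .blueZero < 73)
    (hm : ∀ e < 8, capCup (k % 3) (stateMatching (run (b.take k))) e =
      capCup (k % 3) (stateMatching (run (a.take k))) e)
    (hcell : IsCell (torusBraid n) a ∨ IsCell (torusBraid n) b) :
    (a, b) ∈ isoEdges (torusBraid n) (layer j (hjk.trans hk)) k := by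
  have ma := (run_spec (w := a) (by omega) hra).2.zero (sm_of_getElem? hak)
  have mb := ((run_spec (w := b) (by omega) hrb).2.zero (sm_of_getElem? hbk)).congr hm
  -- The prefixes of length `k + 1` have the same matching, so either word is a cell once the other
  -- is.
  have hcells : IsCell (torusBraid n) a ∧ IsCell (torusBraid n) b := by
    rcases hcell with h | h
    · exact ⟨h, h.of_replace hlb hk hrb hbk (by simp [Letter.color, Letter.smoothing, hcb])
        (fun l hl => hab l (by omega) (by omega)) ma mb⟩
    · exact ⟨h.of_replace hla hk hra hak (by simp [Letter.color, hca])
        (fun l hl => (hab l (by omega) (by omega)).symm) mb ma, h⟩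
  refine mem_isoEdges_of_simpleLoop hcells.1 hcells.2 _ hak hbk ?_ ?_ hab hj
  · refine simpleLoop_of_closes (by omega) hrb hcb fun hs => hdb ?_
    revert hs
    generalize run (b.take k) = s
    revert s
    decide +kernel
  · refine ⟨by simp [layer, haj, Letter.smoothing], by simp [layer, hbj, Letter.smoothing], ?_⟩
    intro l hl
    by_cases hlk : l = k
    · subst hlk
      simp [hak, hbk, Letter.smoothing]
    · rw [hab l hl hlk]

/-- After a common prefix that leads to `v`, the words `a` and `b` go on with `00` and `1` and a
blue `0`, and agree from there on. -/
structure Pair₁ (n k : ℕ) (a b : Word) : Prop where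
  length_left : a.length = 3 * n
  length_right : b.length = 3 * n
  lt : k + 1 < 3 * n
  left₁ : a[k]? = some .zero
  right₁ : b[k]? = some .one
  left₂ : a[k + 1]? = some .zero
  right₂ : b[k + 1]? = some .blueZero
  eq : ∀ l, l ≠ k → l ≠ k + 1 → a[l]? = b[l]?
  alive : run (a.take k) < 73
  partner : Partner₁ (run (a.take k))

/-- The only earlier edges of the stage change layer `k + 1` itself; their ends carry red `0` and
`1` there, unlike `a` and `b`. -/
theorem Pair₁.mem_part (h : Pair₁ n k a b) (ih : MatchedBelow n (k + 1))
    (hcell : IsCell (torusBraid n) a ∨ IsCell (torusBraid n) b) :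
    (a, b) ∈ greedyPart (torusBraid n) (layer k (by have := h.lt; omega)) (k + 1) := by
  obtain ⟨hla, hlb, hk, ha1, hb1, ha2, hb2, hab, hv, hp⟩ := h
  obtain ⟨s1, s2, s3, s4⟩ := partner₁_spec _ hv hp
  obtain ⟨p1, p2, p3, p4⟩ := hp
  have ra := run_take_succ ha1
  have rb := run_take_succ hb1
  rw [take_congr (a := b) (b := a) (k := k) fun l hl => (hab l (by omega) (by omega)).symm] at rb
  have hph := (run_spec (w := a) (k := k) (by omega) hv).1
  rw [← ra] at p1 p4 s4
  rw [← rb] at p2 p3 s2 s4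
  rw [hph, show (k % 3 + 1) % 3 = (k + 1) % 3 by omega] at s4
  refine mem_greedyPart_of_alive ih (isoEdges_of_partner hla hlb hk (by omega) (by omega) ha1 hb1
    ha2 hb2 hab p1 p2 p4 p3 s2 s4 hcell) p1 p2 ?_
  intro l hl hlk e' he'
  have hl' : k < (l : ℕ) := hl
  have hl'' : (l : ℕ) = k + 1 := by omega
  have := isoEdges_self (j := l) (e := e') (hl'' ▸ (mem_greedyPart.1 he').1)
  rw [hl''] at this
  obtain ⟨t1, t2, -⟩ := this
  exact ⟨ne_of_getElem? ha2 t1 (by decide), ne_of_getElem? ha2 t2 (by decide),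
    ne_of_getElem? hb2 t1 (by decide), ne_of_getElem? hb2 t2 (by decide)⟩

theorem mem_zero_of_smoothing : ∀ x ∈ plainLetters, x.smoothing = .zero →
    x ∈ [Letter.zero, .blueZero] := by decide

theorem eq_one_of_smoothing : ∀ x ∈ plainLetters, x.smoothing = .one → x = .one := by decide

/-- The smoothings of `a` and `b` differ only in layer `j`, and their prefixes of length `k` are
accepted. -/
structure Diverge (n k j : ℕ) (a b : Word) : Prop where
  length_left : a.length = 3 * n
  length_right : b.length = 3 * n
  lt_length : k < 3 * n
  lt : j < k
  alive_left : run (a.take k) < 73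
  alive_right : run (b.take k) < 73
  zero_left : sm a j = some .zero
  one_right : sm b j = some .one
  smoothing_eq : ∀ l, l ≠ j → sm a l = sm b l

namespace Diverge

variable {j : ℕ}

theorem getElem?_eq (h : Diverge n k j a b) {l : ℕ} (hl : l < j) : a[l]? = b[l]? := by
  have := h.length_left
  have := h.length_right
  have := h.lt_length
  have := h.lt
  exact getElem?_eq_of_alive (by omega) (by omega) h.alive_left h.alive_right (by omega)
    fun i hi => h.smoothing_eq i (by omega)

theorem first (h : Diverge n k j a b) : ∃ c ∈ [Letter.zero, .blueZero], a[j]? = some c ∧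
    b[j]? = some .one ∧ run (a.take j) < 73 ∧ phase (run (a.take j)) = j % 3 ∧
    run (b.take j) = run (a.take j) ∧
    run (a.take (j + 1)) = next (run (a.take j)) c ∧ next (run (a.take j)) c < 73 ∧
    run (b.take (j + 1)) = next (run (a.take j)) .one ∧ next (run (a.take j)) .one < 73 := by
  have hla := h.length_left
  have hlb := h.length_right
  have hk := h.lt_length
  have hj := h.lt
  obtain ⟨x, hx, ax, rx, vx, dx⟩ := run_step (by omega) h.alive_left h.lt
  obtain ⟨y, hy, ay, ry, vy, dy⟩ := run_step (by omega) h.alive_right h.lt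
  have sx := h.zero_left
  have sy := h.one_right
  rw [sm_of_getElem? ax, Option.some.injEq] at sx
  rw [sm_of_getElem? ay, Option.some.injEq] at sy
  obtain rfl := eq_one_of_smoothing y hy sy
  have hv : b.take j = a.take j := take_congr fun l hl => (h.getElem?_eq hl).symm
  rw [hv] at ry dy
  exact ⟨x, mem_zero_of_smoothing x hx sx, ax, ay, vx, (run_spec (by omega) vx).1, by rw [hv],
    rx, dx, ry, dy⟩

theorem step (h : Diverge n k j a b) {l : ℕ} (hl : j < l) (hlk : l < k) :
    ∃ x ∈ plainLetters, ∃ y ∈ plainLetters, x.smoothing = y.smoothing ∧ b[l]? = some x ∧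
      a[l]? = some y ∧ run (b.take (l + 1)) = next (run (b.take l)) x ∧
      run (a.take (l + 1)) = next (run (a.take l)) y ∧
      next (run (b.take l)) x < 73 ∧ next (run (a.take l)) y < 73 := by
  have hla := h.length_left
  have hlb := h.length_right
  have hk := h.lt_length
  obtain ⟨x, hx, ax, rx, vx, dx⟩ := run_step (by omega) h.alive_right hlk
  obtain ⟨y, hy, ay, ry, vy, dy⟩ := run_step (by omega) h.alive_left hlk
  have := h.smoothing_eq l (by omega)
  rw [sm_of_getElem? ax, sm_of_getElem? ay, Option.some.injEq] at this
  exact ⟨x, hx, y, hy, this.symm, ax, ay, rx, ry, dx, dy⟩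

theorem pair_mem (h : Diverge n k j a b) {l : ℕ} (hl : j < l) (hlk : l ≤ k) :
    100 * run (b.take l) + run (a.take l) ∈ pairTable := by
  induction l, hl using Nat.le_induction with
  | base =>
    obtain ⟨c, hc, -, -, hv, -, -, ra, da, rb, db⟩ := h.first
    rw [ra, rb]
    exact (pairTable_start _ hv c hc db da).1
  | succ l hl ih =>
    obtain ⟨x, hx, y, hy, hxy, -, -, rb, ra, db, da⟩ := h.step hl hlk
    have := run_alive_mono (by have := h.1; have := h.3; omega) h.5 (by omega : l ≤ k)
    have h1 : (100 * run (b.take l) + run (a.take l)) / 100 = run (b.take l) := by omega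
    have h2 : (100 * run (b.take l) + run (a.take l)) % 100 = run (a.take l) := by omega
    have := (pairTable_step _ (ih (by omega)) x hx y hy hxy (by rwa [h1]) (by rwa [h2])).1
    rwa [h1, h2, ← ra, ← rb] at this

/-- If the next cap closes off a loop of `b` that passes through layer `j`, then it does not close
off a loop of `a`. -/
theorem not_closes (h : Diverge n k j a b) (hc : Closes (run (b.take k)))
    (hloop : Conn (sm b) k (k, k % 3) (j, j % 3) ∨ Conn (sm b) k (k, k % 3) (j, j % 3 + 1)) :
    ¬ Closes (run (a.take k)) := by
  intro hca
  have hk := h.lt_length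
  have hlb := h.length_right
  have hj := h.lt
  obtain ⟨c, hc', -, -, hv, hph, hv', ra, da, rb, db⟩ := h.first
  -- For a tall loop the window leaves only `k - 1` and `k - 3` as `1`-smoothed places for `j`, and
  -- there the change to `0` is rejected. For a loop of height two, `j` is `k - 1` or `k - 2`, and
  -- the phases found by the finite checks put the crossing off the loop.
  by_cases hs : run (b.take k) ∈ [48, 51]
  · obtain ⟨k6, k3, s1, s2, s4, s5, s6, r1, r3⟩ := tall_loop_window (by omega) hs
    have hj5 : k ≤ j + 5 := by
      rcases hloop with hl | hl <;> exact (tallLoopPoint_of_conn k6 k3 s1 s2 s4 s5 s6 hl).2.1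
    have hone := h.one_right
    have hj' : j = k - 1 ∨ j = k - 3 := by
      by_contra hne
      rcases (by omega : j = k - 2 ∨ j = k - 4 ∨ j = k - 5) with rfl | rfl | rfl <;> simp_all
    refine tall_loop_rigid (run (a.take j)) ?_ c hc' da
    rw [← hv']
    rcases hj' with rfl | rfl
    · simp only [List.mem_cons, List.not_mem_nil, or_false] at r1 ⊢
      omega
    · simp only [List.mem_cons, List.not_mem_nil, or_false] at r3 ⊢
      omega
  · have hsl := simpleLoop_of_closes (by omega) h.alive_right hc hs
    have hpt : loopPoint k (j, j % 3) ∨ loopPoint k (j, j % 3 + 1) :=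
      hloop.imp hsl.loopPoint_of_conn hsl.loopPoint_of_conn
    unfold loopPoint at hpt
    simp only at hpt
    rcases (by omega : k = j + 1 ∨ k = j + 2) with rfl | rfl
    · rw [rb] at hc
      rw [ra] at hca
      have := (pairTable_start _ hv c hc' db da).2.1 hc hca
      omega
    · obtain ⟨x, hx, y, hy, hxy, -, -, rb', ra', db', da'⟩ := h.step (l := j + 1) (by omega)
        (by omega)
      rw [rb, ra] at *
      rw [rb'] at hc
      rw [ra'] at hca
      have := pair_gap_two _ hv c hc' db da x hx y hy hxy db' da' hc hca
      omega

end Diverge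

/-- The ends of a greedy edge between different layers. -/
theorem diverge_of_mem_greedyPart (ih : MatchedBelow n k) {j : Fin (torusBraid n).length}
    (he : (a, b) ∈ greedyPart (torusBraid n) j k) (hjk : (j : ℕ) ≠ k) :
    Diverge n k j a b ∧ a[k]? = some .zero ∧ b[k]? = some .blueZero ∧
      ¬ Closes (run (a.take k)) ∧ Closes (run (b.take k)) := by
  obtain ⟨hal, hbl⟩ : run (a.take k) < 73 ∧ run (b.take k) < 73 := alive_of_mem_greedyPart ih he
  obtain ⟨hiso, hfirst⟩ := mem_greedyPart.1 he
  obtain ⟨hj, hk, hcase⟩ := isoEdges_of_ne hiso hjk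
  have ha : IsCell (torusBraid n) a := hiso.1
  have hb : IsCell (torusBraid n) b := hiso.2.1
  obtain ⟨sa, sb, sab⟩ := hiso.2.2.1.sm
  have la : a.length = 3 * n := ha.length_eq
  have lb : b.length = 3 * n := hb.length_eq
  -- A red `0` in layer `k` would already be matched by an edge at layer `k` in the same stage.
  obtain ⟨hbk, hbc, hloop⟩ := hcase.resolve_left fun h => by
    obtain ⟨b', hb'⟩ := exists_edge_of_redZero ih ha hal hk h
    exact (hfirst (layer k hk) k (.inr ⟨rfl, hj⟩) _ hb').1 rfl
  have hd : Diverge n k j a b := ⟨la, lb, hk, hj, hal, hbl, sa, sb, sab⟩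
  have hcb : Closes (run (b.take k)) := (conn_iff_closes (by omega) hbl).1 hbc.2
  have hca := hd.not_closes hcb hloop
  obtain ⟨x, hx⟩ := exists_letter la hk
  have hxs := sab k (Ne.symm hjk)
  rw [sm_of_getElem? hx, sm_of_getElem? hbk, Option.some.injEq] at hxs
  have hxc : x.color = none := by
    by_contra hne
    exact hca ((closing_iff_closes (by omega) hal hx).1 ((ha.color_iff hx).1 hne)).2
  obtain rfl := Letter.eq_zero hxs hxc
  exact ⟨hd, hx, hbk, hca, hcb⟩

theorem partner₁_of_mem_greedyPart (ih : MatchedBelow n (k + 1))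
    {j : Fin (torusBraid n).length} (he : (a, b) ∈ greedyPart (torusBraid n) j (k + 1))
    (hj : (j : ℕ) = k) : a[k]? = some .zero ∧ b[k]? = some .one ∧ run (b.take k) = run (a.take k) ∧
      Partner₁ (run (a.take k)) := by
  obtain ⟨hd, hak, hbk, hca, hcb⟩ := diverge_of_mem_greedyPart ih he (by omega)
  rw [hj] at hd
  obtain ⟨c, hc, haj, hbj, hv, hph, hv', ra, da, rb, db⟩ := hd.first
  rw [ra] at hca
  rw [rb] at hcb
  obtain rfl := (pairTable_start _ hv c hc db da).2.2 hcb hca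
  exact ⟨haj, hbj, hv', da, db, hcb, hca⟩

theorem exists_edge_of_one_blueZero (ih : MatchedBelow n (k + 1)) (hw : IsCell (torusBraid n) w)
    (hk : k + 1 < 3 * n) (h : run (w.take k) < 73) (h₁ : w[k]? = some .one)
    (h₂ : w[k + 1]? = some .blueZero) (hp : Partner₁ (run (w.take k))) :
    ∃ a, (a, w) ∈ greedyPart (torusBraid n) (layer k (by omega)) (k + 1) := by
  have hl := hw.length_eq
  have hr : run (((w.set k .zero).set (k + 1) .zero).take k) = run (w.take k) := by
    rw [run_take_set _ (by omega), run_take_set _ le_rfl]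
  refine ⟨(w.set k .zero).set (k + 1) .zero, Pair₁.mem_part ⟨by simp [hl], hl, hk, ?_, h₁, ?_, h₂,
    ?_, hr ▸ h, hr ▸ hp⟩ ih (.inr hw)⟩
  · rw [List.getElem?_set_ne (by omega), List.getElem?_set_self (by omega)]
  · rw [List.getElem?_set_self (by simp; omega)]
  · intro l h1 h2
    rw [List.getElem?_set_ne (by omega), List.getElem?_set_ne (by omega)]

theorem exists_edge_of_zero_zero (ih : MatchedBelow n (k + 1)) (hw : IsCell (torusBraid n) w)
    (hk : k + 1 < 3 * n) (h : run (w.take k) < 73) (h₁ : w[k]? = some .zero)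
    (h₂ : w[k + 1]? = some .zero) (hp : Partner₁ (run (w.take k))) :
    ∃ b, (w, b) ∈ greedyPart (torusBraid n) (layer k (by omega)) (k + 1) := by
  have hl := hw.length_eq
  refine ⟨(w.set k .one).set (k + 1) .blueZero, Pair₁.mem_part ⟨hl, by simp [hl], hk, h₁, ?_, h₂,
    ?_, ?_, h, hp⟩ ih (.inl hw)⟩
  · rw [List.getElem?_set_ne (by omega), List.getElem?_set_self (by omega)]
  · rw [List.getElem?_set_self (by simp; omega)]
  · intro l h1 h2
    rw [List.getElem?_set_ne (by omega), List.getElem?_set_ne (by omega)]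

/-- The core of soundness. It does not classify the edges with a distant changed layer; the pair
table shows that their ends are rejected anyway. -/
theorem not_alive_of_mem_greedyPart (ih : MatchedBelow n k) {j : Fin (torusBraid n).length}
    (he : (a, b) ∈ greedyPart (torusBraid n) j k) (hjk : (j : ℕ) ≠ k) :
    ¬ next (run (b.take k)) .blueZero < 73 ∧ ¬ next (run (a.take k)) .zero < 73 := by
  obtain ⟨hd, hak, hbk, hca, hcb⟩ := diverge_of_mem_greedyPart ih he hjk
  have hj := hd.lt
  obtain ⟨k, rfl⟩ : ∃ k', k = k' + 1 := ⟨k - 1, by omega⟩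
  rcases (by omega : (j : ℕ) = k ∨ (j : ℕ) < k) with hjk' | hjk'
  · obtain ⟨h1, h2, h3, h4⟩ := partner₁_of_mem_greedyPart ih he hjk'
    rw [run_take_succ h1, run_take_succ h2, h3]
    have hla := hd.length_left
    have hkn := hd.lt_length
    have := partner₁_spec _ (run_alive_mono (by omega) hd.alive_left (by omega)) h4
    exact this.2.imp id And.left
  · obtain ⟨x, hx, y, hy, hxy, bx, ay, rb, ra, db, da⟩ := hd.step hjk' (by omega)
    have hla := hd.length_left
    have hlb := hd.length_right
    have hkn := hd.lt_length
    have hqa : run (a.take k) < 73 := run_alive_mono (by omega) hd.alive_left (by omega)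
    have hqb : run (b.take k) < 73 := run_alive_mono (by omega) hd.alive_right (by omega)
    have h1 : (100 * run (b.take k) + run (a.take k)) / 100 = run (b.take k) := by omega
    have h2 : (100 * run (b.take k) + run (a.take k)) % 100 = run (a.take k) := by omega
    have := (pairTable_step _ (hd.pair_mem hjk' (by omega)) x hx y hy hxy (by rwa [h1])
      (by rwa [h2])).2
    rw [h1, h2, ← ra, ← rb] at this
    -- In the remaining case `b` has a partner that changes the layer just below `k + 1`; that edge
    -- comes earlier in the stage and uses up `b`.
    refine (this hcb hca).resolve_right ?_
    rintro ⟨rfl, hp⟩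
    obtain ⟨hiso, hfirst⟩ := mem_greedyPart.1 he
    obtain ⟨a', ha'⟩ := exists_edge_of_one_blueZero ih hiso.2.1 hkn hqb bx hbk hp
    exact (hfirst _ _ (.inr ⟨rfl, hjk'⟩) _ ha').2.2.2 rfl

/-- After a common prefix that leads to `v`, the words `a` and `b` go on with `0x0` and with `1x`
and a blue `0`, and agree from there on. -/
structure Pair₂ (n k : ℕ) (a b : Word) (x : Letter) : Prop where
  length_left : a.length = 3 * n
  length_right : b.length = 3 * n
  lt : k + 2 < 3 * n
  left₁ : a[k]? = some .zero
  right₁ : b[k]? = some .one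
  left₂ : a[k + 1]? = some x
  left₃ : a[k + 2]? = some .zero
  right₃ : b[k + 2]? = some .blueZero
  eq : ∀ l, l ≠ k → l ≠ k + 2 → a[l]? = b[l]?
  alive : run (a.take k) < 73
  mem : x ∈ plainLetters
  partner : Partner₂ (run (a.take k)) x

/-- Earlier edges of the stage change layer `k + 2` or `k + 1`. The letters exclude the former, the
two negative clauses of `Partner₂` exclude the latter. -/
theorem Pair₂.mem_part (h : Pair₂ n k a b x) (ih : MatchedBelow n (k + 2))
    (hcell : IsCell (torusBraid n) a ∨ IsCell (torusBraid n) b) :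
    (a, b) ∈ greedyPart (torusBraid n) (layer k (by have := h.lt; omega)) (k + 2) := by
  obtain ⟨hla, hlb, hk, ha1, hb1, ha2, ha3, hb3, hab, hv, hx, hp⟩ := h
  obtain ⟨s1, s2, s3, s4, s5⟩ := partner₂_spec _ hv x hx hp
  obtain ⟨p1, p2, p3, p4, p5, p6⟩ := hp
  have hb2 := hab (k + 1) (by omega) (by omega) ▸ ha2
  have ra := run_take_succ ha1
  have rb := run_take_succ hb1
  have ra' := run_take_succ ha2
  have rb' := run_take_succ hb2
  rw [take_congr (a := b) (b := a) (k := k) fun l hl => (hab l (by omega) (by omega)).symm] at rb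
  have hph := (run_spec (w := a) (k := k) (by omega) hv).1
  rw [hph, show (k % 3 + 2) % 3 = (k + 2) % 3 by omega] at s5
  rw [← ra] at p1 p4 p6 s5
  rw [← ra'] at p1 p4 s5
  rw [← rb] at p2 p3 p5 s3 s5
  rw [← rb'] at p2 p3 s3 s5
  refine mem_greedyPart_of_alive ih (isoEdges_of_partner hla hlb hk (by omega) (by omega) ha1 hb1
    ha3 hb3 hab p1 p2 p4 p3 s3 s5 hcell) p1 p2 ?_
  rintro l hl hlk ⟨a', b'⟩ he'
  have hl' : k < (l : ℕ) := hl
  rcases (by omega : (l : ℕ) = k + 2 ∨ (l : ℕ) = k + 1) with hl'' | hl''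
  · have := isoEdges_self (j := l) (hl'' ▸ (mem_greedyPart.1 he').1)
    rw [hl''] at this
    obtain ⟨t1, t2, -⟩ := this
    exact ⟨ne_of_getElem? ha3 t1 (by decide), ne_of_getElem? ha3 t2 (by decide),
      ne_of_getElem? hb3 t1 (by decide), ne_of_getElem? hb3 t2 (by decide)⟩
  · obtain ⟨-, e1, e2, -⟩ := diverge_of_mem_greedyPart ih he' (by omega)
    obtain ⟨e3, e4, e5, e6⟩ := partner₁_of_mem_greedyPart ih he' hl''
    refine ⟨?_, ne_of_getElem? ha3 e2 (by decide), ne_of_getElem? hb3 e1 (by decide), ?_⟩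
    · rintro rfl
      exact p6 ⟨Option.some_injective _ (ha2.symm.trans e3), e6⟩
    · rintro rfl
      exact p5 ⟨Option.some_injective _ (hb2.symm.trans e4), e5 ▸ e6⟩

theorem exists_edge_of_one_of_blueZero (ih : MatchedBelow n (k + 2)) (hw : IsCell (torusBraid n) w)
    (hk : k + 2 < 3 * n) (h : run (w.take k) < 73) (h₁ : w[k]? = some .one)
    (h₂ : w[k + 1]? = some x) (h₃ : w[k + 2]? = some .blueZero) (hx : x ∈ plainLetters)
    (hp : Partner₂ (run (w.take k)) x) :
    ∃ a, (a, w) ∈ greedyPart (torusBraid n) (layer k (by omega)) (k + 2) := by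
  have hl := hw.length_eq
  have hr : run (((w.set k .zero).set (k + 2) .zero).take k) = run (w.take k) := by
    rw [run_take_set _ (by omega), run_take_set _ le_rfl]
  refine ⟨(w.set k .zero).set (k + 2) .zero, Pair₂.mem_part ⟨by simp [hl], hl, hk, ?_, h₁, ?_, ?_,
    h₃, ?_, hr ▸ h, hx, hr ▸ hp⟩ ih (.inr hw)⟩
  · rw [List.getElem?_set_ne (by omega), List.getElem?_set_self (by omega)]
  · rw [List.getElem?_set_ne (by omega), List.getElem?_set_ne (by omega), h₂]
  · rw [List.getElem?_set_self (by simp; omega)]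
  · intro l h1 h2
    rw [List.getElem?_set_ne (by omega), List.getElem?_set_ne (by omega)]

theorem exists_edge_of_zero_of_zero (ih : MatchedBelow n (k + 2)) (hw : IsCell (torusBraid n) w)
    (hk : k + 2 < 3 * n) (h : run (w.take k) < 73) (h₁ : w[k]? = some .zero)
    (h₂ : w[k + 1]? = some x) (h₃ : w[k + 2]? = some .zero) (hx : x ∈ plainLetters)
    (hp : Partner₂ (run (w.take k)) x) :
    ∃ b, (w, b) ∈ greedyPart (torusBraid n) (layer k (by omega)) (k + 2) := by
  have hl := hw.length_eq
  refine ⟨(w.set k .one).set (k + 2) .blueZero, Pair₂.mem_part ⟨hl, by simp [hl], hk, h₁, ?_, h₂,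
    h₃, ?_, ?_, h, hx, hp⟩ ih (.inl hw)⟩
  · rw [List.getElem?_set_ne (by omega), List.getElem?_set_self (by omega)]
  · rw [List.getElem?_set_self (by simp; omega)]
  · intro l h1 h2
    rw [List.getElem?_set_ne (by omega), List.getElem?_set_ne (by omega)]

theorem touched_of_not_alive (ih : MatchedBelow n k) (hw : IsCell (torusBraid n) w)
    (hk : k < 3 * n) (h : run (w.take k) < 73) (hd : ¬ run (w.take (k + 1)) < 73) :
    Touched n k w := by
  have hl := hw.length_eq
  obtain ⟨c, hc⟩ := exists_letter hl hk
  rw [run_take_succ hc] at hd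
  have hcol := hw.color_iff hc
  rw [closing_iff_closes (by omega) h hc] at hcol
  -- The search for a partner looks back two letters; before that, `0` is accepted and no loop can
  -- be closed off.
  have h2 : c = .zero ∨ c = .blueZero → 2 ≤ k := by
    intro hc'
    by_contra hlt
    have hmem : run (w.take k) ∈ [0, 1, 2, 3, 4, 5, 6] := by
      have h0 : run (w.take 0) = 0 := rfl
      rcases (by omega : k = 0 ∨ k = 1) with rfl | rfl
      · rw [h0]
        decide
      · obtain ⟨x, hx, -, hr, -, h2⟩ := run_step (by omega) h (l := 0) (by omega)
        rw [h0] at hr h2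
        have := next_early x hx h2
        rw [show run (w.take 1) = next 0 x from hr]
        grind
    obtain ⟨e1, e2⟩ := early_states _ hmem
    rcases hc' with rfl | rfl
    · exact hd e1
    · exact e2 (hcol.1 (by simp [Letter.color])).2
  have two : 2 ≤ k → ∃ u y x, k = u + 2 ∧ y ∈ plainLetters ∧ x ∈ plainLetters ∧
      run (w.take u) < 73 ∧ next (run (w.take u)) y < 73 ∧
      next (next (run (w.take u)) y) x < 73 ∧ w[u]? = some y ∧ w[u + 1]? = some x ∧
      run (w.take (u + 1)) = next (run (w.take u)) y ∧
      run (w.take k) = next (next (run (w.take u)) y) x := by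
    intro h2
    obtain ⟨u, rfl⟩ : ∃ u, k = u + 2 := ⟨k - 2, by omega⟩
    obtain ⟨y, hy, wy, ry, vy, dy⟩ := run_step (by omega) h (l := u) (by omega)
    obtain ⟨x, hx, wx, rx, vx, dx⟩ := run_step (by omega) h (l := u + 1) (by omega)
    rw [ry] at dx rx
    exact ⟨u, y, x, rfl, hy, hx, vy, dy, dx, wy, wx, ry, rx⟩
  match c with
  | .redOne => simp [Letter.color, Letter.smoothing] at hcol
  | .blueOne => simp [Letter.color, Letter.smoothing] at hcol
  | .redZero =>
    obtain ⟨b, hb⟩ := exists_edge_of_redZero ih hw h hk hc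
    exact ⟨_, _, hb, .inl rfl⟩
  | .one =>
    rw [next_one_alive _ h, not_not] at hd
    exact touched_of_one ih hw h hk hc hd
  | .blueZero =>
    obtain ⟨u, y, x, rfl, hy, hx, hu, dy, dx, wy, wx, ry, rx⟩ := two (h2 (.inr rfl))
    have hcl := (hcol.1 (by simp [Letter.color])).2
    rw [rx] at hd hcl
    obtain ⟨rfl, hp⟩ | ⟨rfl, hp⟩ := exists_partner_blueZero _ hu y hy dy x hx dx hcl hd
    · obtain ⟨a, ha⟩ := exists_edge_of_one_blueZero ih hw hk (ry ▸ dy) wx hc (ry ▸ hp)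
      exact ⟨_, _, ha, .inr rfl⟩
    · obtain ⟨a, ha⟩ := exists_edge_of_one_of_blueZero ih hw hk hu wy wx hc hx hp
      exact ⟨_, _, ha, .inr rfl⟩
  | .zero =>
    obtain ⟨u, y, x, rfl, hy, hx, hu, dy, dx, wy, wx, ry, rx⟩ := two (h2 (.inl rfl))
    have hcl : ¬ Closes (run (w.take (u + 2))) := fun hcl => by
      simp [Letter.color, Letter.smoothing, hcl] at hcol
    rw [rx] at hd hcl
    obtain ⟨rfl, hp⟩ | ⟨rfl, hp⟩ := exists_partner_zero _ hu y hy dy x hx dx hcl hd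
    · obtain ⟨b, hb⟩ := exists_edge_of_zero_zero ih hw hk (ry ▸ dy) wx hc (ry ▸ hp)
      exact ⟨_, _, hb, .inl rfl⟩
    · obtain ⟨b, hb⟩ := exists_edge_of_zero_of_zero ih hw hk hu wy wx hc hx hp
      exact ⟨_, _, hb, .inl rfl⟩

theorem not_alive_of_touched_self (ih : MatchedBelow n k) (hw : IsCell (torusBraid n) w)
    (hk : k < 3 * n) (ht : Touched n k w) : ¬ run (w.take (k + 1)) < 73 := by
  intro h
  have hl := hw.length_eq
  obtain ⟨c, hc, wc, rc, hv, dc⟩ := run_step (by omega) h (l := k) (by omega)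
  obtain ⟨j, ⟨a, b⟩, he, hab⟩ := ht
  by_cases hjk : (j : ℕ) = k
  · subst hjk
    obtain ⟨h1, h2, h3⟩ := isoEdges_self (mem_greedyPart.1 he).1
    rcases hab with rfl | rfl
    · rw [h1, Option.some.injEq] at wc
      subst wc
      exact absurd hc (by decide)
    · rw [h2, Option.some.injEq] at wc
      subst wc
      exact (next_one_alive _ hv).1 dc ((conn_iff_closes (by omega) hv).1 h3)
  · obtain ⟨-, h1, h2, -⟩ := diverge_of_mem_greedyPart ih he hjk
    obtain ⟨d1, d2⟩ := not_alive_of_mem_greedyPart ih he hjk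
    rcases hab with rfl | rfl
    · rw [h1, Option.some.injEq] at wc
      exact d2 (wc ▸ dc)
    · rw [h2, Option.some.injEq] at wc
      exact d1 (wc ▸ dc)

/-- Rejection at the next letter is equivalent to being touched in stage `k`; rejection before it is
covered by the induction hypothesis. -/
theorem matchedBelow (hk : k ≤ 3 * n) : MatchedBelow n k := by
  induction k with
  | zero =>
    intro w _
    simp only [not_lt_zero, false_and, exists_false, false_iff, not_not, List.take_zero]
    decide
  | succ k ih =>
    have ih := ih (by omega)
    intro w hw
    have hl := hw.length_eq
    constructor
    · rintro ⟨r, hr, ht⟩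
      rcases Nat.lt_succ_iff_lt_or_eq.1 hr with hr | rfl
      · exact fun h => (ih w hw).1 ⟨r, hr, ht⟩ (run_alive_mono (by omega) h (by omega))
      · exact not_alive_of_touched_self ih hw hk ht
    · intro hd
      by_cases h : run (w.take k) < 73
      · exact ⟨k, by omega, touched_of_not_alive ih hw hk h hd⟩
      · obtain ⟨r, hr, ht⟩ := (ih w hw).2 h
        exact ⟨r, by omega, ht⟩

theorem lt_of_mem_isoEdges {j : Fin (torusBraid n).length}
    (he : e ∈ isoEdges (torusBraid n) j k) : k < 3 * n := by
  by_cases h : (j : ℕ) = k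
  · exact h ▸ layer_lt j
  · exact (isoEdges_of_ne he h).2.1

theorem mem_U_iff : w ∈ U n ↔ w.length = 3 * n ∧ run w < 73 := by
  have key : ∀ w, IsCell (torusBraid n) w →
      ((∃ e ∈ greedyMatching (torusBraid n), w = e.1 ∨ w = e.2) ↔ ¬ run w < 73) := by
    intro w hw
    have := matchedBelow (n := n) le_rfl w hw
    rw [← hw.length_eq, List.take_length] at this
    rw [← this]
    constructor
    · rintro ⟨e, ⟨j, k, he⟩, h⟩
      exact ⟨k, hw.length_eq ▸ lt_of_mem_isoEdges (mem_greedyPart.1 he).1, j, e, he, h⟩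
    · rintro ⟨k, -, j, e, he, h⟩
      exact ⟨e, ⟨j, k, he⟩, h⟩
  constructor
  · rintro ⟨hw, h⟩
    refine ⟨hw.length_eq, ?_⟩
    by_contra hd
    obtain ⟨e, he, h'⟩ := (key w hw).2 hd
    exact h'.elim (h e he).1 (h e he).2
  · rintro ⟨hl, h⟩
    have hw := IsCell.of_alive hl h
    exact ⟨hw, fun e he => ⟨fun h' => (key w hw).1 ⟨e, he, .inl h'⟩ h,
      fun h' => (key w hw).1 ⟨e, he, .inr h'⟩ h⟩⟩

end Greedy

/-! ## Occurrences of a block in accepted words -/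

/-- A device that looks for the first occurrence of a block which starts in one of the states `S`,
and for a second occurrence right after it. In a configuration `(m, s, k)` the state of the automaton
is `s`, and the last `k` letters are the first `k` letters of the block. The mode `m` is `0` before
the end of the first occurrence, `1` as long as a second occurrence can follow, `2` if it does not
follow, and `3` after the second occurrence. -/
def advance (blk : Word) (S : List ℕ) : ℕ × ℕ × ℕ → Letter → ℕ × ℕ × ℕ
  | (0, s, k), c =>
    if blk[k]? = some c ∧ (0 < k ∨ s ∈ S) then
      if k + 1 = blk.length then (1, next s c, 0) else (0, next s c, k + 1)
    else if blk[0]? = some c ∧ s ∈ S then (0, next s c, 1) else (0, next s c, 0)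
  | (1, s, k), c =>
    if blk[k]? = some c then
      if k + 1 = blk.length then (3, next s c, 0) else (1, next s c, k + 1)
    else (2, next s c, 0)
  | (m + 2, s, _), c => (m + 2, next s c, 0)

/-- The configuration which is reached on a word. -/
def scan (blk : Word) (S : List ℕ) (w : Word) : ℕ × ℕ × ℕ := w.foldl (advance blk S) (0, 0, 0)

/-- A linear combination of the number of `1`-smoothings, the number of blue loops and the length. -/
def weight (α β γ : ℤ) (w : Word) : ℤ := α * onesCount w + β * colorCount .blue w + γ * w.length

section Scan

variable {blk : Word} {S : List ℕ} {w u v : Word} {c : Letter} {α β γ : ℤ}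

theorem weight_append (u v : Word) : weight α β γ (u ++ v) = weight α β γ u + weight α β γ v := by
  simp only [weight, onesCount, colorCount, List.countP_append, List.length_append]
  push_cast
  ring

theorem advance_state (q : ℕ × ℕ × ℕ) (c : Letter) : (advance blk S q c).2.1 = next q.2.1 c := by
  obtain ⟨m, s, k⟩ := q
  match m with
  | 0 => simp only [advance]; split_ifs <;> rfl
  | 1 => simp only [advance]; split_ifs <;> rfl
  | m + 2 => rfl

theorem scan_append (u v : Word) :
    scan blk S (u ++ v) = v.foldl (advance blk S) (scan blk S u) := List.foldl_append ..

theorem scan_concat (u : Word) (c : Letter) :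
    scan blk S (u ++ [c]) = advance blk S (scan blk S u) c := scan_append u [c]

theorem run_concat (u : Word) (c : Letter) : run (u ++ [c]) = next (run u) c := run_append u [c]

theorem scan_state (w : Word) : (scan blk S w).2.1 = run w := by
  induction w using List.reverseRecOn with
  | nil => rfl
  | append_singleton u c ih => rw [scan_concat, run_concat, advance_state, ih]

theorem mode_le_advance (q : ℕ × ℕ × ℕ) (c : Letter) : q.1 ≤ (advance blk S q c).1 := by
  obtain ⟨m, s, k⟩ := q
  match m with
  | 0 => exact Nat.zero_le _
  | 1 => simp only [advance]; split_ifs <;> simp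
  | m + 2 => exact le_rfl

theorem mode_le_foldl (v : Word) (q : ℕ × ℕ × ℕ) : q.1 ≤ (v.foldl (advance blk S) q).1 := by
  induction v generalizing q with
  | nil => exact le_rfl
  | cons c v ih => exact (mode_le_advance q c).trans (ih _)

theorem mode_mono (u v : Word) : (scan blk S u).1 ≤ (scan blk S (u ++ v)).1 := by
  rw [scan_append]
  exact mode_le_foldl _ _

theorem take_succ_suffix {k : ℕ} (h : blk[k]? = some c) (hu : blk.take k <:+ u) :
    blk.take (k + 1) <:+ u ++ [c] := by
  obtain ⟨t, rfl⟩ := hu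
  rw [List.take_add_one, h]
  exact ⟨t, by simp⟩

/-- The counter is truthful: a match that the scanner reports is a real suffix. That it misses none
is the separate condition `complete`, needed because the device restarts naively after a mismatch.
-/
theorem scan_mode_zero (hblk : 1 < blk.length) (h : (scan blk S w).1 = 0) :
    (scan blk S w).2.2 < blk.length ∧ blk.take (scan blk S w).2.2 <:+ w := by
  induction w using List.reverseRecOn with
  | nil => exact ⟨by simp only [scan, List.foldl_nil]; omega, by simp [scan]⟩
  | append_singleton u c ih =>
    obtain ⟨ih1, ih2⟩ := ih (Nat.le_zero.1 (h ▸ mode_mono u [c]))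
    have hm : (scan blk S u).1 = 0 := Nat.le_zero.1 (h ▸ mode_mono u [c])
    rw [scan_concat] at h ⊢
    revert h ih1 ih2 hm
    generalize scan blk S u = q
    obtain ⟨m, s, k⟩ := q
    rintro h ih1 ih2 rfl
    simp only [advance] at h ih1 ih2 ⊢
    by_cases h1 : blk[k]? = some c ∧ (0 < k ∨ s ∈ S)
    · rw [if_pos h1] at h ⊢
      by_cases h2 : k + 1 = blk.length
      · simp [if_pos h2] at h
      · rw [if_neg h2]
        exact ⟨show k + 1 < _ by omega, take_succ_suffix h1.1 ih2⟩
    · rw [if_neg h1]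
      by_cases h3 : blk[0]? = some c ∧ s ∈ S
      · rw [if_pos h3]
        exact ⟨hblk, take_succ_suffix h3.1 (by simp)⟩
      · rw [if_neg h3]
        exact ⟨show 0 < _ by omega, by simp⟩

theorem suffix_of_mode_change (hblk : 1 < blk.length) (h : (scan blk S u).1 = 0)
    (h' : (scan blk S (u ++ [c])).1 ≠ 0) :
    blk <:+ u ++ [c] ∧ ∃ s, scan blk S (u ++ [c]) = (1, s, 0) := by
  obtain ⟨-, h2⟩ := scan_mode_zero hblk h
  rw [scan_concat] at h' ⊢
  revert h h' h2
  generalize scan blk S u = q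
  obtain ⟨m, s, k⟩ := q
  rintro rfl h' h2
  simp only [advance] at h' h2 ⊢
  split_ifs at h' ⊢ with h1 h3 h4
  · refine ⟨?_, _, rfl⟩
    have := take_succ_suffix h1.1 h2
    rwa [h3, List.take_length] at this
  all_goals simp at h'

theorem exists_mode_change (h : (scan blk S w).1 ≠ 0) :
    ∃ u c z, w = u ++ [c] ++ z ∧ (scan blk S u).1 = 0 ∧ (scan blk S (u ++ [c])).1 ≠ 0 := by
  induction w using List.reverseRecOn with
  | nil => exact absurd rfl h
  | append_singleton u c ih =>
    by_cases hu : (scan blk S u).1 = 0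
    · exact ⟨u, c, [], by simp, hu, h⟩
    · obtain ⟨u', c', z, rfl, h1, h2⟩ := ih hu
      exact ⟨u', c', z ++ [c], by simp, h1, h2⟩

theorem drop_prefix_of_mode_three {s k : ℕ} (hk : k < blk.length)
    (h : (v.foldl (advance blk S) (1, s, k)).1 = 3) : blk.drop k <+: v := by
  induction v generalizing s k with
  | nil => simp at h
  | cons c v ih =>
    rw [List.foldl_cons] at h
    by_cases h1 : blk[k]? = some c
    · obtain ⟨hk', rfl⟩ := List.getElem?_eq_some_iff.1 h1
      rw [List.drop_eq_getElem_cons hk', List.cons_prefix_cons]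
      refine ⟨rfl, ?_⟩
      by_cases h2 : k + 1 = blk.length
      · rw [h2, List.drop_length]
        exact List.nil_prefix
      · refine ih (by omega) (s := next s blk[k]) ?_
        simpa only [advance, if_pos h1, if_neg h2] using h
    · exfalso
      have : ∀ (v : Word) (s : ℕ), (v.foldl (advance blk S) (2, s, 0)).1 = 2 := by
        intro v
        induction v with
        | nil => exact fun s => rfl
        | cons c v ih => exact fun s => ih (next s c)
      simp only [advance, if_neg h1, this] at h
      omega

end Scan

/-- The finite verification behind the duplication of the block `blk`: the table `T` bounds the
weight of the accepted words by the configurations that they lead to. -/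
structure IsDuplicable (blk : Word) (S : List ℕ) (α β γ : ℤ) (T : List ((ℕ × ℕ × ℕ) × ℤ))
    (θ₁ θ₂ : ℤ) : Prop where
  one_lt_length : 1 < blk.length
  start : ((0, 0, 0), 0) ∈ T
  closed : ∀ r ∈ T, ∀ c ∈ plainLetters, next r.1.2.1 c < 73 → (advance blk S r.1 c).1 = 3 ∨
    ∃ r' ∈ T, r'.1 = advance blk S r.1 c ∧ r.2 + weight α β γ [c] ≤ r'.2
  lt₁ : ∀ r ∈ T, r.1.1 = 0 → phase r.1.2.1 = 0 → r.2 < θ₁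
  lt₂ : ∀ r ∈ T, phase r.1.2.1 = 0 → r.2 < θ₂
  complete : ∀ r ∈ T, r.1.1 = 0 → (blk.foldl (advance blk S) r.1).2.1 < 73 →
    (blk.foldl (advance blk S) r.1).1 ≠ 0
  stable : ∀ s < 73, blk.foldl next s < 73 → blk.foldl next (blk.foldl next s) = blk.foldl next s
  weight_eq : weight α β γ blk = θ₂ - θ₁

/-- The words of the form `x ++ s ++ y`, where `x` ends before the first occurrence of `s`. -/
def IsFirst (s x w : Word) : Prop := ∀ x' y' : Word, w = x' ++ s ++ y' → x.length ≤ x'.length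

/-- Being the first occurrence depends only on the word up to the end of that occurrence, so it
survives the insertion or deletion of a later copy. -/
theorem isFirst_of_append {s x y w : Word} (h : IsFirst s x (x ++ s ++ y)) (hw : x ++ s <+: w) :
    IsFirst s x w := by
  rintro x' y' rfl
  by_contra hlt
  have hp : x' ++ s <+: x ++ s :=
    List.prefix_of_prefix_length_le (List.prefix_append ..) hw (by simp; omega)
  obtain ⟨z, hz⟩ := hp
  exact hlt (h x' (z ++ y) (by rw [← hz]; simp))

theorem run_foldl_of_append {u v : Word} (h : run (u ++ v) < 73) : run u < 73 := by
  have := run_alive_mono (w := u ++ v) (k := (u ++ v).length) le_rfl (by rwa [List.take_length])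
    (l := u.length) (by simp)
  rwa [List.take_left'  rfl] at this

namespace IsDuplicable

variable {blk : Word} {S : List ℕ} {α β γ θ₁ θ₂ : ℤ} {T : List ((ℕ × ℕ × ℕ) × ℤ)} {w x y : Word}

/-- The table is a potential: it starts at `0` and every step respects the bounds, until the second
copy is complete. -/
theorem exists_le (h : IsDuplicable blk S α β γ T θ₁ θ₂) (hw : run w < 73)
    (hm : (scan blk S w).1 ≠ 3) : ∃ r ∈ T, r.1 = scan blk S w ∧ weight α β γ w ≤ r.2 := by
  induction w using List.reverseRecOn with
  | nil => exact ⟨_, h.start, rfl, by simp [weight, onesCount, colorCount]⟩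
  | append_singleton u c ih =>
    rw [run_concat] at hw
    rw [scan_concat] at hm ⊢
    have hu : (scan blk S u).1 ≠ 3 := by
      intro hu
      apply hm
      obtain ⟨q, hq⟩ : ∃ q, scan blk S u = (3, q) := ⟨_, Prod.ext hu rfl⟩
      rw [hq]
      rfl
    obtain ⟨r, hr, hr1, hr2⟩ := ih (next_alive hw).1 hu
    have := h.closed r hr c (next_alive hw).2 (by rw [hr1, scan_state]; exact hw)
    rw [hr1] at this
    obtain ⟨r', h1, h2, h3⟩ := this.resolve_left hm
    exact ⟨r', h1, h2, by rw [weight_append]; omega⟩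

/-- The first occurrence of the block in an accepted word of large weight. -/
theorem exists_first (h : IsDuplicable blk S α β γ T θ₁ θ₂) (hw : run w < 73)
    (hph : phase (run w) = 0) (hθ : θ₁ ≤ weight α β γ w) :
    ∃ x y, w = x ++ blk ++ y ∧ IsFirst blk x w ∧ ∃ s, scan blk S (x ++ blk) = (1, s, 0) := by
  have hm : (scan blk S w).1 ≠ 0 := by
    intro hm
    obtain ⟨r, hr, hr1, hr2⟩ := h.exists_le hw (by omega)
    have := h.lt₁ r hr (hr1 ▸ hm) (by rw [hr1, scan_state, hph])
    omega
  obtain ⟨u, c, z, rfl, h1, h2⟩ := exists_mode_change hm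
  obtain ⟨⟨x, hx⟩, s, hs⟩ := suffix_of_mode_change h.one_lt_length h1 h2
  rw [← hx] at hs
  refine ⟨x, z, by rw [← hx], ?_, s, hs⟩
  intro x' y' hxy
  by_contra hlt
  have hlen : x.length + blk.length = u.length + 1 := by
    simpa using congrArg List.length hx
  -- An earlier occurrence would end while the scanner is still in mode `0`, contrary to `complete`.
  have hpre : x' ++ blk <+: u := by
    refine List.prefix_of_prefix_length_le (l₃ := u ++ [c] ++ z) ?_ ?_ (by simp; omega)
    · rw [hxy]
      exact List.prefix_append ..
    · rw [List.append_assoc]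
      exact List.prefix_append ..
  obtain ⟨t, ht⟩ := hpre
  have hm' : (scan blk S (x' ++ blk)).1 = 0 := by
    have := mode_mono (blk := blk) (S := S) (x' ++ blk) t
    rw [ht] at this
    omega
  have hm'' : (scan blk S x').1 = 0 := by
    have := mode_mono (blk := blk) (S := S) x' blk
    omega
  rw [hxy] at hw
  have hr := run_foldl_of_append hw
  obtain ⟨r, hr', hr1, -⟩ := h.exists_le (run_foldl_of_append hr) (by omega)
  refine h.complete r hr' (hr1 ▸ hm'') ?_ ?_
  · rw [hr1, ← scan_append, scan_state]
    exact hr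
  · rw [hr1, ← scan_append, hm']

theorem exists_first_twice (h : IsDuplicable blk S α β γ T θ₁ θ₂) (hw : run w < 73)
    (hph : phase (run w) = 0) (hθ : θ₂ ≤ weight α β γ w) (hle : θ₁ ≤ θ₂) :
    ∃ x y, w = x ++ blk ++ blk ++ y ∧ IsFirst blk x w := by
  have hm : (scan blk S w).1 = 3 := by
    by_contra hm
    obtain ⟨r, hr, hr1, hr2⟩ := h.exists_le hw hm
    have := h.lt₂ r hr (by rw [hr1, scan_state, hph])
    omega
  obtain ⟨x, y, rfl, hx, s, hs⟩ := h.exists_first hw hph (hle.trans hθ)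
  rw [scan_append, hs] at hm
  obtain ⟨z, rfl⟩ := drop_prefix_of_mode_three (by have := h.one_lt_length; omega) hm
  exact ⟨x, z, by simp, hx⟩

/-- The block fixes the state in which its first copy ends, so a second copy is invisible to the
rest of the word. -/
theorem run_twice (h : IsDuplicable blk S α β γ T θ₁ θ₂) (hr : run (x ++ blk) < 73) :
    run (x ++ blk ++ blk ++ y) = run (x ++ blk ++ y) := by
  have hx := run_foldl_of_append hr
  have e : run (x ++ blk ++ blk) = run (x ++ blk) := by
    rw [run_append (x ++ blk), run_append x]
    rw [run_append] at hr
    exact h.stable _ hx hr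
  rw [run_append _ y, run_append _ y, e]

end IsDuplicable

/-! ## Degrees and connectivity of accepted words -/

theorem mem_plainLetters_of_alive {w : Word} (h : run w < 73) : ∀ c ∈ w, c ∈ plainLetters := by
  intro c hc
  obtain ⟨i, hi, rfl⟩ := List.getElem_of_mem hc
  rw [← List.take_length (l := w)] at h
  obtain ⟨x, hx, h', -⟩ := run_step le_rfl h hi
  rw [List.getElem?_eq_getElem hi, Option.some.injEq] at h'
  rwa [h']

theorem colorCount_red_of_alive {w : Word} (h : run w < 73) : colorCount .red w = 0 := by
  have key : ∀ c ∈ plainLetters, ¬ decide (c.color = some .red) = true := by decide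
  exact List.countP_eq_zero.2 fun c hc => key c (mem_plainLetters_of_alive h c hc)

/-- The final state determines the matching of the endpoints, even for braids of different length.
-/
theorem underlying_eq_of_run_eq {n n' : ℕ} {w w' : Word} (hw : w.length = 3 * n)
    (hw' : w'.length = 3 * n') (h : run w < 73) (hr : run w = run w') :
    underlying (torusBraid n) w = underlying (torusBraid n') w' := by
  have key : ∀ (n : ℕ) (w : Word), w.length = 3 * n → run w < 73 → ∀ e e' : Endpoint 3,
      (components (torusBraid n) w) (endpoint _ e) (endpoint _ e') ↔
        cond e'.1 4 0 + (e'.2 : ℕ) = cond e.1 4 0 + (e.2 : ℕ) ∨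
        cond e'.1 4 0 + (e'.2 : ℕ) = stateMatching (run w) (cond e.1 4 0 + (e.2 : ℕ)) := by
    intro n w hw h e e'
    have hm := (run_spec (w := w) (k := 3 * n) hw.ge (by rwa [← hw, List.take_length])).2
    rw [← hw, List.take_length, hw] at hm
    have bound : ∀ e : Endpoint 3, cond e.1 4 0 + (e.2 : ℕ) < 8 := by decide
    rw [components_iff, coords_endpoint, coords_endpoint]
    exact hm.conn _ (bound e) _ (bound e')
  ext e e'
  exact (key n w hw h e e').trans ((hr ▸ (key n' w' hw' (hr ▸ h) e e').symm))

/-- The duplication of the first occurrence of a block is a bijection between the unmatched words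
of large weight. -/
theorem IsDuplicable.exists_equiv {blk : Word} {S : List ℕ} {α β γ θ₁ θ₂ : ℤ}
    {T : List ((ℕ × ℕ × ℕ) × ℤ)} (h : IsDuplicable blk S α β γ T θ₁ θ₂) (hle : θ₁ ≤ θ₂)
    (hlen : blk.length = 12) {n : ℕ} {P Q : Word → Prop}
    (hP : ∀ w ∈ U n, P w ↔ θ₁ ≤ weight α β γ w)
    (hQ : ∀ w ∈ U (n + 4), Q w ↔ θ₂ ≤ weight α β γ w) {dh dq : ℤ}
    (hdh : dh = 12 - onesCount blk) (hdq : dq = 24 - onesCount blk + colorCount .blue blk) :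
    ∃ f : {w : Word // w ∈ U n ∧ P w} ≃ {w : Word // w ∈ U (n + 4) ∧ Q w}, ∀ w,
      DuplicatesFirst blk w.1 (f w).1 ∧
      cellObject (torusBraid n) w.1 = (cellObject (torusBraid (n + 4)) (f w).1).shift dh dq := by
  have hph : ∀ {n w}, w ∈ U n → phase (run w) = 0 := by
    intro n w hw
    obtain ⟨h1, h2⟩ := mem_U_iff.1 hw
    have := (run_spec (w := w) (k := 3 * n) h1.ge (by rwa [← h1, List.take_length])).1
    rw [← h1, List.take_length, h1] at this
    omega
  have hdup : ∀ w ∈ U n, ∀ x y, w = x ++ blk ++ y →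
      run (x ++ blk ++ blk ++ y) = run w := by
    rintro w hw x y rfl
    exact h.run_twice (run_foldl_of_append (mem_U_iff.1 hw).2)
  have hex : ∀ w : {w : Word // w ∈ U n ∧ P w}, ∃ w' : {w : Word // w ∈ U (n + 4) ∧ Q w},
      DuplicatesFirst blk w.1 w'.1 := by
    rintro ⟨w, hw, hPw⟩
    have hwθ := (hP w hw).1 hPw
    obtain ⟨x, y, hxy, hx, -⟩ := h.exists_first (mem_U_iff.1 hw).2 (hph hw) hwθ
    have hr := hdup w hw x y hxy
    have hl : w.length = 3 * n := (mem_U_iff.1 hw).1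
    have hU : x ++ blk ++ blk ++ y ∈ U (n + 4) := by
      refine mem_U_iff.2 ⟨?_, by rw [hr]; exact (mem_U_iff.1 hw).2⟩
      rw [hxy] at hl
      simp only [List.length_append] at hl ⊢
      omega
    refine ⟨⟨_, hU, (hQ _ hU).2 ?_⟩, x, y, hxy, rfl, hx⟩
    have := h.weight_eq
    rw [hxy] at hwθ
    simp only [weight_append] at hwθ ⊢
    omega
  choose f hf using hex
  -- The inserted copy leaves the first occurrence in place, so its position can be read off from
  -- the image, and with it the original word.
  have hinj : Function.Injective f := by
    rintro ⟨w, hw⟩ ⟨w', hw'⟩ heq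
    obtain ⟨x, y, rfl, h2, h3⟩ := hf ⟨w, hw⟩
    obtain ⟨x', y', rfl, h5, h6⟩ := hf ⟨w', hw'⟩
    rw [heq, h5] at h2
    have h3' := isFirst_of_append (w := x ++ blk ++ blk ++ y) h3 ⟨blk ++ y, by simp⟩
    have h6' := isFirst_of_append (w := x' ++ blk ++ blk ++ y') h6 ⟨blk ++ y', by simp⟩
    have hl : x.length = x'.length :=
      le_antisymm (h3' x' (blk ++ y') (by rw [← h2]; simp)) (h6' x (blk ++ y) (by rw [h2]; simp))
    simp only [List.append_assoc] at h2
    obtain ⟨rfl, h7⟩ := List.append_inj h2 hl.symm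
    simp only [List.append_cancel_left_eq] at h7
    subst h7
    rfl
  -- The weight forces two consecutive copies at the first occurrence; deleting the second gives the
  -- preimage.
  have hsurj : Function.Surjective f := by
    rintro ⟨w', hw', hQw⟩
    have hwθ := (hQ w' hw').1 hQw
    obtain ⟨x, y, hxy, hx⟩ := h.exists_first_twice (mem_U_iff.1 hw').2 (hph hw') hwθ hle
    have hr : run w' = run (x ++ blk ++ y) := by
      rw [hxy]
      refine h.run_twice (run_foldl_of_append (v := blk ++ y) ?_)
      have := (mem_U_iff.1 hw').2
      rw [hxy] at this
      simpa only [List.append_assoc] using this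
    have hl : w'.length = 3 * (n + 4) := (mem_U_iff.1 hw').1
    have hU : x ++ blk ++ y ∈ U n := by
      refine mem_U_iff.2 ⟨?_, hr ▸ (mem_U_iff.1 hw').2⟩
      rw [hxy] at hl
      simp only [List.length_append] at hl ⊢
      omega
    have hPU : P (x ++ blk ++ y) := by
      refine (hP _ hU).2 ?_
      have := h.weight_eq
      rw [hxy] at hwθ
      simp only [weight_append] at hwθ ⊢
      omega
    refine ⟨⟨_, hU, hPU⟩, Subtype.ext ?_⟩
    obtain ⟨x', y', h1, h2, h3⟩ := hf ⟨_, hU, hPU⟩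
    have hx' : IsFirst blk x (x ++ blk ++ y) :=
      isFirst_of_append (y := blk ++ y) (by rw [hxy] at hx; simpa using hx) ⟨y, rfl⟩
    have hl' : x.length = x'.length := le_antisymm (hx' x' y' h1) (h3 x y rfl)
    simp only [List.append_assoc] at h1
    obtain ⟨rfl, h7⟩ := List.append_inj h1 hl'
    simp only [List.append_cancel_left_eq] at h7
    subst h7
    exact h2.trans hxy.symm
  refine ⟨Equiv.ofBijective f ⟨hinj, hsurj⟩, fun w => ⟨hf w, ?_⟩⟩
  change cellObject _ w.1 = (cellObject _ (f w).1).shift dh dq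
  obtain ⟨x, y, h1, h2, -⟩ := hf w
  obtain ⟨hw1, hw2⟩ := mem_U_iff.1 w.2.1
  obtain ⟨hw1', hw2'⟩ := mem_U_iff.1 (f w).2.1
  have hr := hdup _ w.2.1 x y h1
  rw [← h2] at hr
  rw [cellObject, cellObject, GradedDiagram.shift,
    underlying_eq_of_run_eq hw1 hw1' hw2 hr.symm]
  have o : onesCount (f w).1 = onesCount w.1 + onesCount blk := by
    rw [h1, h2]
    simp only [onesCount, List.countP_append]
    omega
  have b : colorCount .blue (f w).1 = colorCount .blue w.1 + colorCount .blue blk := by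
    rw [h1, h2]
    simp only [colorCount, List.countP_append]
    omega
  congr 1
  · simp only [hdeg, torusBraid_length, o, hdh]
    push_cast
    ring
  · simp only [qdeg, torusBraid_length, o, b, hdq, colorCount_red_of_alive hw2,
      colorCount_red_of_alive hw2']
    push_cast
    ring

theorem qdeg_of_mem_U {n : ℕ} {w : Word} (hw : w ∈ U n) :
    (hdeg (torusBraid n) w : ℝ) = onesCount w - 3 * n ∧
    (qdeg (torusBraid n) w : ℝ) = onesCount w - 6 * n - colorCount .blue w ∧
    (w.length : ℝ) = 3 * n := by
  obtain ⟨h1, h2⟩ := mem_U_iff.1 hw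
  refine ⟨?_, ?_, by rw [h1]; push_cast; ring⟩
  · rw [hdeg, torusBraid_length]
    push_cast
    ring
  · rw [qdeg, torusBraid_length, colorCount_red_of_alive h2]
    push_cast
    ring

/-! ## The three blocks -/

/-- Bounds for the weights of the words that lead to the configurations for `blockA`. -/
def boundsA : List ((ℕ × ℕ × ℕ) × ℤ) := [
  ((0, 0, 0), 0), ((0, 0, 3), 3), ((0, 0, 6), 6), ((0, 0, 9), 9), ((0, 1, 0), 7), ((0, 2, 1), 1),
  ((0, 2, 4), 4), ((0, 2, 7), 7), ((0, 2, 10), 10), ((0, 3, 0), 5), ((0, 4, 0), 8),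
  ((0, 5, 0), 8), ((0, 6, 2), 2), ((0, 6, 5), 5), ((0, 6, 8), 8), ((0, 6, 11), 11),
  ((0, 7, 0), 3), ((0, 8, 0), 6), ((0, 9, 0), 9), ((0, 10, 0), 9), ((0, 11, 0), 9),
  ((0, 12, 0), 9), ((0, 13, 0), 9), ((0, 14, 0), 4), ((0, 15, 0), 7), ((0, 16, 0), 7),
  ((0, 17, 0), 10), ((0, 18, 0), 7), ((0, 19, 0), 10), ((0, 20, 0), 7), ((0, 21, 0), 10),
  ((0, 22, 0), 5), ((0, 23, 0), 5), ((0, 24, 0), 8), ((0, 25, 0), 8), ((0, 26, 0), 11),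
  ((0, 27, 0), 8), ((0, 28, 0), 5), ((0, 29, 0), 8), ((0, 30, 0), 8), ((0, 31, 0), 11),
  ((0, 32, 0), 6), ((0, 33, 0), 6), ((0, 34, 0), 6), ((0, 35, 0), 9), ((0, 36, 0), 6),
  ((0, 37, 0), 9), ((0, 38, 0), 7), ((0, 39, 0), 4), ((0, 40, 0), 7), ((0, 41, 0), 10),
  ((0, 42, 0), 4), ((0, 43, 0), 7), ((0, 44, 0), 7), ((0, 45, 0), 10), ((0, 46, 0), 5),
  ((0, 47, 0), 8), ((0, 48, 0), 5), ((0, 49, 0), 8), ((0, 50, 0), 11), ((0, 51, 0), 5),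
  ((0, 52, 0), 8), ((0, 53, 0), 6), ((0, 54, 0), 6), ((0, 55, 0), 9), ((0, 56, 0), 9),
  ((0, 57, 0), 12), ((0, 58, 0), 6), ((0, 59, 0), 9), ((0, 60, 0), 4), ((0, 61, 0), 7),
  ((0, 62, 0), 10), ((0, 63, 0), 5), ((0, 64, 0), 8), ((0, 65, 0), 8), ((0, 66, 0), 11),
  ((0, 67, 0), 6), ((0, 68, 0), 6), ((0, 69, 0), 9), ((0, 70, 0), 12), ((0, 71, 0), 7),
  ((0, 72, 0), 8), ((1, 0, 0), 12), ((1, 0, 3), 15), ((1, 0, 6), 18), ((1, 0, 9), 21),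
  ((1, 2, 1), 13), ((1, 2, 4), 16), ((1, 2, 7), 19), ((1, 2, 10), 22), ((1, 6, 2), 14),
  ((1, 6, 5), 17), ((1, 6, 8), 20), ((1, 6, 11), 23), ((2, 1, 0), 19), ((2, 3, 0), 17),
  ((2, 4, 0), 20), ((2, 5, 0), 20), ((2, 7, 0), 15), ((2, 8, 0), 18), ((2, 9, 0), 21),
  ((2, 10, 0), 21), ((2, 11, 0), 21), ((2, 12, 0), 21), ((2, 13, 0), 21), ((2, 14, 0), 16),
  ((2, 15, 0), 19), ((2, 16, 0), 19), ((2, 17, 0), 22), ((2, 18, 0), 19), ((2, 19, 0), 22),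
  ((2, 20, 0), 19), ((2, 21, 0), 22), ((2, 22, 0), 17), ((2, 23, 0), 17), ((2, 24, 0), 20),
  ((2, 25, 0), 20), ((2, 26, 0), 23), ((2, 27, 0), 20), ((2, 28, 0), 17), ((2, 29, 0), 20),
  ((2, 30, 0), 20), ((2, 31, 0), 23), ((2, 32, 0), 18), ((2, 33, 0), 18), ((2, 34, 0), 18),
  ((2, 35, 0), 21), ((2, 36, 0), 18), ((2, 37, 0), 21), ((2, 38, 0), 19), ((2, 39, 0), 16),
  ((2, 40, 0), 19), ((2, 41, 0), 22), ((2, 42, 0), 16), ((2, 43, 0), 19), ((2, 44, 0), 19),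
  ((2, 45, 0), 22), ((2, 46, 0), 17), ((2, 47, 0), 20), ((2, 48, 0), 17), ((2, 49, 0), 20),
  ((2, 50, 0), 23), ((2, 51, 0), 17), ((2, 52, 0), 20), ((2, 53, 0), 18), ((2, 54, 0), 18),
  ((2, 55, 0), 21), ((2, 56, 0), 21), ((2, 57, 0), 24), ((2, 58, 0), 18), ((2, 59, 0), 21),
  ((2, 60, 0), 16), ((2, 61, 0), 19), ((2, 62, 0), 22), ((2, 63, 0), 17), ((2, 64, 0), 20),
  ((2, 65, 0), 20), ((2, 66, 0), 23), ((2, 67, 0), 18), ((2, 68, 0), 18), ((2, 69, 0), 21),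
  ((2, 70, 0), 24), ((2, 71, 0), 19), ((2, 72, 0), 20)]

/-- Bounds for the weights of the words that lead to the configurations for `blockB`. -/
def boundsB : List ((ℕ × ℕ × ℕ) × ℤ) := [
  ((0, 0, 0), 0), ((0, 1, 0), 1), ((0, 1, 7), 3), ((0, 2, 1), 0), ((0, 3, 0), 2), ((0, 3, 8), 4),
  ((0, 4, 0), 3), ((0, 5, 2), 1), ((0, 6, 0), 0), ((0, 7, 0), 3), ((0, 7, 9), 5), ((0, 8, 0), 4),
  ((0, 9, 0), 4), ((0, 10, 0), 3), ((0, 11, 0), 2), ((0, 12, 3), 3), ((0, 13, 0), 1),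
  ((0, 14, 0), 3), ((0, 14, 10), 5), ((0, 15, 0), 4), ((0, 16, 0), 4), ((0, 17, 1), 2),
  ((0, 18, 4), 4), ((0, 19, 0), 4), ((0, 20, 0), 4), ((0, 21, 1), 1), ((0, 22, 0), 3),
  ((0, 22, 11), 5), ((0, 23, 0), 5), ((0, 24, 0), 4), ((0, 25, 2), 3), ((0, 26, 0), 2),
  ((0, 27, 5), 4), ((0, 28, 0), 5), ((0, 29, 0), 4), ((0, 30, 2), 2), ((0, 31, 0), 1),
  ((0, 32, 0), 2), ((0, 33, 0), 5), ((0, 34, 0), 5), ((0, 35, 6), 4), ((0, 36, 0), 5),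
  ((0, 37, 3), 2), ((0, 38, 1), 2), ((0, 39, 0), 6), ((0, 40, 0), 5), ((0, 41, 7), 3),
  ((0, 42, 0), 6), ((0, 43, 0), 5), ((0, 44, 4), 3), ((0, 45, 0), 3), ((0, 46, 2), 3),
  ((0, 47, 0), 2), ((0, 48, 0), 6), ((0, 49, 8), 4), ((0, 50, 0), 3), ((0, 51, 0), 6),
  ((0, 52, 5), 3), ((0, 53, 3), 3), ((0, 54, 9), 5), ((0, 55, 0), 4), ((0, 56, 0), 4),
  ((0, 57, 0), 3), ((0, 58, 0), 5), ((0, 59, 6), 3), ((0, 60, 4), 4), ((0, 61, 10), 5),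
  ((0, 62, 7), 2), ((0, 63, 5), 4), ((0, 64, 11), 5), ((0, 65, 8), 3), ((0, 66, 0), 2),
  ((0, 67, 6), 4), ((0, 68, 9), 4), ((0, 69, 0), 3), ((0, 70, 0), 2), ((0, 71, 10), 4),
  ((0, 72, 11), 4), ((1, 1, 7), 5), ((1, 3, 8), 6), ((1, 7, 9), 7), ((1, 11, 0), 4),
  ((1, 12, 3), 5), ((1, 13, 0), 3), ((1, 14, 10), 7), ((1, 17, 1), 4), ((1, 18, 4), 6),
  ((1, 21, 1), 3), ((1, 22, 11), 7), ((1, 25, 2), 5), ((1, 27, 5), 6), ((1, 30, 2), 4),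
  ((1, 32, 0), 4), ((1, 35, 6), 6), ((1, 37, 3), 4), ((1, 38, 1), 4), ((1, 41, 7), 5),
  ((1, 44, 4), 5), ((1, 46, 2), 5), ((1, 49, 8), 6), ((1, 52, 5), 5), ((1, 53, 3), 5),
  ((1, 54, 9), 7), ((1, 59, 6), 5), ((1, 60, 4), 6), ((1, 61, 10), 7), ((1, 62, 7), 4),
  ((1, 63, 5), 6), ((1, 64, 11), 7), ((1, 65, 8), 5), ((1, 67, 6), 6), ((1, 68, 9), 6),
  ((1, 71, 10), 6), ((1, 72, 11), 6), ((2, 4, 0), 5), ((2, 8, 0), 6), ((2, 9, 0), 6),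
  ((2, 10, 0), 5), ((2, 15, 0), 6), ((2, 16, 0), 6), ((2, 19, 0), 6), ((2, 20, 0), 6),
  ((2, 23, 0), 7), ((2, 24, 0), 6), ((2, 26, 0), 4), ((2, 28, 0), 7), ((2, 29, 0), 6),
  ((2, 31, 0), 3), ((2, 33, 0), 7), ((2, 34, 0), 7), ((2, 36, 0), 7), ((2, 39, 0), 8),
  ((2, 40, 0), 7), ((2, 42, 0), 8), ((2, 43, 0), 7), ((2, 45, 0), 5), ((2, 47, 0), 4),
  ((2, 48, 0), 8), ((2, 50, 0), 5), ((2, 51, 0), 8), ((2, 55, 0), 6), ((2, 56, 0), 6),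
  ((2, 57, 0), 5), ((2, 58, 0), 7), ((2, 66, 0), 4), ((2, 69, 0), 5), ((2, 70, 0), 4)]

/-- Bounds for the weights of the words that lead to the configurations for `blockC`. -/
def boundsC : List ((ℕ × ℕ × ℕ) × ℤ) := [
  ((0, 0, 0), 0), ((0, 1, 0), -1), ((0, 2, 0), 0), ((0, 3, 0), -2), ((0, 4, 0), -1),
  ((0, 5, 0), -1), ((0, 6, 0), 0), ((0, 7, 0), -3), ((0, 8, 0), -2), ((0, 9, 0), -2),
  ((0, 10, 0), -1), ((0, 11, 0), 0), ((0, 12, 0), -1), ((0, 13, 0), -1), ((0, 14, 0), -3),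
  ((0, 15, 0), -2), ((0, 16, 0), -1), ((0, 16, 4), 1), ((0, 16, 10), 3), ((0, 17, 0), 0),
  ((0, 18, 0), -2), ((0, 19, 0), -1), ((0, 20, 0), -2), ((0, 20, 4), 0), ((0, 20, 10), 2),
  ((0, 21, 0), -1), ((0, 22, 0), -3), ((0, 23, 0), -2), ((0, 23, 5), 0), ((0, 23, 11), 2),
  ((0, 24, 0), 3), ((0, 25, 0), -1), ((0, 26, 0), 0), ((0, 27, 0), -2), ((0, 28, 0), -3),
  ((0, 28, 5), -1), ((0, 28, 11), 1), ((0, 29, 0), 2), ((0, 30, 0), -2), ((0, 31, 0), -1),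
  ((0, 32, 0), -1), ((0, 33, 0), -2), ((0, 33, 6), 0), ((0, 34, 0), -3), ((0, 34, 3), -1),
  ((0, 34, 9), 1), ((0, 35, 0), -2), ((0, 36, 0), -3), ((0, 36, 6), -1), ((0, 37, 0), -2),
  ((0, 38, 0), -1), ((0, 39, 1), -3), ((0, 39, 7), -1), ((0, 40, 0), 0), ((0, 41, 0), 0),
  ((0, 42, 1), -4), ((0, 42, 7), -2), ((0, 43, 0), -1), ((0, 44, 0), -3), ((0, 45, 0), -2),
  ((0, 46, 0), -2), ((0, 47, 0), -1), ((0, 48, 2), -3), ((0, 48, 8), -1), ((0, 49, 0), -1),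
  ((0, 50, 0), 0), ((0, 51, 2), -4), ((0, 51, 8), -2), ((0, 52, 0), -3), ((0, 53, 0), -2),
  ((0, 54, 0), -2), ((0, 55, 0), -1), ((0, 56, 0), -1), ((0, 57, 0), 0), ((0, 58, 0), -4),
  ((0, 58, 3), -2), ((0, 58, 9), 0), ((0, 59, 0), -3), ((0, 60, 0), -3), ((0, 61, 0), -2),
  ((0, 62, 0), -1), ((0, 63, 0), -3), ((0, 64, 0), -2), ((0, 65, 0), -2), ((0, 66, 0), -1),
  ((0, 67, 0), -3), ((0, 68, 0), -3), ((0, 69, 0), -2), ((0, 70, 0), -1), ((0, 71, 0), -3),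
  ((0, 72, 0), -3), ((1, 16, 4), 5), ((1, 16, 10), 7), ((1, 20, 4), 4), ((1, 20, 10), 6),
  ((1, 23, 5), 4), ((1, 23, 11), 6), ((1, 28, 5), 3), ((1, 28, 11), 5), ((1, 33, 0), 2),
  ((1, 33, 6), 4), ((1, 34, 3), 3), ((1, 34, 9), 5), ((1, 36, 0), 1), ((1, 36, 6), 3),
  ((1, 39, 1), 1), ((1, 39, 7), 3), ((1, 42, 1), 0), ((1, 42, 7), 2), ((1, 48, 2), 1),
  ((1, 48, 8), 3), ((1, 51, 2), 0), ((1, 51, 8), 2), ((1, 58, 3), 2), ((1, 58, 9), 4),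
  ((2, 24, 0), 7), ((2, 29, 0), 6), ((2, 40, 0), 4), ((2, 43, 0), 3)]

/-- On `U n` the weight is `12 * tA + 12`, so the thresholds correspond to the values 1 and 2 of
`tA`. -/
theorem isDuplicable_blockA : IsDuplicable blockA [0] 3 3 (-2) boundsA 24 36 where
  one_lt_length := by decide
  start := by decide
  closed := by decide +kernel
  lt₁ := by decide +kernel
  lt₂ := by decide +kernel
  complete := by decide +kernel
  stable := by decide +kernel
  weight_eq := by decide

/-- Here the weight is `2 * tB + 5` on `U n`. -/
theorem isDuplicable_blockB : IsDuplicable blockB [0, 11, 13, 32] (-1) (-2) 1 boundsB 7 9 where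
  one_lt_length := by decide
  start := by decide
  closed := by decide +kernel
  lt₁ := by decide +kernel
  lt₂ := by decide +kernel
  complete := by decide +kernel
  stable := by decide +kernel
  weight_eq := by decide

/-- Here the weight is `4 * tC + 1` on `U n`. -/
theorem isDuplicable_blockC : IsDuplicable blockC [33, 36] 1 3 (-1) boundsC 5 9 where
  one_lt_length := by decide
  start := by decide
  closed := by decide +kernel
  lt₁ := by decide +kernel
  lt₂ := by decide +kernel
  complete := by decide +kernel
  stable := by decide +kernel
  weight_eq := by decide

end GreedyKhovanov

theorem mainTheorem8 (n : ℕ) :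
    (∃ a : {w : GreedyKhovanov.Word // w ∈ GreedyKhovanov.U n ∧ 1 ≤ GreedyKhovanov.tA n w} ≃
        {w : GreedyKhovanov.Word //
          w ∈ GreedyKhovanov.U (n + 4) ∧ 2 ≤ GreedyKhovanov.tA (n + 4) w},
      ∀ w : {w : GreedyKhovanov.Word // w ∈ GreedyKhovanov.U n ∧ 1 ≤ GreedyKhovanov.tA n w},
        GreedyKhovanov.DuplicatesFirst GreedyKhovanov.blockA w.1 (a w).1 ∧
        GreedyKhovanov.cellObject (GreedyKhovanov.torusBraid n) w.1 =
          (GreedyKhovanov.cellObject (GreedyKhovanov.torusBraid (n + 4)) (a w).1).shift 0 12) ∧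
    (∃ b : {w : GreedyKhovanov.Word // w ∈ GreedyKhovanov.U n ∧ 1 ≤ GreedyKhovanov.tB n w} ≃
        {w : GreedyKhovanov.Word //
          w ∈ GreedyKhovanov.U (n + 4) ∧ 2 ≤ GreedyKhovanov.tB (n + 4) w},
      ∀ w : {w : GreedyKhovanov.Word // w ∈ GreedyKhovanov.U n ∧ 1 ≤ GreedyKhovanov.tB n w},
        GreedyKhovanov.DuplicatesFirst GreedyKhovanov.blockB w.1 (b w).1 ∧
        GreedyKhovanov.cellObject (GreedyKhovanov.torusBraid n) w.1 =
          (GreedyKhovanov.cellObject (GreedyKhovanov.torusBraid (n + 4)) (b w).1).shift 6 20) ∧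
    (∃ c : {w : GreedyKhovanov.Word // w ∈ GreedyKhovanov.U n ∧ 1 ≤ GreedyKhovanov.tC n w} ≃
        {w : GreedyKhovanov.Word //
          w ∈ GreedyKhovanov.U (n + 4) ∧ 2 ≤ GreedyKhovanov.tC (n + 4) w},
      ∀ w : {w : GreedyKhovanov.Word // w ∈ GreedyKhovanov.U n ∧ 1 ≤ GreedyKhovanov.tC n w},
        GreedyKhovanov.DuplicatesFirst GreedyKhovanov.blockC w.1 (c w).1 ∧
        GreedyKhovanov.cellObject (GreedyKhovanov.torusBraid n) w.1 =
          (GreedyKhovanov.cellObject (GreedyKhovanov.torusBraid (n + 4)) (c w).1).shift 8 24) := by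
  refine ⟨?_, ?_, ?_⟩
  · refine GreedyKhovanov.isDuplicable_blockA.exists_equiv (by norm_num) rfl ?_ ?_ (by decide)
      (by decide) <;> exact fun w hw => by
        obtain ⟨h1, h2, h3⟩ := GreedyKhovanov.qdeg_of_mem_U hw
        rw [GreedyKhovanov.tA, h1, h2, GreedyKhovanov.weight, ← Int.cast_le (R := ℝ)]
        push_cast at h3 ⊢
        rw [h3]
        constructor <;> intro h <;> linarith
  · refine GreedyKhovanov.isDuplicable_blockB.exists_equiv (by norm_num) rfl ?_ ?_ (by decide)
      (by decide) <;> exact fun w hw => by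
        obtain ⟨h1, h2, h3⟩ := GreedyKhovanov.qdeg_of_mem_U hw
        rw [GreedyKhovanov.tB, h1, h2, GreedyKhovanov.weight, ← Int.cast_le (R := ℝ)]
        push_cast at h3 ⊢
        rw [h3]
        constructor <;> intro h <;> linarith
  · refine GreedyKhovanov.isDuplicable_blockC.exists_equiv (by norm_num) rfl ?_ ?_ (by decide)
      (by decide) <;> exact fun w hw => by
        obtain ⟨h1, h2, h3⟩ := GreedyKhovanov.qdeg_of_mem_U hw
        rw [GreedyKhovanov.tC, h1, h2, GreedyKhovanov.weight, ← Int.cast_le (R := ℝ)]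
        push_cast at h3 ⊢
        rw [h3]
        constructor <;> intro h <;> linarith
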